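/- Let $p=(p(n))_{n\in\mathbb N}$ be a probability distribution on $\mathbb N=\{0,1,2,\dots\}$ with finite mean $\mu=\sum_n n\,p(n)\in(1,\infty)$, and let $\mathfrak a=\min\{n: p(n)>0\}$, $\mathfrak b=\sup\{n: p(n)>0\}\in\mathbb N\cup\{\infty\}$; assume $\mathfrak a<\mathfrak b$. Let $f(r)=\sum_n p(n)r^n\in[0,\infty]$ for $r\in[0,\infty]$ and let $R_c=\sup\{r\ge 1: f(r)<\infty\}\in[1,\infty]$; assume $f(R_c)=+\infty$ (which holds automatically if $R_c=\infty$). *Setting.* Trees are rooted ordered trees whose vertices have out-degrees $k_u(\mathbf t)\in\mathbb N\cup\{\infty\}$, with $k_u(\mathbf t)=-1$ if $u\notin\mathbf t$; the set of trees carries the topology of convergence of $k_u(\mathbf t)$ in $\{-1,0,1,\dots,\infty\}$ for every finite word $u$ (where $\{-1,0,1,\dots,\infty\}$ is the one-point compactification of a discrete space), and random trees converge in distribution with respect to this topology. Let $\tau$ be the Galton–Watson (GW) tree with offspring distribution $p$, $Z_n$ the size of its $n$-th generation, and $\mathfrak c\in[0,1)$ its extinction probability. Let $(c_n)_{n\ge0}$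 be any Seneta–Heyde norming: a sequence of positive reals such that $(e^{-Z_n/c_n})_n$ is a martingale and $c_0>-1/\log\mathfrak c$ (that is, $e^{-1/c_0}>\mathfrak c$). Let $W=\lim_n Z_n/c_n$ (a.s.), let $w$ be the continuous density of $W$ on $(0,\infty)$, and let $w^{*i}$ be its $i$-fold convolution. *The trees $\tau^\theta$, $0<\theta<\infty$.* For $r\ge1$ and $s\in\{1,2,\dots\}^r$ put $$\rho_{\theta,r}(s)=\mu\,\frac{w^{*(s_1+\dots+s_r)}(\mu\theta)}{w^{*r}(\theta)}\prod_{i=1}^r\frac{f^{(s_i)}(\mathfrak c)}{s_i!}.$$ Let $\mathfrak p(n)=\mathfrak c^{\,n-1}p(n)$ if $\mathfrak c>0$, and let $\mathfrak p$ be the Dirac mass at $\mathfrak a$ if $\mathfrak c=0$; let $\mathfrak p_{[\ell]}(k)=\binom k\ell\frac{\ell!}{f^{(\ell)}(\mathfrak c)}\mathfrak c^{k-\ell}p(k)$ for $k\ge\ell$, whenever $f^{(\ell)}(\mathfrak c)>0$ (with $0^0=1$). Then $\tau^\theta$ is the tree obtained by forgetting the types in the following random tree with vertices of types s and e. The root is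 of type s. Conditionally on the generations up to $h$, with $\mathscr S_h$ the set of vertices of type s in generation $h$: the vertices of type e in generation $h$ have, independently of each other and of the offspring of the vertices of type s, only children of type e, with offspring distribution $\mathfrak p$; the numbers $(s_u)_{u\in\mathscr S_h}$ of type-s children of the vertices of type s have law $\rho_{\mu^h\theta,\,\#\mathscr S_h}$; and, given these numbers, independently for each $u\in\mathscr S_h$, the total number $k_u$ of children of $u$ has law $\mathfrak p_{[s_u]}$ and the $s_u$ children of type s are chosen uniformly among the $k_u$ children, the others being of type e. *The tree $\tau^\infty=T^{(\lambda_c)}$.* Let $\lambda_c=\sup\{\lambda\in\mathbb R:\mathbb E[e^{\lambda W}]<\infty\}\in[0,\infty]$, and let $\zeta_h=\mathbb E[e^{\lambda_c\mu^{-h}W}]\in(0,\infty]$ for $h\in\mathbb N$ (so $\zeta_h=\infty$ for all $h$ if $\lambda_c=\infty$). Then $\tau^\infty$ is the GW tree with independent offspring numbers in which the vertices of generation $h$ have offspring distribution $\tilde p_h(k)=\frac{\zeta_{h+1}^k}{\zeta_h}p(k)$, $k\in\mathbb N$, if $\zeta_h<\infty$, and the Dirac mass at $\mathfrak b\in\mathbb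 N\cup\{\infty\}$ if $\zeta_h=\infty$. **Claim.** If $\tau^\theta$ converges in distribution as $\theta\to\infty$, then the limit is the distribution of $\tau^\infty$. -/

import Mathlib

open MeasureTheory ProbabilityTheory Filter Topology
open scoped ENNReal

noncomputable section

namespace GWTree

/-! ### Plane trees and local convergence -/

/-- Rooted ordered trees, possibly with vertices of infinite out-degree.  A vertex is a finite
word of natural numbers, the root is `[]`, and the children of `u` are `0 :: u, 1 :: u, …`
(letters are numbered from `0`, the most recent letter comes first), so that `u.length` is the
generation of `u`. -/
structure PlaneTree where
  carrier : Set (List ℕ)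
  root_mem : [] ∈ carrier
  parent_mem : ∀ (i : ℕ) (u : List ℕ), i :: u ∈ carrier → u ∈ carrier
  exists_deg : ∀ u ∈ carrier, ∃ k : ℕ∞, ∀ i : ℕ, i :: u ∈ carrier ↔ (i : ℕ∞) < k

open Classical in
/-- The out-degree of `u` in `t`, shifted by one: it is `k_u(t) + 1` if `u` is a vertex of `t`, and
`0` if it is not (where the out-degree is `-1` by convention).  Adding one identifies
`{-1, 0, 1, 2, …, ∞}`, the one-point compactification of a discrete space, with `ℕ∞`. -/
def PlaneTree.code (t : PlaneTree) (u : List ℕ) : ℕ∞ :=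
  if u ∈ t.carrier then {i : ℕ | i :: u ∈ t.carrier}.encard + 1 else 0

/-- The topology of local convergence: `t_n → t` iff all out-degrees converge. -/
instance : TopologicalSpace PlaneTree := TopologicalSpace.induced PlaneTree.code inferInstance

instance : MeasurableSpace PlaneTree := borel PlaneTree

instance : BorelSpace PlaneTree := ⟨rfl⟩

/-- The size `z_n(t)` of generation `n`. -/
def PlaneTree.genSize (n : ℕ) (t : PlaneTree) : ℕ∞ := {u ∈ t.carrier | u.length = n}.encard

/-- The words reached from the root when each word `u` has the `ω u` children
`i :: u`, `i < ω u`. -/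
def Reached (ω : List ℕ → ℕ∞) : List ℕ → Prop
  | [] => True
  | i :: u => Reached ω u ∧ (i : ℕ∞) < ω u

/-- The tree in which each vertex `u` has out-degree `ω u`. -/
def treeOf (ω : List ℕ → ℕ∞) : PlaneTree where
  carrier := {u | Reached ω u}
  root_mem := trivial
  parent_mem := fun _ _ h => h.1
  exists_deg := fun u hu => ⟨ω u, fun _ => ⟨fun h => h.2, fun h => ⟨hu, h⟩⟩⟩

theorem encard_lt (k : ℕ∞) : {i : ℕ | (i : ℕ∞) < k}.encard = k := by
  induction k using ENat.recTopCoe with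
  | top => simp [Set.encard_univ]
  | coe n =>
    have : {i : ℕ | (i : ℕ∞) < (n : ℕ∞)} = (Finset.range n : Set ℕ) := by
      ext i; simp
    rw [this, Set.encard_coe_eq_coe_finsetCard, Finset.card_range]

open Classical in
theorem code_treeOf (ω : List ℕ → ℕ∞) (u : List ℕ) :
    (treeOf ω).code u = if Reached ω u then ω u + 1 else 0 := by
  by_cases h : Reached ω u
  · have h1 : {i : ℕ | i :: u ∈ (treeOf ω).carrier} = {i : ℕ | (i : ℕ∞) < ω u} := by
      ext i; exact ⟨fun h' => h'.2, fun h' => ⟨h, h'⟩⟩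
    have h2 : u ∈ (treeOf ω).carrier := h
    rw [PlaneTree.code, if_pos h2, if_pos h, h1, encard_lt]
  · have h2 : u ∉ (treeOf ω).carrier := h
    rw [PlaneTree.code, if_neg h2, if_neg h]

instance : BorelSpace ℕ∞ := ⟨borel_eq_top_of_countable.symm⟩

theorem measurableSet_reached (u : List ℕ) : MeasurableSet {ω : List ℕ → ℕ∞ | Reached ω u} := by
  induction u with
  | nil => simp [Reached]
  | cons i u ih =>
    exact ih.inter (measurableSet_lt measurable_const (measurable_pi_apply u))

theorem measurable_treeOf : Measurable treeOf := by
  have h : (inferInstance : MeasurableSpace PlaneTree)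
      = MeasurableSpace.comap PlaneTree.code (borel (List ℕ → ℕ∞)) :=
    borel_comap
  rw [← BorelSpace.measurable_eq (α := List ℕ → ℕ∞)] at h
  refine Measurable.mono (?_ : Measurable[_, MeasurableSpace.comap PlaneTree.code _] treeOf)
    le_rfl h.le
  rw [measurable_comap_iff]
  refine measurable_pi_lambda _ fun u => ?_
  classical
  simp only [Function.comp_def, code_treeOf]
  exact Measurable.ite (measurableSet_reached u)
    ((measurable_of_countable (fun k : ℕ∞ => k + 1)).comp (measurable_pi_apply u)) measurable_const

/-! ### Galton-Watson trees -/

open Classical in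
/-- The probability distribution with weights `w`, if these sum to one.  The value in the other
case (the Dirac mass at `a₀`) is irrelevant: the weights below have total mass one in all the cases
that occur. -/
def ofWeights {α : Type*} (w : α → ℝ≥0∞) (a₀ : α) : PMF α :=
  if h : ∑' a, w a = 1 then ⟨w, h ▸ ENNReal.summable.hasSum⟩ else PMF.pure a₀

/-- The law of the Galton-Watson tree in which a vertex of generation `h` has offspring
distribution `q h` on `ℕ ∪ {∞}`, all offspring numbers being independent. -/
def gwLaw (q : ℕ → PMF ℕ∞) : ProbabilityMeasure PlaneTree :=
  ⟨(Measure.infinitePi fun u : List ℕ => (q u.length).toMeasure).map treeOf,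
    Measure.isProbabilityMeasure_map measurable_treeOf.aemeasurable⟩

/-- The law of the Galton-Watson tree `τ` with offspring distribution `p`. -/
def tauLaw (p : PMF ℕ) : ProbabilityMeasure PlaneTree :=
  gwLaw fun _ => p.map (fun n : ℕ => (n : ℕ∞))

/-- The generating function `f(r) = ∑ p(n) r^n`, `r ∈ [0, ∞]`, with values in `[0, ∞]`. -/
def genFun (p : PMF ℕ) (r : ℝ≥0∞) : ℝ≥0∞ := ∑' n, p n * r ^ n

/-- The derivative of order `s` of the generating function, term by term. -/
def genFunDeriv (p : PMF ℕ) (s : ℕ) (r : ℝ≥0∞) : ℝ≥0∞ :=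
  ∑' n, p n * (n.descFactorial s : ℝ≥0∞) * r ^ (n - s)

/-- The radius of convergence `R_c = sup {r ≥ 1 : f(r) < ∞} ∈ [1, ∞]`. -/
def radius (p : PMF ℕ) : ℝ≥0∞ := sSup {r : ℝ≥0∞ | 1 ≤ r ∧ genFun p r < ∞}

/-- The mean `μ`. -/
def mean (p : PMF ℕ) : ℝ≥0∞ := ∑' n, p n * (n : ℝ≥0∞)

/-- The lower bound `𝔞` of the support. -/
def lowerBd (p : PMF ℕ) : ℕ := sInf {n | p n ≠ 0}

/-- The upper bound `𝔟 ∈ ℕ ∪ {∞}` of the support. -/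
def upperBd (p : PMF ℕ) : ℕ∞ := ⨆ n ∈ {n | p n ≠ 0}, (n : ℕ∞)

/-- The extinction probability `𝔠`. -/
def extProb (p : PMF ℕ) : ℝ≥0∞ :=
  (tauLaw p : Measure PlaneTree) {t | ∃ n, t.genSize n = 0}

/-! ### The Seneta-Heyde norming and the limit `W` -/

/-- `c` is a Seneta-Heyde norming: `exp (-Z_n / c_n)` is a martingale (for some filtration,
equivalently for its natural one) and `c_0 > -1 / log 𝔠`, that is, `𝔠 < exp (-1 / c_0)`. -/
def IsSenetaHeyde (p : PMF ℕ) (c : ℕ → ℝ) : Prop :=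
  (∀ n, 0 < c n) ∧ extProb p < ENNReal.ofReal (Real.exp (-1 / c 0)) ∧
    ∃ ℱ : Filtration ℕ (inferInstance : MeasurableSpace PlaneTree),
      Martingale (fun n (t : PlaneTree) => Real.exp (-((t.genSize n).toNat : ℝ) / c n)) ℱ
        (tauLaw p : Measure PlaneTree)

/-- The almost sure limit `W` of `Z_n / c_n`, as a function of the tree. -/
def limW (c : ℕ → ℝ) (t : PlaneTree) : ℝ :=
  (limsup (fun n => ((t.genSize n : ℕ∞) : ℝ≥0∞) / ENNReal.ofReal (c n)) atTop).toReal

/-- The density `w` of `W` on `(0, ∞)`: the derivative of its distribution function. -/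
def dens (p : PMF ℕ) (c : ℕ → ℝ) (x : ℝ) : ℝ≥0∞ :=
  ENNReal.ofReal
    (deriv (fun y => ((tauLaw p : Measure PlaneTree) {t | limW c t ≤ y}).toReal) x)

/-- The convolution powers `w^{*i}` on `(0, ∞)`, `i ≥ 1` (the value at `i = 0` is not used). -/
def densConv (p : PMF ℕ) (c : ℕ → ℝ) : ℕ → ℝ → ℝ≥0∞
  | 0, _ => 0
  | 1, x => dens p c x
  | i + 2, x => ∫⁻ y in Set.Ioo 0 x, densConv p c (i + 1) (x - y) * dens p c y

/-! ### The extremal trees `τ^θ` -/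

/-- `ρ_{θ,r}(s)`, with the `r` coordinates of `s` indexed by the elements of `S`. -/
def rho (p : PMF ℕ) (c : ℕ → ℝ) (θ : ℝ) (S : Finset (List ℕ)) (s : List ℕ → ℕ) : ℝ≥0∞ :=
  mean p * densConv p c (∑ u ∈ S, s u) ((mean p).toReal * θ) / densConv p c S.card θ *
    ∏ u ∈ S, (genFunDeriv p (s u) (extProb p) / ((s u).factorial : ℝ≥0∞))

open Classical in
/-- The offspring distribution `𝔭` of the vertices of type `e`. -/
def extOffspring (p : PMF ℕ) (k : ℕ) : ℝ≥0∞ :=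
  if extProb p = 0 then (if k = lowerBd p then 1 else 0)
    else extProb p ^ k / extProb p * p k

/-- The size-biased distribution `𝔭_{[l]}` of order `l`. -/
def biased (p : PMF ℕ) (l k : ℕ) : ℝ≥0∞ :=
  if l ≤ k then
    (k.choose l : ℝ≥0∞) * (l.factorial : ℝ≥0∞) / genFunDeriv p l (extProb p)
      * extProb p ^ (k - l) * p k
  else 0

/-- One generation of a two-type tree: the finite set of its vertices and the subset of those which
are of type `s` (the others are of type `e`). -/
@[ext] structure TypedGen where
  all : Finset (List ℕ)
  surv : Finset (List ℕ)

instance : MeasurableSpace TypedGen := ⊤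

open Classical in
/-- The number of children of `u` that belong to `V`. -/
def numChildren (u : List ℕ) (V : Finset (List ℕ)) : ℕ :=
  (V.filter fun v => ∃ i, v = i :: u).card

/-- `g'` is a possible next generation of `g`: its vertices are the first `k_u` children of each
vertex `u` of `g`, for some numbers `k_u`; those of type `s` all descend from vertices of type `s`,
and each vertex of type `s` has at least one child of type `s`. -/
def IsNextGen (g g' : TypedGen) : Prop :=
  (∀ v, v ∈ g'.all ↔ ∃ u ∈ g.all, ∃ i < numChildren u g'.all, v = i :: u) ∧
    g'.surv ⊆ g'.all ∧ ∀ u ∈ g.all, (0 < numChildren u g'.surv ↔ u ∈ g.surv)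

open Classical in
/-- The probability that generation `h + 1` of the extremal two-type tree of parameter `θ` is `g'`,
given its first generations up to generation `h`, the latter being `g`.  With `k_u` and `s_u` the
numbers of children and of children of type `s` of `u`: the vertices of type `e` have independent
offspring numbers with law `𝔭`; the family `(s_u)` indexed by the vertices of type `s` has law
`ρ_{μ^h θ, r}` with `r` the number of these vertices; given `(s_u)`, the `k_u` are independent with
laws `𝔭_{[s_u]}`, and the positions of the `s_u` children of type `s` are uniform. -/
def extremalWeight (p : PMF ℕ) (c : ℕ → ℝ) (θ : ℝ) (h : ℕ) (g g' : TypedGen) : ℝ≥0∞ :=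
  if IsNextGen g g' then
      (∏ u ∈ g.all \ g.surv, extOffspring p (numChildren u g'.all)) *
      (rho p c ((mean p).toReal ^ h * θ) g.surv (fun u => numChildren u g'.surv) *
        ∏ u ∈ g.surv,
          (((numChildren u g'.all).choose (numChildren u g'.surv) : ℝ≥0∞)⁻¹ *
            biased p (numChildren u g'.surv) (numChildren u g'.all)))
    else 0

/-- The transition from generation `h` to generation `h + 1` of the extremal two-type tree. -/
def extremalStep (p : PMF ℕ) (c : ℕ → ℝ) (θ : ℝ) (h : ℕ) : Kernel TypedGen TypedGen where
  toFun g := (ofWeights (extremalWeight p c θ h g) ⟨∅, ∅⟩).toMeasure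
  measurable' := measurable_from_top

instance (p : PMF ℕ) (c : ℕ → ℝ) (θ : ℝ) (h : ℕ) : IsMarkovKernel (extremalStep p c θ h) :=
  ⟨fun g => PMF.toMeasure.isProbabilityMeasure
    (ofWeights (extremalWeight p c θ h g) ⟨∅, ∅⟩)⟩

/-- The same transition, from the whole past up to generation `h`. -/
def extremalKernel (p : PMF ℕ) (c : ℕ → ℝ) (θ : ℝ) (h : ℕ) :
    Kernel ((i : Finset.Iic h) → (fun _ : ℕ => TypedGen) i) TypedGen :=
  (extremalStep p c θ h).comap (fun x => x ⟨h, Finset.mem_Iic.2 le_rfl⟩) (measurable_pi_apply _)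

instance (p : PMF ℕ) (c : ℕ → ℝ) (θ : ℝ) (h : ℕ) : IsMarkovKernel (extremalKernel p c θ h) := by
  unfold extremalKernel; infer_instance

/-- The law of the successive generations of the extremal two-type tree `τ̂^θ`, whose root is of
type `s`. -/
def extremalPathLaw (p : PMF ℕ) (c : ℕ → ℝ) (θ : ℝ) : Measure (ℕ → TypedGen) :=
  Kernel.traj (X := fun _ => TypedGen) (extremalKernel p c θ) 0 (fun _ => ⟨{[]}, {[]}⟩)

/-- The skeleton of a two-type tree: the types are forgotten. -/
def skeleton (x : ℕ → TypedGen) : PlaneTree :=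
  treeOf fun u => (numChildren u (x (u.length + 1)).all : ℕ∞)

theorem measurable_skeleton : Measurable skeleton := by
  refine measurable_treeOf.comp (measurable_pi_lambda _ fun u => ?_)
  have h : Measurable (fun g : TypedGen => (numChildren u g.all : ℕ∞)) := measurable_from_top
  exact h.comp (measurable_pi_apply _)

/-- The law of the extremal tree `τ^θ`, `θ ∈ (0, ∞)`. -/
def extremalLaw (p : PMF ℕ) (c : ℕ → ℝ) (θ : ℝ) : ProbabilityMeasure PlaneTree :=
  ⟨(extremalPathLaw p c θ).map skeleton, by
    have : IsProbabilityMeasure (extremalPathLaw p c θ) := by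
      unfold extremalPathLaw; infer_instance
    exact Measure.isProbabilityMeasure_map measurable_skeleton.aemeasurable⟩

/-! ### The trees `T^(λ)` and `τ^∞` -/

/-- `ζ_h(l) = E[exp (l μ^{-h} W)]` for `l ∈ [-∞, ∞]`, with `(±∞) · 0 = 0`, `exp (-∞) = 0` and
`exp (+∞) = ∞`. -/
def expMoment (p : PMF ℕ) (c : ℕ → ℝ) (l : EReal) (h : ℕ) : ℝ≥0∞ :=
  ∫⁻ t, EReal.exp (l * ((((mean p).toReal ^ h)⁻¹ * limW c t : ℝ) : EReal))
    ∂(tauLaw p : Measure PlaneTree)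

/-- `λ_c = sup {l ∈ ℝ : E[exp (l W)] < ∞} ∈ [0, ∞]`. -/
def lambdaC (p : PMF ℕ) (c : ℕ → ℝ) : EReal :=
  sSup ((fun l : ℝ => (l : EReal)) '' {l : ℝ | expMoment p c l 0 < ∞})

open Classical in
/-- The offspring distribution at generation `h` of `T^(l)`, `l ∈ [-∞, λ_c]`. -/
def tiltedOffspring (p : PMF ℕ) (c : ℕ → ℝ) (l : EReal) (h : ℕ) : PMF ℕ∞ :=
  if expMoment p c l h = ∞ then PMF.pure (upperBd p)
    else if expMoment p c l h = 0 then PMF.pure (lowerBd p : ℕ∞)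
    else PMF.map (fun n : ℕ => (n : ℕ∞))
      (ofWeights (fun k : ℕ => expMoment p c l (h + 1) ^ k / expMoment p c l h * p k) 0)

/-- The law of `T^(l)`. -/
def tiltedLaw (p : PMF ℕ) (c : ℕ → ℝ) (l : EReal) : ProbabilityMeasure PlaneTree :=
  gwLaw (tiltedOffspring p c l)

/-- The law of `τ^∞ = T^(λ_c)`. -/
def tauInftyLaw (p : PMF ℕ) (c : ℕ → ℝ) : ProbabilityMeasure PlaneTree :=
  tiltedLaw p c (lambdaC p c)

end GWTree

end

noncomputable section

namespace GWTree

/-! ### Sums over the possible next generations -/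

/-! The tree τ^θ plays the role of τ conditioned on W = θ, and the trees T^(l) are mixtures of the
τ^θ. If l ≥ 0 and E[exp(lW)] < ∞, then for every event E constraining finitely many vertices,
E[exp(lW)] P(T^(l) ∈ E) equals the integral over θ > 0 of exp(lθ) w(θ) P(τ^θ ∈ E), plus a term
between 0 and 𝔠 due to extinct trees (`IsSenetaHeyde.lintegral_exp_mul_extremalLaw`).

Let l increase to λ_c. Then exp(lK) / E[exp(lW)] tends to 0 for each K
(`IsSenetaHeyde.tendsto_exp_div_lap`), so the mixing measure escapes to θ = ∞ and a limit ν of τ^θ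
is also the limit of T^(l) (`IsSenetaHeyde.tendsto_tiltedLaw`). On the other hand the offspring laws
of T^(l) converge, generation by generation, to those of T^(λ_c)
(`IsSenetaHeyde.tendsto_tiltedOffspring`). The two limits agree on clopen events that generate the
σ-algebra, hence ν is the law of τ^∞.

The blow-up f(R_c) = ∞ enters twice. It gives R_c > 1, so that p and then W have exponential moments
and λ_c > 0. It also gives E[exp(λ_c W)] = ∞ (`IsSenetaHeyde.expMoment_lambdaC`): by the functional
equation f(E[exp(lW)]) = E[exp(μlW)], finiteness at λ_c would extend beyond λ_c.

The mixture formula is proved by Laplace transforms in θ. If φ is the transform of w, then f(𝔠 +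
φ(l)) = 𝔠 + φ(μl). Expanding the left side over the two types of children shows that the densities
of successive generations are consistent after transformation, hence for almost every θ, which
suffices because θ is integrated out. For the same reason w matters only up to null sets. That W has
a density on (0, ∞) follows from the integrability of the characteristic function of x P(W ∈ dx). -/

theorem tsum_pi_prod {ι : Type*} [Fintype ι] {D : Type*} (h : ι → D → ℝ≥0∞) :
    ∑' d : ι → D, ∏ u, h u (d u) = ∏ u, ∑' x, h u x := by
  refine Fintype.induction_empty_option
    (P := fun ι _ => ∀ h : ι → D → ℝ≥0∞, ∑' d : ι → D, ∏ u, h u (d u) = ∏ u, ∑' x, h u x)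
    ?_ ?_ ?_ ι h
  · intro α β _ e ih h
    let := Fintype.ofEquiv β e.symm
    rw [← e.prod_comp (fun u => ∑' x, h u x), ← ih (fun a => h (e a)),
      ← (Equiv.arrowCongr e (Equiv.refl D)).tsum_eq]
    refine tsum_congr fun d => ?_
    rw [← e.prod_comp]
    simp [Equiv.arrowCongr]
  · intro h
    simp
  · intro α _ ih h
    rw [Fintype.prod_option, ← ih, ← ENNReal.tsum_mul_right,
      ← (Equiv.piOptionEquivProd (β := fun _ : Option α => D)).symm.tsum_eq, ENNReal.tsum_prod']
    refine tsum_congr fun x => ?_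
    rw [← ENNReal.tsum_mul_left]
    refine tsum_congr fun d => ?_
    rw [Fintype.prod_option]
    rfl

theorem numChildren_eq {u : List ℕ} {V : Finset (List ℕ)} {S : Finset ℕ}
    (h : ∀ i, i :: u ∈ V ↔ i ∈ S) : numChildren u V = S.card := by
  classical
  have : (V.filter fun v => ∃ i, v = i :: u) = S.image (fun i => i :: u) := by
    ext v
    simp only [Finset.mem_filter, Finset.mem_image]
    constructor
    · rintro ⟨hv, i, rfl⟩
      exact ⟨i, (h i).1 hv, rfl⟩
    · rintro ⟨i, hi, rfl⟩
      exact ⟨(h i).2 hi, i, rfl⟩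
  rw [numChildren, ← Finset.card_image_of_injective S (f := fun i => i :: u) fun i j hij => by
    simpa using hij, ← this]

/-- The next generation in which `u ∈ g.all` has `(d u).1` children, those of type `s` being at the
positions `(d u).2`. -/
def spread (g : TypedGen) (d : g.all → ℕ × Finset ℕ) : TypedGen where
  all := Finset.univ.biUnion fun u => (Finset.range (d u).1).image fun i => i :: (u : List ℕ)
  surv := Finset.univ.biUnion fun u => (d u).2.image fun i => i :: (u : List ℕ)

/-- The children described by `d` are compatible with the types of their parents. -/
def Compatible (g : TypedGen) (d : g.all → ℕ × Finset ℕ) : Prop :=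
  ∀ u, (d u).2 ⊆ Finset.range (d u).1 ∧ ((d u).2.Nonempty ↔ (u : List ℕ) ∈ g.surv)

theorem cons_mem_spread_all {g : TypedGen} {d : g.all → ℕ × Finset ℕ} (u : g.all) (i : ℕ) :
    i :: (u : List ℕ) ∈ (spread g d).all ↔ i ∈ Finset.range (d u).1 := by
  simp only [spread, Finset.mem_biUnion, Finset.mem_univ, true_and, Finset.mem_image]
  constructor
  · rintro ⟨v, j, hj, h⟩
    obtain ⟨rfl, h'⟩ := List.cons_eq_cons.1 h
    obtain rfl := Subtype.ext h'
    exact hj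
  · exact fun h => ⟨u, i, h, rfl⟩

theorem cons_mem_spread_surv {g : TypedGen} {d : g.all → ℕ × Finset ℕ} (u : g.all) (i : ℕ) :
    i :: (u : List ℕ) ∈ (spread g d).surv ↔ i ∈ (d u).2 := by
  simp only [spread, Finset.mem_biUnion, Finset.mem_univ, true_and, Finset.mem_image]
  constructor
  · rintro ⟨v, j, hj, h⟩
    obtain ⟨rfl, h'⟩ := List.cons_eq_cons.1 h
    obtain rfl := Subtype.ext h'
    exact hj
  · exact fun h => ⟨u, i, h, rfl⟩

theorem numChildren_spread_all {g : TypedGen} {d : g.all → ℕ × Finset ℕ} (u : g.all) :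
    numChildren u (spread g d).all = (d u).1 := by
  rw [numChildren_eq (cons_mem_spread_all u), Finset.card_range]

theorem numChildren_spread_surv {g : TypedGen} {d : g.all → ℕ × Finset ℕ} (u : g.all) :
    numChildren u (spread g d).surv = (d u).2.card :=
  numChildren_eq (cons_mem_spread_surv u)

theorem isNextGen_spread {g : TypedGen} {d : g.all → ℕ × Finset ℕ} (hd : Compatible g d) :
    IsNextGen g (spread g d) := by
  refine ⟨fun v => ⟨fun hv => ?_, ?_⟩, fun v hv => ?_, fun u hu => ?_⟩
  · obtain ⟨u, -, hu⟩ := Finset.mem_biUnion.1 hv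
    obtain ⟨i, hi, rfl⟩ := Finset.mem_image.1 hu
    exact ⟨u, u.2, i, by simpa [numChildren_spread_all] using hi, rfl⟩
  · rintro ⟨u, hu, i, hi, rfl⟩
    rw [cons_mem_spread_all ⟨u, hu⟩, Finset.mem_range, ← numChildren_spread_all]
    exact hi
  · obtain ⟨u, -, hu⟩ := Finset.mem_biUnion.1 hv
    obtain ⟨i, hi, rfl⟩ := Finset.mem_image.1 hu
    exact (cons_mem_spread_all u i).2 ((hd u).1 hi)
  · rw [numChildren_spread_surv ⟨u, hu⟩, Finset.card_pos]
    exact (hd ⟨u, hu⟩).2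

open Classical in
theorem spread_surjective {g g' : TypedGen} (h : IsNextGen g g') :
    ∃ d, Compatible g d ∧ spread g d = g' := by
  obtain ⟨h1, h2, h3⟩ := h
  let d : g.all → ℕ × Finset ℕ := fun u => (numChildren u g'.all,
    (Finset.range (numChildren u g'.all)).filter fun i => i :: (u : List ℕ) ∈ g'.surv)
  have hall : ∀ u ∈ g.all, ∀ i, i :: u ∈ g'.all ↔ i < numChildren u g'.all := by
    intro u hu i
    rw [h1]
    constructor
    · rintro ⟨v, hv, j, hj, h⟩
      obtain ⟨rfl, rfl⟩ := List.cons_eq_cons.1 h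
      exact hj
    · exact fun hi => ⟨u, hu, i, hi, rfl⟩
  have hsurv : ∀ u : g.all, ∀ i, i :: (u : List ℕ) ∈ g'.surv ↔ i ∈ (d u).2 := by
    intro u i
    simp only [d, Finset.mem_filter, Finset.mem_range]
    exact ⟨fun h => ⟨(hall u u.2 i).1 (h2 h), h⟩, fun h => h.2⟩
  refine ⟨d, fun u => ⟨Finset.filter_subset _ _, ?_⟩, ?_⟩
  · rw [← h3 u u.2, numChildren_eq (hsurv u), Finset.card_pos]
  · ext v
    · constructor
      · intro hv
        obtain ⟨u, -, hu⟩ := Finset.mem_biUnion.1 hv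
        obtain ⟨i, hi, rfl⟩ := Finset.mem_image.1 hu
        exact (hall u u.2 i).2 (Finset.mem_range.1 hi)
      · intro hv
        obtain ⟨u, hu, i, hi, rfl⟩ := (h1 v).1 hv
        exact (cons_mem_spread_all (d := d) ⟨u, hu⟩ i).2 (Finset.mem_range.2 hi)
    · constructor
      · intro hv
        obtain ⟨u, -, hu⟩ := Finset.mem_biUnion.1 hv
        obtain ⟨i, hi, rfl⟩ := Finset.mem_image.1 hu
        exact (hsurv u i).2 hi
      · intro hv
        obtain ⟨u, hu, i, hi, rfl⟩ := (h1 v).1 (h2 hv)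
        exact (cons_mem_spread_surv (d := d) ⟨u, hu⟩ i).2 ((hsurv ⟨u, hu⟩ i).1 hv)

theorem spread_injective (g : TypedGen) : Function.Injective (spread g) := by
  intro d d' h
  funext u
  refine Prod.ext ?_ ?_
  · rw [← numChildren_spread_all (d := d), ← numChildren_spread_all (d := d'), h]
  · ext i
    rw [← cons_mem_spread_surv (d := d), ← cons_mem_spread_surv (d := d'), h]

open Classical in
-- The map `spread g` is a bijection from the compatible families onto the possible next
-- generations, so the sum can be taken over choices made vertex by vertex.
theorem tsum_isNextGen (g : TypedGen) (Φ : TypedGen → ℝ≥0∞) :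
    ∑' g', (if IsNextGen g g' then Φ g' else 0)
      = ∑' d, if Compatible g d then Φ (spread g d) else 0 := by
  refine tsum_eq_tsum_of_ne_zero_bij (fun d => spread g d.1)
    (fun x y hxy => Subtype.ext (spread_injective g hxy)) ?_ ?_
  · intro g' hg'
    have h : IsNextGen g g' := by
      by_contra h
      simp [h] at hg'
    obtain ⟨d, hd, rfl⟩ := spread_surjective h
    refine ⟨⟨d, ?_⟩, rfl⟩
    rw [Function.mem_support, if_pos h] at hg'
    rwa [Function.mem_support, if_pos hd]
  · rintro ⟨d, hd⟩
    have : Compatible g d := by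
      by_contra h
      simp [h] at hd
    simp [this, isNextGen_spread this]

/-! ### Product weights on typed generations. -/

open Classical in
/-- The weight `∏ γ_u(k_u)` of a transition between two typed generations. -/
def stepWeight (γ : List ℕ → ℕ → ℝ≥0∞) (g g' : TypedGen) : ℝ≥0∞ :=
  if IsNextGen g g' then ∏ u ∈ g.all, γ u (numChildren u g'.all) else 0

open Classical in
/-- The product of the weights `b v` of the vertices of type `s` and `a v` of the other ones. -/
def colorProd (a b : List ℕ → ℝ≥0∞) (g : TypedGen) : ℝ≥0∞ :=
  ∏ v ∈ g.all, if v ∈ g.surv then b v else a v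

/-- The total weight of the offspring of `u`, with weights `a`. -/
def branch (γ : List ℕ → ℕ → ℝ≥0∞) (a : List ℕ → ℝ≥0∞) (u : List ℕ) : ℝ≥0∞ :=
  ∑' k, γ u k * ∏ i ∈ Finset.range k, a (i :: u)

open Classical in
/-- The total weight of the offspring of `u` with at least one child of type `s`. -/
def survBranch (γ : List ℕ → ℕ → ℝ≥0∞) (a b : List ℕ → ℝ≥0∞) (u : List ℕ) : ℝ≥0∞ :=
  ∑' k, γ u k * ∑ S ∈ (Finset.range k).powerset.erase ∅,
    ∏ i ∈ Finset.range k, if i ∈ S then b (i :: u) else a (i :: u)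

/-- Expanding ∏ (a + b) over the children yields a sum over the sets S of children that receive `b`.
The term S = ∅ is `branch γ a u`. -/
theorem branch_add_survBranch (γ : List ℕ → ℕ → ℝ≥0∞) (a b : List ℕ → ℝ≥0∞) (u : List ℕ) :
    branch γ a u + survBranch γ a b u = branch γ (a + b) u := by
  classical
  rw [branch, survBranch, branch, ← ENNReal.tsum_add]
  refine tsum_congr fun k => ?_
  rw [← mul_add]
  congr 1
  have h : ∀ S ∈ (Finset.range k).powerset,
      (∏ i ∈ Finset.range k, if i ∈ S then b (i :: u) else a (i :: u))
        = (∏ i ∈ S, b (i :: u)) * ∏ i ∈ Finset.range k \ S, a (i :: u) := by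
    intro S hS
    rw [Finset.prod_ite, Finset.filter_mem_eq_inter,
      Finset.inter_eq_right.2 (Finset.mem_powerset.1 hS), Finset.filter_notMem_eq_sdiff]
  have h0 : ∏ i ∈ Finset.range k, a (i :: u)
      = ∏ i ∈ Finset.range k, if i ∈ (∅ : Finset ℕ) then b (i :: u) else a (i :: u) := by simp
  rw [h0, Finset.add_sum_erase _ (fun S => ∏ i ∈ Finset.range k,
    if i ∈ S then b (i :: u) else a (i :: u)) (Finset.empty_mem_powerset _), Finset.sum_congr rfl h]
  simp only [Pi.add_apply, add_comm (a _)]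
  rw [Finset.prod_add]

open Classical in
-- This is the branching property. The sum factorises over the vertices of `g`: a vertex of type e
-- only allows S = ∅, which gives `branch`, and one of type s only allows S ≠ ∅, which gives
-- `survBranch`.
theorem tsum_stepWeight_mul_colorProd (γ : List ℕ → ℕ → ℝ≥0∞) (a b : List ℕ → ℝ≥0∞)
    (g : TypedGen) :
    ∑' g', stepWeight γ g g' * colorProd a b g'
      = colorProd (branch γ a) (survBranch γ a b) g := by
  have h1 : ∀ g', stepWeight γ g g' * colorProd a b g' = if IsNextGen g g' then
      (∏ u ∈ g.all, γ u (numChildren u g'.all)) * colorProd a b g' else 0 := by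
    intro g'
    rw [stepWeight, ite_mul, zero_mul]
  let w : g.all → ℕ × Finset ℕ → ℝ≥0∞ := fun u x =>
    if x.2 ⊆ Finset.range x.1 ∧ (x.2.Nonempty ↔ (u : List ℕ) ∈ g.surv) then
      γ u x.1 * ∏ i ∈ Finset.range x.1, (if i ∈ x.2 then b (i :: u) else a (i :: u)) else 0
  have h2 : ∀ d : g.all → ℕ × Finset ℕ, (if Compatible g d then
      (∏ u ∈ g.all, γ u (numChildren u (spread g d).all)) * colorProd a b (spread g d) else 0)
      = ∏ u, w u (d u) := by
    intro d
    split_ifs with hd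
    · have e1 : ∀ u, w u (d u) = γ u (d u).1 * ∏ i ∈ Finset.range (d u).1,
          (if i ∈ (d u).2 then b (i :: u) else a (i :: u)) := fun u => if_pos (hd u)
      simp only [e1]
      rw [Finset.prod_mul_distrib, ← Finset.prod_coe_sort]
      congr 1
      · exact Finset.prod_congr rfl fun u _ => by rw [numChildren_spread_all]
      · rw [colorProd]
        conv_lhs => rw [spread]
        simp only
        rw [Finset.prod_biUnion]
        · refine Finset.prod_congr rfl fun u _ => ?_
          rw [Finset.prod_image (fun i _ j _ hij => by simpa using hij)]
          refine Finset.prod_congr rfl fun i _ => ?_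
          have := cons_mem_spread_surv (d := d) u i
          rw [spread] at this
          simp only at this
          simp only [this]
        · intro u _ v _ huv
          rw [Function.onFun, Finset.disjoint_left]
          intro x hx hy
          obtain ⟨i, -, rfl⟩ := Finset.mem_image.1 hx
          obtain ⟨j, -, h⟩ := Finset.mem_image.1 hy
          exact huv (Subtype.ext (List.cons_eq_cons.1 h).2.symm)
    -- A vertex at which compatibility fails contributes a zero factor `w`.
    · rw [Compatible] at hd
      push Not at hd
      obtain ⟨u, hu⟩ := hd
      refine (Finset.prod_eq_zero (Finset.mem_univ u) (if_neg fun h => ?_)).symm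
      rcases hu h.1 with h' | h'
      · exact h'.2 (h.2.1 h'.1)
      · exact (h.2.2 h'.2).ne_empty h'.1
  rw [tsum_congr h1, tsum_isNextGen, tsum_congr h2, tsum_pi_prod, colorProd,
    ← Finset.prod_coe_sort g.all]
  refine Finset.prod_congr rfl fun u _ => ?_
  rw [ENNReal.tsum_prod']
  split_ifs with hu
  · rw [survBranch]
    refine tsum_congr fun k => ?_
    rw [tsum_eq_sum (s := (Finset.range k).powerset.erase ∅), Finset.mul_sum]
    · refine Finset.sum_congr rfl fun S hS => if_pos ?_
      rw [Finset.mem_erase, Finset.mem_powerset] at hS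
      simp [hS.2, hu, Finset.nonempty_iff_ne_empty, hS.1]
    · intro S hS
      refine if_neg fun h => hS ?_
      rw [Finset.mem_erase, Finset.mem_powerset, ← Finset.nonempty_iff_ne_empty]
      exact ⟨h.2.2 hu, h.1⟩
  · rw [branch]
    refine tsum_congr fun k => ?_
    rw [tsum_eq_single ∅]
    · simp [w, hu]
    · intro S hS
      refine if_neg fun h => hu (h.2.1 (Finset.nonempty_iff_ne_empty.2 hS))

/-! ### Clopen events determining the law of a tree -/

/-- The trees in which every `u ∈ F` is a vertex whose out-degree belongs to `C u`. -/
def boxEvent (F : Finset (List ℕ)) (C : List ℕ → Set ℕ∞) : Set PlaneTree :=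
  {t | ∀ u ∈ F, ∃ k ∈ C u, t.code u = k + 1}

/-- The constraints `C` on the out-degrees are clopen, trivial outside `F`, and force the elements
of `F` to be vertices. -/
structure IsFramed (F : Finset (List ℕ)) (C : List ℕ → Set ℕ∞) : Prop where
  isClopen : ∀ u, IsClopen (C u)
  eq_univ : ∀ u ∉ F, C u = Set.univ
  mem_parent : ∀ i u, i :: u ∈ F → u ∈ F
  lt_of_mem : ∀ i u, i :: u ∈ F → ∀ k ∈ C u, (i : ℕ∞) < k

/-- The space ℕ∞ is the disjoint union of the images of C and of its complement, which are compact,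
and of {0}. -/
theorem isClopen_image_add_one {C : Set ℕ∞} (hC : IsClopen C) :
    IsClopen ((fun k : ℕ∞ => k + 1) '' C) := by
  have hcont : Continuous fun k : ℕ∞ => k + 1 := by fun_prop
  refine ⟨(hC.1.isCompact.image hcont).isClosed, ?_⟩
  have : (fun k : ℕ∞ => k + 1) '' C = ((fun k : ℕ∞ => k + 1) '' Cᶜ ∪ {0})ᶜ := by
    ext x
    simp only [Set.mem_image, Set.mem_compl_iff, Set.mem_union, Set.mem_singleton_iff]
    constructor
    · rintro ⟨k, hk, rfl⟩ (⟨l, hl, h⟩ | h)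
      · exact hl (by rwa [(ENat.add_left_injective_of_ne_top ENat.one_ne_top) h])
      · simp at h
    · intro h
      push Not at h
      obtain ⟨k, rfl⟩ : ∃ k, x = k + 1 := ⟨x - 1, by
        rw [tsub_add_cancel_of_le (Order.one_le_iff_ne_zero.2 h.2)]⟩
      refine ⟨k, by_contra fun hk => h.1 k hk rfl, rfl⟩
  rw [this, isOpen_compl_iff]
  exact (hC.compl.1.isCompact.image hcont).isClosed.union isClosed_singleton

theorem continuous_code (u : List ℕ) : Continuous fun t : PlaneTree => t.code u :=
  (continuous_apply u).comp (continuous_induced_dom (f := PlaneTree.code))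

theorem isClopen_boxEvent {F : Finset (List ℕ)} {C : List ℕ → Set ℕ∞}
    (hC : ∀ u, IsClopen (C u)) : IsClopen (boxEvent F C) := by
  have : boxEvent F C = ⋂ u ∈ F, (fun t : PlaneTree => t.code u) ⁻¹'
      ((fun k : ℕ∞ => k + 1) '' C u) := by
    ext t
    simp [boxEvent, eq_comm]
  rw [this]
  exact Set.Finite.isClopen_biInter F.finite_toSet fun u _ =>
    (isClopen_image_add_one (hC u)).preimage (continuous_code u)

theorem treeOf_mem_boxEvent_iff {F : Finset (List ℕ)} {C : List ℕ → Set ℕ∞} {ω : List ℕ → ℕ∞} :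
    treeOf ω ∈ boxEvent F C ↔ ∀ u ∈ F, Reached ω u ∧ ω u ∈ C u := by
  classical
  refine forall₂_congr fun u _ => ?_
  rw [code_treeOf]
  constructor
  · rintro ⟨k, hk, h⟩
    split_ifs at h with hr
    · exact ⟨hr, by rwa [(ENat.add_left_injective_of_ne_top ENat.one_ne_top) h]⟩
    · exact absurd h.symm (by simp)
  · rintro ⟨hr, h⟩
    exact ⟨ω u, h, if_pos hr⟩

theorem IsFramed.reached {F : Finset (List ℕ)} {C : List ℕ → Set ℕ∞} (hF : IsFramed F C)
    {ω : List ℕ → ℕ∞} (h : ∀ u, Reached ω u → ω u ∈ C u) : ∀ u ∈ F, Reached ω u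
  | [], _ => trivial
  | i :: u, hu =>
    have hr := hF.reached h u (hF.mem_parent i u hu)
    ⟨hr, hF.lt_of_mem i u hu _ (h u hr)⟩

theorem IsFramed.treeOf_mem_iff {F : Finset (List ℕ)} {C : List ℕ → Set ℕ∞} (hF : IsFramed F C)
    {ω : List ℕ → ℕ∞} : treeOf ω ∈ boxEvent F C ↔ ∀ u, Reached ω u → ω u ∈ C u := by
  rw [treeOf_mem_boxEvent_iff]
  constructor
  · intro h u hu
    by_cases huF : u ∈ F
    · exact (h u huF).2
    · rw [hF.eq_univ u huF]; trivial
  · exact fun h u hu => ⟨hF.reached h u hu, h u (hF.reached h u hu)⟩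

/-- Being reached is automatic for the words of F, so the event is a product set in `ω` and its
probability under a Galton-Watson law is a finite product. -/
theorem IsFramed.treeOf_mem_iff_forall_mem {F : Finset (List ℕ)} {C : List ℕ → Set ℕ∞}
    (hF : IsFramed F C) {ω : List ℕ → ℕ∞} : treeOf ω ∈ boxEvent F C ↔ ∀ u ∈ F, ω u ∈ C u := by
  refine ⟨fun h u hu => (treeOf_mem_boxEvent_iff.1 h u hu).2, fun h => hF.treeOf_mem_iff.2 ?_⟩
  intro u _
  by_cases huF : u ∈ F
  · exact h u huF
  · rw [hF.eq_univ u huF]; trivial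

theorem IsFramed.inter {F F' : Finset (List ℕ)} {C C' : List ℕ → Set ℕ∞} (hF : IsFramed F C)
    (hF' : IsFramed F' C') : IsFramed (F ∪ F') fun u => C u ∩ C' u where
  isClopen u := (hF.isClopen u).inter (hF'.isClopen u)
  eq_univ u hu := by
    rw [Finset.mem_union, not_or] at hu
    rw [hF.eq_univ u hu.1, hF'.eq_univ u hu.2, Set.inter_univ]
  mem_parent i u hu := by
    rcases Finset.mem_union.1 hu with h | h
    · exact Finset.mem_union_left _ (hF.mem_parent i u h)
    · exact Finset.mem_union_right _ (hF'.mem_parent i u h)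
  lt_of_mem i u hu k hk := by
    rcases Finset.mem_union.1 hu with h | h
    · exact hF.lt_of_mem i u h k hk.1
    · exact hF'.lt_of_mem i u h k hk.2

theorem boxEvent_inter {F F' : Finset (List ℕ)} {C C' : List ℕ → Set ℕ∞} (hF : IsFramed F C)
    (hF' : IsFramed F' C') :
    boxEvent F C ∩ boxEvent F' C' = boxEvent (F ∪ F') fun u => C u ∩ C' u := by
  have hmem : ∀ (t : PlaneTree) (u : List ℕ) (k : ℕ∞), t.code u = k + 1 →
      ∀ l, t.code u = l + 1 → l = k := fun t u k hk l hl =>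
    (ENat.add_left_injective_of_ne_top ENat.one_ne_top) (hl.symm.trans hk)
  ext t
  constructor
  · rintro ⟨h, h'⟩ u hu
    by_cases h1 : u ∈ F
    · obtain ⟨k, hk, e⟩ := h u h1
      refine ⟨k, ⟨hk, ?_⟩, e⟩
      by_cases h2 : u ∈ F'
      · obtain ⟨l, hl, e'⟩ := h' u h2
        rwa [← hmem t u k e l e']
      · rw [hF'.eq_univ u h2]; trivial
    · have h2 : u ∈ F' := (Finset.mem_union.1 hu).resolve_left h1
      obtain ⟨k, hk, e⟩ := h' u h2
      exact ⟨k, ⟨by rw [hF.eq_univ u h1]; trivial, hk⟩, e⟩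
  · intro h
    refine ⟨fun u hu => ?_, fun u hu => ?_⟩
    · obtain ⟨k, hk, e⟩ := h u (Finset.mem_union_left _ hu)
      exact ⟨k, hk.1, e⟩
    · obtain ⟨k, hk, e⟩ := h u (Finset.mem_union_right _ hu)
      exact ⟨k, hk.2, e⟩

/-- The class of all framed events. -/
def framedEvents : Set (Set PlaneTree) := {E | ∃ F C, IsFramed F C ∧ E = boxEvent F C}

theorem isPiSystem_framedEvents : IsPiSystem framedEvents := by
  rintro _ ⟨F, C, hF, rfl⟩ _ ⟨F', C', hF', rfl⟩ _
  exact ⟨_, _, hF.inter hF', boxEvent_inter hF hF'⟩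

theorem isClopen_natCast_lt (i : ℕ) : IsClopen {k : ℕ∞ | (i : ℕ∞) < k} := by
  refine ⟨?_, isOpen_Ioi⟩
  have : {k : ℕ∞ | (i : ℕ∞) < k} = Set.Ici ((i : ℕ∞) + 1) := by
    ext k
    simp [ENat.add_one_le_iff]
  rw [this]
  exact isClosed_Ici

theorem mem_carrier_iff_code_ne_zero (t : PlaneTree) (u : List ℕ) :
    u ∈ t.carrier ↔ t.code u ≠ 0 := by
  classical
  rw [PlaneTree.code]
  split_ifs with h <;> simp [h]

theorem cons_mem_carrier_iff (t : PlaneTree) (i : ℕ) (u : List ℕ) :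
    i :: u ∈ t.carrier ↔ ∃ k : ℕ∞, (i : ℕ∞) < k ∧ t.code u = k + 1 := by
  classical
  constructor
  · intro h
    have hu := t.parent_mem i u h
    obtain ⟨k, hk⟩ := t.exists_deg u hu
    refine ⟨k, (hk i).1 h, ?_⟩
    have h1 : {i : ℕ | i :: u ∈ t.carrier} = {i : ℕ | (i : ℕ∞) < k} := by
      ext j; exact hk j
    rw [PlaneTree.code, if_pos hu, h1, encard_lt]
  · rintro ⟨k, hik, e⟩
    have hu : u ∈ t.carrier := (mem_carrier_iff_code_ne_zero t u).2 (by simp [e])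
    obtain ⟨l, hl⟩ := t.exists_deg u hu
    have h1 : {i : ℕ | i :: u ∈ t.carrier} = {i : ℕ | (i : ℕ∞) < l} := by
      ext j; exact hl j
    rw [PlaneTree.code, if_pos hu, h1, encard_lt] at e
    rw [hl, (ENat.add_left_injective_of_ne_top ENat.one_ne_top) e]
    exact hik

/-- F consists of `u` and its ancestors. Each ancestor is required to have enough children to
contain the next word on the way to `u`, which is a clopen condition. The bound on lengths serves
the induction: it shows that `i :: u` is a new word. -/
theorem exists_framed (u : List ℕ) : ∀ D : Set ℕ∞, IsClopen D → ∃ F C, IsFramed F C ∧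
    (∀ v ∈ F, v.length ≤ u.length) ∧ u ∈ F ∧ C u = D ∧
    boxEvent F C = {t | ∃ k ∈ D, t.code u = k + 1} := by
  classical
  induction u with
  | nil =>
    intro D hD
    refine ⟨{[]}, fun v => if v = [] then D else Set.univ, ⟨fun v => ?_, ?_, ?_, ?_⟩, ?_, ?_, ?_, ?_⟩
    · split_ifs
      exacts [hD, isClopen_univ]
    · intro v hv
      exact if_neg (by simpa using hv)
    · intro i v hv
      simp at hv
    · intro i v hv
      simp at hv
    · simp
    · simp
    · simp
    · ext t
      simp [boxEvent]
  | cons i u ih =>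
    intro D hD
    obtain ⟨F, C, hF, hlen, hu, hCu, hbox⟩ := ih _ (isClopen_natCast_lt i)
    have hnot : i :: u ∉ F := fun h => by simpa using hlen _ h
    refine ⟨insert (i :: u) F, fun v => if v = i :: u then D else C v,
      ⟨fun v => ?_, ?_, ?_, ?_⟩, ?_, ?_, ?_, ?_⟩
    · split_ifs
      exacts [hD, hF.isClopen v]
    · intro v hv
      rw [Finset.mem_insert, not_or] at hv
      rw [if_neg hv.1, hF.eq_univ v hv.2]
    · intro j v hv
      rcases Finset.mem_insert.1 hv with h | h
      · obtain ⟨rfl, rfl⟩ := List.cons_eq_cons.1 h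
        exact Finset.mem_insert_of_mem hu
      · exact Finset.mem_insert_of_mem (hF.mem_parent j v h)
    · intro j v hv k hk
      have hvF : v ∈ F := by
        rcases Finset.mem_insert.1 hv with h | h
        · obtain ⟨rfl, rfl⟩ := List.cons_eq_cons.1 h
          exact hu
        · exact hF.mem_parent j v h
      rw [if_neg (fun h : v = i :: u => hnot (h ▸ hvF))] at hk
      rcases Finset.mem_insert.1 hv with h | h
      · obtain ⟨rfl, rfl⟩ := List.cons_eq_cons.1 h
        rw [hCu] at hk
        exact hk
      · exact hF.lt_of_mem j v h k hk
    · intro v hv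
      rcases Finset.mem_insert.1 hv with rfl | h
      · exact le_rfl
      · exact (hlen v h).trans (by simp)
    · exact Finset.mem_insert_self _ _
    · exact if_pos rfl
    · ext t
      have key : t ∈ boxEvent (insert (i :: u) F) (fun v => if v = i :: u then D else C v) ↔
          (∃ k ∈ D, t.code (i :: u) = k + 1) ∧ t ∈ boxEvent F C := by
        simp only [boxEvent, Set.mem_ofPred_eq, Finset.forall_mem_insert, if_true]
        refine and_congr_right fun _ => forall₂_congr fun v hv => ?_
        rw [if_neg fun h : v = i :: u => hnot (h ▸ hv)]
      rw [key, hbox]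
      refine ⟨fun h => h.1, fun h => ⟨h, ?_⟩⟩
      obtain ⟨k, -, hk⟩ := h
      exact (cons_mem_carrier_iff t i u).1 ((mem_carrier_iff_code_ne_zero _ _).2 (by simp [hk]))

theorem isClopen_singleton_natCast (k : ℕ) : IsClopen ({(k : ℕ∞)} : Set ℕ∞) :=
  ⟨isClosed_singleton, ENat.isOpen_singleton (ENat.natCast_ne_top k)⟩

/-- It suffices to catch each value of each code. The nonzero finite values come from singletons D,
the value 0 is the complement of the case D = univ, and ⊤ is what remains. -/
theorem generateFrom_framedEvents :
    instMeasurableSpacePlaneTree = MeasurableSpace.generateFrom framedEvents := by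
  refine le_antisymm ?_ ?_
  · have h : instMeasurableSpacePlaneTree
        = MeasurableSpace.comap PlaneTree.code (borel (List ℕ → ℕ∞)) := borel_comap
    rw [← BorelSpace.measurable_eq (α := List ℕ → ℕ∞)] at h
    rw [h, ← measurable_iff_comap_le, @measurable_pi_iff]
    intro u
    have hD : ∀ D : Set ℕ∞, IsClopen D → MeasurableSet[MeasurableSpace.generateFrom framedEvents]
        {t : PlaneTree | ∃ k ∈ D, t.code u = k + 1} := by
      intro D hD
      obtain ⟨F, C, hF, -, -, -, h⟩ := exists_framed u D hD
      exact MeasurableSpace.measurableSet_generateFrom ⟨F, C, hF, h.symm⟩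
    have hs : ∀ k : ℕ, MeasurableSet[MeasurableSpace.generateFrom framedEvents]
        {t : PlaneTree | t.code u = (k : ℕ∞) + 1} := by
      intro k
      simpa using hD _ (isClopen_singleton_natCast k)
    refine @measurable_to_countable' _ _ _ _ (_) _ fun a => ?_
    induction a using ENat.recTopCoe with
    | top =>
      have : (fun t : PlaneTree => t.code u) ⁻¹' {⊤} = {t | ∃ k ∈ Set.univ, t.code u = k + 1} \
          ⋃ k : ℕ, {t : PlaneTree | t.code u = (k : ℕ∞) + 1} := by
        ext t
        simp only [Set.mem_preimage, Set.mem_singleton_iff, Set.mem_sdiff, Set.mem_ofPred_eq,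
          Set.mem_univ, true_and, Set.mem_iUnion, not_exists]
        constructor
        · intro h
          rw [h]
          exact ⟨⟨⊤, rfl⟩, fun k hk => ENat.natCast_ne_top (k + 1) (by push_cast; exact hk.symm)⟩
        · rintro ⟨⟨k, hk⟩, h⟩
          induction k using ENat.recTopCoe with
          | top => rw [hk]; rfl
          | coe k => exact absurd hk (h k)
      rw [this]
      exact (hD _ isClopen_univ).diff (MeasurableSet.iUnion hs)
    | coe a =>
      rcases a with - | a
      · have : (fun t : PlaneTree => t.code u) ⁻¹' {((0 : ℕ) : ℕ∞)}
            = {t | ∃ k ∈ Set.univ, t.code u = k + 1}ᶜ := by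
          ext t
          simp only [Set.mem_preimage, Set.mem_singleton_iff, Set.mem_compl_iff, Set.mem_ofPred_eq,
            Set.mem_univ, true_and, not_exists]
          constructor
          · intro h k hk
            simp [hk] at h
          · intro h
            by_contra h0
            exact h (t.code u - 1) (by
              rw [tsub_add_cancel_of_le (Order.one_le_iff_ne_zero.2 (by simpa using h0))])
        rw [this]
        exact (hD _ isClopen_univ).compl
      · have := hs a
        convert! this using 1
  · refine MeasurableSpace.generateFrom_le ?_
    rintro _ ⟨F, C, hF, rfl⟩
    exact (isClopen_boxEvent hF.isClopen).isOpen.measurableSet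

theorem probabilityMeasure_ext_of_framed {P Q : ProbabilityMeasure PlaneTree}
    (h : ∀ F C, IsFramed F C →
      (P : Measure PlaneTree) (boxEvent F C) = (Q : Measure PlaneTree) (boxEvent F C)) : P = Q := by
  have : IsProbabilityMeasure P.1 := P.2
  have : IsProbabilityMeasure Q.1 := Q.2
  refine Subtype.ext (ext_of_generate_finite framedEvents generateFrom_framedEvents
    isPiSystem_framedEvents ?_ (by rw [measure_univ, measure_univ]))
  rintro _ ⟨F, C, hF, rfl⟩
  exact h F C hF

theorem gwLaw_boxEvent (q : ℕ → PMF ℕ∞) {F : Finset (List ℕ)} {C : List ℕ → Set ℕ∞}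
    (hF : IsFramed F C) :
    (gwLaw q : Measure PlaneTree) (boxEvent F C) = ∏ u ∈ F, (q u.length).toMeasure (C u) := by
  have : treeOf ⁻¹' boxEvent F C = Set.pi F C := by
    ext ω
    exact hF.treeOf_mem_iff_forall_mem
  change (Measure.map treeOf _) _ = _
  rw [Measure.map_apply measurable_treeOf (isClopen_boxEvent hF.isClopen).isOpen.measurableSet, this,
    Measure.infinitePi_pi]
  exact fun u _ => (hF.isClopen u).isOpen.measurableSet

/-! ### Generation sizes of Galton-Watson trees -/

/-- The vertices of generation `n` of the tree `treeOf ω`. -/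
def genSet (ω : List ℕ → ℕ∞) (n : ℕ) : Set (List ℕ) := {u | Reached ω u ∧ u.length = n}

theorem genSize_treeOf (ω : List ℕ → ℕ∞) (n : ℕ) : (treeOf ω).genSize n = (genSet ω n).encard :=
  rfl

theorem genSet_zero (ω : List ℕ → ℕ∞) : genSet ω 0 = {[]} := by
  ext u
  simp only [genSet, Set.mem_ofPred_eq, Set.mem_singleton_iff, List.length_eq_zero_iff]
  exact ⟨fun h => h.2, fun h => ⟨h ▸ trivial, h⟩⟩

theorem genSet_succ {ω : List ℕ → ℕ∞} (hω : ∀ u, ω u ≠ ⊤) {n : ℕ} {A : Finset (List ℕ)}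
    (hA : genSet ω n = A) :
    genSet ω (n + 1)
      = ((A.biUnion fun u => (Finset.range (ω u).toNat).image fun i => i :: u : Finset _) :
        Set (List ℕ)) := by
  ext v
  have hmem : ∀ u, u ∈ A ↔ Reached ω u ∧ u.length = n := fun u => by
    rw [← Finset.mem_coe, ← hA]; rfl
  have hlt : ∀ u (i : ℕ), i < (ω u).toNat ↔ (i : ℕ∞) < ω u := fun u i => by
    conv_rhs => rw [← ENat.natCast_toNat (hω u)]
    exact Nat.cast_lt.symm
  simp only [Finset.coe_biUnion, Set.mem_iUnion, Finset.mem_coe, Finset.mem_image,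
    Finset.mem_range, hmem, hlt]
  constructor
  · rintro ⟨h, hl⟩
    rcases v with - | ⟨i, u⟩
    · simp at hl
    · exact ⟨u, ⟨h.1, by simpa using hl⟩, i, h.2, rfl⟩
  · rintro ⟨u, ⟨h1, h2⟩, i, hi, rfl⟩
    exact ⟨⟨h1, hi⟩, by simp [h2]⟩

theorem card_children (A : Finset (List ℕ)) (k : List ℕ → ℕ) :
    (A.biUnion fun u => (Finset.range (k u)).image fun i => i :: u).card = ∑ u ∈ A, k u := by
  rw [Finset.card_biUnion]
  · refine Finset.sum_congr rfl fun u _ => ?_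
    rw [Finset.card_image_of_injective _ (fun i j h => by simpa using h), Finset.card_range]
  · intro u _ v _ huv
    rw [Function.onFun, Finset.disjoint_left]
    intro x hx hy
    obtain ⟨i, -, rfl⟩ := Finset.mem_image.1 hx
    obtain ⟨j, -, h⟩ := Finset.mem_image.1 hy
    exact huv (List.cons_eq_cons.1 h).2.symm

theorem finite_genSet {ω : List ℕ → ℕ∞} (hω : ∀ u, ω u ≠ ⊤) (n : ℕ) : (genSet ω n).Finite := by
  induction n with
  | zero => rw [genSet_zero]; exact Set.finite_singleton _
  | succ n ih =>
    rw [genSet_succ hω ih.coe_toFinset.symm]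
    exact Finset.finite_toSet _

/-- The σ-algebra generated by the offspring number of `u`. -/
abbrev coordSigma (u : List ℕ) : MeasurableSpace (List ℕ → ℕ∞) :=
  MeasurableSpace.comap (fun ω => ω u) inferInstance

theorem coordSigma_le (u : List ℕ) : coordSigma u ≤ MeasurableSpace.pi :=
  (measurable_pi_apply u).comap_le

/-- Generation n depends only on the offspring numbers of words of length less than n. It is thus
independent of the offspring numbers of its own vertices. -/
theorem measurableSet_genSet_eq (n : ℕ) (A : Set (List ℕ)) :
    MeasurableSet[⨆ u ∈ {u : List ℕ | u.length < n}, coordSigma u] {ω | genSet ω n = A} := by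
  have hr : ∀ u : List ℕ, u.length ≤ n →
      MeasurableSet[⨆ u ∈ {u : List ℕ | u.length < n}, coordSigma u] {ω | Reached ω u} := by
    intro u
    induction u with
    | nil => intro _; simp [Reached]
    | cons i u ih =>
      intro hu
      have hu' : u.length < n := by simpa using hu
      refine MeasurableSet.inter (ih hu'.le) ?_
      have : MeasurableSet[coordSigma u] {ω : List ℕ → ℕ∞ | (i : ℕ∞) < ω u} :=
        ⟨Set.Ioi (i : ℕ∞), measurableSet_Ioi, rfl⟩
      exact (le_iSup₂_of_le (f := fun (u : List ℕ) (_ : u ∈ {u : List ℕ | u.length < n}) =>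
        coordSigma u) u hu' le_rfl) _ this
  have : {ω | genSet ω n = A} = ⋂ u : List ℕ, {ω | u ∈ genSet ω n ↔ u ∈ A} := by
    ext ω
    simp [Set.ext_iff]
  rw [this]
  refine MeasurableSet.iInter fun u => ?_
  by_cases hu : u.length = n
  · by_cases huA : u ∈ A
    · simpa [genSet, hu, huA] using hr u hu.le
    · have : {ω : List ℕ → ℕ∞ | u ∈ genSet ω n ↔ u ∈ A} = {ω | Reached ω u}ᶜ := by
        ext ω
        simp [genSet, hu, huA]
      rw [this]
      exact (hr u hu.le).compl
  · simp [genSet, hu]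

theorem lintegral_pow_coord (p : PMF ℕ) (s : ℝ≥0∞) :
    ∫⁻ k, s ^ k.toNat ∂(p.map (fun n : ℕ => (n : ℕ∞))).toMeasure = genFun p s := by
  rw [← PMF.toMeasure_map _ _ (measurable_of_countable _),
    lintegral_map (measurable_of_countable _) (measurable_of_countable _), lintegral_countable',
    genFun]
  refine tsum_congr fun n => ?_
  rw [PMF.toMeasure_apply_singleton _ _ (measurableSet_singleton _), mul_comm]
  simp

/-- The product measure under which `treeOf` has law `tauLaw p`. -/
def offspringLaw (p : PMF ℕ) : Measure (List ℕ → ℕ∞) :=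
  Measure.infinitePi fun _ : List ℕ => (p.map (fun n : ℕ => (n : ℕ∞))).toMeasure

instance (p : PMF ℕ) : IsProbabilityMeasure (offspringLaw p) := by
  unfold offspringLaw; infer_instance

theorem tauLaw_eq_map (p : PMF ℕ) :
    (tauLaw p : Measure PlaneTree) = (offspringLaw p).map treeOf := rfl

theorem ae_ne_top (p : PMF ℕ) : ∀ᵐ ω ∂offspringLaw p, ∀ u, ω u ≠ ⊤ := by
  rw [ae_all_iff]
  intro u
  have h : (offspringLaw p).map (fun ω => ω u) = (p.map (fun n : ℕ => (n : ℕ∞))).toMeasure :=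
    Measure.infinitePi_map_eval _ u
  have h2 : ∀ᵐ k ∂(offspringLaw p).map (fun ω => ω u), k ≠ ⊤ := by
    rw [h, ae_iff, PMF.toMeasure_apply_eq_zero_iff _ (Set.to_countable _).measurableSet,
      Set.disjoint_left]
    intro k hk
    rw [PMF.support_map] at hk
    obtain ⟨n, -, rfl⟩ := hk
    simp
  exact ae_of_ae_map (measurable_pi_apply u).aemeasurable h2

theorem lintegral_prod_coord (p : PMF ℕ) (s : ℝ≥0∞) (A : Finset (List ℕ)) :
    ∫⁻ ω, ∏ u ∈ A, s ^ (ω u).toNat ∂offspringLaw p = genFun p s ^ A.card := by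
  have hm : Measurable fun k : ℕ∞ => s ^ k.toNat := measurable_of_countable _
  have hi : iIndepFun (fun (u : List ℕ) (ω : List ℕ → ℕ∞) => s ^ (ω u).toNat) (offspringLaw p) :=
    iIndepFun_infinitePi (fun _ => hm)
  rw [lintegral_prod_eq_prod_lintegral_of_indepFun A _ hi
    (fun u => hm.comp (measurable_pi_apply u)), Finset.prod_eq_pow_card]
  intro u _
  rw [← lintegral_pow_coord, ← Measure.infinitePi_map_eval
    (fun _ : List ℕ => (p.map (fun n : ℕ => (n : ℕ∞))).toMeasure) u,
    lintegral_map hm (measurable_pi_apply u)]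
  rfl

/-- On this event the size of the next generation is the sum of the offspring numbers over A, and
these are independent of the event. If A contains a word of the wrong length, the event is empty. -/
theorem lintegral_genSet_eq (p : PMF ℕ) (s : ℝ≥0∞) (n : ℕ) (A : Finset (List ℕ)) :
    ∫⁻ ω in {ω | genSet ω n = A}, s ^ (genSet ω (n + 1)).encard.toNat ∂offspringLaw p
      = offspringLaw p {ω | genSet ω n = A} * genFun p s ^ A.card := by
  classical
  have hms : MeasurableSet {ω : List ℕ → ℕ∞ | genSet ω n = A} :=
    (iSup₂_le fun u _ => coordSigma_le u) _ (measurableSet_genSet_eq n A)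
  by_cases hA : ∀ u ∈ A, u.length = n
  swap
  · have : {ω : List ℕ → ℕ∞ | genSet ω n = A} = ∅ := by
      ext ω
      simp only [Set.mem_ofPred_eq, Set.mem_empty_iff_false, iff_false]
      intro h
      push Not at hA
      obtain ⟨u, hu, hne⟩ := hA
      rw [← Finset.mem_coe, ← h] at hu
      exact hne hu.2
    simp [this]
  have h1 : ∫⁻ ω in {ω | genSet ω n = A}, s ^ (genSet ω (n + 1)).encard.toNat ∂offspringLaw p
      = ∫⁻ ω, {ω | genSet ω n = A}.indicator 1 ω * ∏ u ∈ A, s ^ (ω u).toNat ∂offspringLaw p := by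
    rw [← lintegral_indicator hms]
    refine lintegral_congr_ae ?_
    filter_upwards [ae_ne_top p] with ω hω
    by_cases h : genSet ω n = A
    · rw [Set.indicator_of_mem (show ω ∈ {ω | genSet ω n = A} from h),
        Set.indicator_of_mem (show ω ∈ {ω | genSet ω n = A} from h), Pi.one_apply, one_mul,
        genSet_succ hω h, Set.encard_coe_eq_coe_finsetCard, ENat.toNat_natCast, card_children,
        Finset.prod_pow_eq_pow_sum]
    · rw [Set.indicator_of_notMem (show ω ∉ {ω | genSet ω n = A} from h),
        Set.indicator_of_notMem (show ω ∉ {ω | genSet ω n = A} from h), zero_mul]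
  have hind : iIndep coordSigma (offspringLaw p) :=
    iIndepFun_infinitePi (X := fun _ k => k) (fun _ => measurable_id)
  have hdis : Disjoint {u : List ℕ | u.length < n} {u : List ℕ | u.length = n} := by
    rw [Set.disjoint_left]
    intro u h1 h2
    exact h1.ne h2
  have hprod : Measurable[⨆ u ∈ {u : List ℕ | u.length = n}, coordSigma u]
      fun ω : List ℕ → ℕ∞ => ∏ u ∈ A, s ^ (ω u).toNat := by
    refine Finset.measurable_prod _ fun u hu => ?_
    have h : Measurable[coordSigma u] fun ω : List ℕ → ℕ∞ => s ^ (ω u).toNat :=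
      (measurable_of_countable fun k : ℕ∞ => s ^ k.toNat).comp (comap_measurable _)
    exact h.mono (le_iSup₂_of_le (f := fun (u : List ℕ) (_ : u ∈ {u : List ℕ | u.length = n}) =>
        coordSigma u) u (hA u hu) le_rfl) le_rfl
  rw [h1, lintegral_mul_eq_lintegral_mul_lintegral_of_independent_measurableSpace
    (iSup₂_le fun u _ => coordSigma_le u) (iSup₂_le fun u _ => coordSigma_le u)
    (indep_iSup_of_disjoint coordSigma_le hind hdis)
    (Measurable.indicator (f := (1 : (List ℕ → ℕ∞) → ℝ≥0∞)) (@measurable_const _ _ _ (_) 1) (measurableSet_genSet_eq n A)) hprod, lintegral_prod_coord,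
    lintegral_indicator_one hms]

theorem lintegral_eq_tsum_genSet (p : PMF ℕ) (n : ℕ) (G : (List ℕ → ℕ∞) → ℝ≥0∞) :
    ∫⁻ ω, G ω ∂offspringLaw p
      = ∑' A : Finset (List ℕ), ∫⁻ ω in {ω | genSet ω n = A}, G ω ∂offspringLaw p := by
  have hms : ∀ A : Finset (List ℕ), MeasurableSet {ω : List ℕ → ℕ∞ | genSet ω n = A} := fun A =>
    (iSup₂_le fun u _ => coordSigma_le u) _ (measurableSet_genSet_eq n A)
  rw [← lintegral_iUnion hms, ← setLIntegral_univ]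
  · refine setLIntegral_congr ?_
    filter_upwards [ae_ne_top p] with ω hω
    refine propext ⟨fun _ => ?_, fun _ => trivial⟩
    exact Set.mem_iUnion.2 ⟨(finite_genSet hω n).toFinset, (finite_genSet hω n).coe_toFinset.symm⟩
  · intro A B hAB
    rw [Function.onFun, Set.disjoint_left]
    intro ω h1 h2
    exact hAB (Finset.coe_injective (Eq.trans (Eq.symm h1) h2))

theorem lintegral_pow_genSet (p : PMF ℕ) (n : ℕ) : ∀ s : ℝ≥0∞,
    ∫⁻ ω, s ^ (genSet ω n).encard.toNat ∂offspringLaw p = (genFun p)^[n] s := by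
  induction n with
  | zero => intro s; simp [genSet_zero]
  | succ n ih =>
    intro s
    rw [Function.iterate_succ_apply, ← ih, lintegral_eq_tsum_genSet p n,
      lintegral_eq_tsum_genSet p n]
    refine tsum_congr fun A => ?_
    have hms : MeasurableSet {ω : List ℕ → ℕ∞ | genSet ω n = A} :=
      (iSup₂_le fun u _ => coordSigma_le u) _ (measurableSet_genSet_eq n A)
    rw [lintegral_genSet_eq, setLIntegral_congr_fun (g := fun _ => genFun p s ^ A.card) hms,
      setLIntegral_const, mul_comm]
    intro ω hω
    dsimp only
    rw [show genSet ω n = A from hω, Set.encard_coe_eq_coe_finsetCard, ENat.toNat_natCast]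

theorem measurable_genSize (n : ℕ) : Measurable fun t : PlaneTree => t.genSize n := by
  classical
  have h : Measurable fun t : PlaneTree => ((t.genSize n : ℕ∞) : ℝ≥0∞) := by
    have : (fun t : PlaneTree => ((t.genSize n : ℕ∞) : ℝ≥0∞)) = fun t => ∑' u : List ℕ,
        {t : PlaneTree | u ∈ t.carrier ∧ u.length = n}.indicator 1 t := by
      funext t
      rw [PlaneTree.genSize, ← ENNReal.tsum_set_one,
        tsum_subtype {u | u ∈ t.carrier ∧ u.length = n} (fun _ => (1 : ℝ≥0∞))]
      refine tsum_congr fun u => ?_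
      simp only [Set.indicator_apply, Set.mem_ofPred_eq]
      rfl
    rw [this]
    refine Measurable.tsum fun u => measurable_one.indicator ?_
    by_cases hu : u.length = n
    · simp only [hu, and_true, mem_carrier_iff_code_ne_zero]
      exact (isOpen_compl_singleton.preimage (continuous_code u)).measurableSet
    · simp [hu]
  exact measurable_to_countable' fun a => by
    have : (fun t : PlaneTree => t.genSize n) ⁻¹' {a}
        = (fun t : PlaneTree => ((t.genSize n : ℕ∞) : ℝ≥0∞)) ⁻¹' {(a : ℝ≥0∞)} := by
      ext t
      simp
    rw [this]
    exact h (measurableSet_singleton _)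

theorem ae_genSize_ne_top (p : PMF ℕ) :
    ∀ᵐ t ∂(tauLaw p : Measure PlaneTree), ∀ n, t.genSize n ≠ ⊤ := by
  rw [tauLaw_eq_map, ae_all_iff]
  intro n
  rw [ae_map_iff (p := fun t : PlaneTree => t.genSize n ≠ ⊤) measurable_treeOf.aemeasurable
    (measurable_genSize n (measurableSet_singleton ⊤).compl)]
  filter_upwards [ae_ne_top p] with ω hω
  rw [genSize_treeOf]
  exact (finite_genSet hω n).encard_lt_top.ne

/-- The generating function of `Z_n` is the `n`-th iterate of `f`. -/
theorem lintegral_pow_genSize (p : PMF ℕ) (n : ℕ) (s : ℝ≥0∞) :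
    ∫⁻ t, s ^ (t.genSize n).toNat ∂(tauLaw p : Measure PlaneTree) = (genFun p)^[n] s := by
  rw [tauLaw_eq_map, lintegral_map _ measurable_treeOf]
  · exact lintegral_pow_genSet p n s
  · exact (measurable_of_countable fun k : ℕ∞ => s ^ k.toNat).comp (measurable_genSize n)

/-! ### The generating function on the real line -/

/-- The standing assumptions on the offspring distribution. -/
structure IsSupercritical (p : PMF ℕ) : Prop where
  nondeg : (lowerBd p : ℕ∞) < upperBd p
  one_lt_mean : 1 < mean p
  mean_lt_top : mean p < ∞
  genFun_radius : genFun p (radius p) = ∞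

/-- The generating function as a real or complex function. -/
def gf {𝕜 : Type*} [RCLike 𝕜] (p : PMF ℕ) (z : 𝕜) : 𝕜 := ∑' n, ((p n).toReal : 𝕜) * z ^ n

/-- The derivative of the generating function. -/
def gfDeriv {𝕜 : Type*} [RCLike 𝕜] (p : PMF ℕ) (z : 𝕜) : 𝕜 :=
  ∑' n, ((p n).toReal : 𝕜) * (n * z ^ (n - 1))

theorem hasSum_toReal (p : PMF ℕ) : HasSum (fun n => (p n).toReal) 1 := by
  have := p.tsum_coe
  have h2 : (∑' n, p n) ≠ ∞ := by rw [this]; simp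
  have h3 := (ENNReal.hasSum_toReal h2)
  rw [← ENNReal.tsum_toReal_eq (fun n => p.apply_ne_top n), this] at h3
  simpa using h3

theorem ofReal_toReal_apply (p : PMF ℕ) (n : ℕ) : ENNReal.ofReal (p n).toReal = p n :=
  ENNReal.ofReal_toReal (p.apply_ne_top n)

theorem toReal_apply_pos {p : PMF ℕ} {n : ℕ} (h : p n ≠ 0) : 0 < (p n).toReal :=
  ENNReal.toReal_pos h (p.apply_ne_top n)

theorem genFun_mono (p : PMF ℕ) : Monotone (genFun p) := fun _ _ h =>
  ENNReal.tsum_le_tsum fun _ => by gcongr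

theorem genFun_one (p : PMF ℕ) : genFun p 1 = 1 := by
  simp [genFun, p.tsum_coe]

theorem genFun_ofReal_term (p : PMF ℕ) {x : ℝ} (hx : 0 ≤ x) (n : ℕ) :
    p n * ENNReal.ofReal x ^ n = ENNReal.ofReal ((p n).toReal * x ^ n) := by
  rw [ENNReal.ofReal_mul ENNReal.toReal_nonneg, ofReal_toReal_apply, ENNReal.ofReal_pow hx]

theorem genFun_ofReal (p : PMF ℕ) {x : ℝ} (hx : 0 ≤ x)
    (hs : Summable fun n => (p n).toReal * x ^ n) :
    genFun p (ENNReal.ofReal x) = ENNReal.ofReal (gf p x) := by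
  rw [gf, ENNReal.ofReal_tsum_of_nonneg (fun n => by simpa using by positivity) (by simpa using hs),
    genFun]
  exact tsum_congr fun n => by simpa using genFun_ofReal_term p hx n

theorem summable_of_genFun_ne_top (p : PMF ℕ) {x : ℝ} (hx : 0 ≤ x)
    (h : genFun p (ENNReal.ofReal x) ≠ ∞) : Summable fun n => (p n).toReal * x ^ n := by
  rw [genFun, tsum_congr (genFun_ofReal_term p hx)] at h
  exact (summable_of_sum_le (c := (∑' n, ENNReal.ofReal ((p n).toReal * x ^ n)).toReal)
    (fun n => by positivity) fun u => by
      rw [← ENNReal.ofReal_le_iff_le_toReal h, ENNReal.ofReal_sum_of_nonneg fun n _ => by positivity]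
      exact ENNReal.sum_le_tsum u)

theorem summable_of_le_one (p : PMF ℕ) {x : ℝ} (hx : 0 ≤ x) (h1 : x ≤ 1) :
    Summable fun n => (p n).toReal * x ^ n :=
  (hasSum_toReal p).summable.of_nonneg_of_le (fun n => by positivity)
    fun n => mul_le_of_le_one_right ENNReal.toReal_nonneg (pow_le_one₀ hx h1)

theorem gf_one (p : PMF ℕ) : gf p (1 : ℝ) = 1 := by
  simpa [gf] using (hasSum_toReal p).tsum_eq

theorem gf_nonneg (p : PMF ℕ) {x : ℝ} (hx : 0 ≤ x) : 0 ≤ gf p x :=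
  tsum_nonneg fun n => by simpa using by positivity

theorem gf_mono (p : PMF ℕ) {x y : ℝ} (hx : 0 ≤ x) (hxy : x ≤ y)
    (hy : Summable fun n => (p n).toReal * y ^ n) : gf p x ≤ gf p y := by
  have hx' : Summable fun n => (p n).toReal * x ^ n := hy.of_nonneg_of_le (fun n => by positivity)
    fun n => by gcongr
  exact Summable.tsum_le_tsum (fun n => by simpa using by gcongr) (by simpa using hx')
    (by simpa using hy)

theorem gf_mem_Icc (p : PMF ℕ) {x : ℝ} (hx : x ∈ Set.Icc (0 : ℝ) 1) :
    gf p x ∈ Set.Icc (0 : ℝ) 1 :=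
  ⟨gf_nonneg p hx.1, gf_one p ▸ gf_mono p hx.1 hx.2 (summable_of_le_one p zero_le_one le_rfl)⟩

theorem iterate_gf_mem_Icc (p : PMF ℕ) {x : ℝ} (hx : x ∈ Set.Icc (0 : ℝ) 1) (n : ℕ) :
    (gf p)^[n] x ∈ Set.Icc (0 : ℝ) 1 := by
  induction n with
  | zero => exact hx
  | succ n ih => rw [Function.iterate_succ_apply']; exact gf_mem_Icc p ih

theorem monotoneOn_iterate_gf (p : PMF ℕ) (n : ℕ) :
    MonotoneOn ((gf p)^[n]) (Set.Icc (0 : ℝ) 1) := by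
  induction n with
  | zero => exact monotoneOn_id
  | succ n ih =>
    intro x hx y hy hxy
    rw [Function.iterate_succ_apply', Function.iterate_succ_apply']
    have h := iterate_gf_mem_Icc p hy n
    exact gf_mono p (iterate_gf_mem_Icc p hx n).1 (ih hx hy hxy) (summable_of_le_one p h.1 h.2)

theorem iterate_genFun_ofReal (p : PMF ℕ) {x : ℝ} (hx : x ∈ Set.Icc (0 : ℝ) 1) (n : ℕ) :
    (genFun p)^[n] (ENNReal.ofReal x) = ENNReal.ofReal ((gf p)^[n] x) := by
  induction n with
  | zero => rfl
  | succ n ih =>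
    have h := iterate_gf_mem_Icc p hx n
    rw [Function.iterate_succ_apply', ih, Function.iterate_succ_apply',
      genFun_ofReal p h.1 (summable_of_le_one p h.1 h.2)]

theorem hasDerivAt_gf {𝕜 : Type*} [RCLike 𝕜] (p : PMF ℕ) {r : ℝ} (hr : 0 < r)
    (hs : Summable fun n => (p n).toReal * r ^ n) {z : 𝕜} (hz : ‖z‖ < r) :
    HasDerivAt (gf p) (gfDeriv p z) z := by
  obtain ⟨r', hzr', hr'⟩ := exists_between hz
  have hr'0 : 0 < r' := (norm_nonneg z).trans_lt hzr'
  have hq : Summable fun n : ℕ => (n : ℝ) ^ 1 * (r' / r) ^ n :=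
    summable_pow_mul_geometric_of_norm_lt_one 1 (by
      rw [Real.norm_of_nonneg (by positivity), div_lt_one hr]; exact hr')
  -- Since M bounds n (r'/r)^n, the differentiated series on the ball of radius r' is dominated by
  -- (M/r') times the series at r.
  obtain ⟨M, hM⟩ := hq.tendsto_atTop_zero.bddAbove_range
  have hu : Summable fun n => (p n).toReal * (n * r' ^ (n - 1)) := by
    refine Summable.of_nonneg_of_le (fun n => by positivity) (fun n => ?_) (hs.mul_left (M / r'))
    have h1 : (n : ℝ) ^ 1 * (r' / r) ^ n ≤ M := hM ⟨n, rfl⟩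
    rcases n with - | n
    · have hM0 : 0 ≤ M := by simpa using h1
      simp; positivity
    · rw [pow_one, div_pow, mul_div_assoc', div_le_iff₀ (by positivity)] at h1
      have h2 : ((n + 1 : ℕ) : ℝ) * r' ^ n ≤ M / r' * r ^ (n + 1) := by
        rw [div_mul_eq_mul_div, le_div_iff₀ hr'0]
        calc _ = ((n + 1 : ℕ) : ℝ) * r' ^ (n + 1) := by ring
          _ ≤ _ := h1
      calc (p (n + 1)).toReal * (((n + 1 : ℕ) : ℝ) * r' ^ (n + 1 - 1))
          ≤ (p (n + 1)).toReal * (M / r' * r ^ (n + 1)) := by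
            rw [Nat.add_sub_cancel]; gcongr
        _ = _ := by ring
  refine hasDerivAt_tsum_of_isPreconnected (t := Metric.ball (0 : 𝕜) r')
    (g := fun n z => ((p n).toReal : 𝕜) * z ^ n)
    (g' := fun n z => ((p n).toReal : 𝕜) * (n * z ^ (n - 1))) hu Metric.isOpen_ball
    (convex_ball _ _).isPreconnected (fun n y _ => ?_) (fun n y hy => ?_)
    (Metric.mem_ball_self hr'0) ?_ (by simpa using hzr')
  · exact (hasDerivAt_pow n y).const_mul _
  · have hy' : ‖y‖ ≤ r' := by simpa using (Metric.mem_ball.1 hy).le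
    rw [norm_mul, norm_mul, norm_pow, RCLike.norm_natCast, RCLike.norm_ofReal,
      abs_of_nonneg ENNReal.toReal_nonneg]
    gcongr
  · exact (hasSum_single 0 fun n hn => by simp [hn]).summable

/-- R_c > 1, because f(1) = 1 whereas f(R_c) = ∞. -/
theorem IsSupercritical.exists_summable {p : PMF ℕ} (hp : IsSupercritical p) :
    ∃ r : ℝ, 1 < r ∧ Summable fun n => (p n).toReal * r ^ n := by
  have h1 : (1 : ℝ≥0∞) ≤ radius p := le_sSup ⟨le_rfl, by rw [genFun_one]; simp⟩
  have h2 : (1 : ℝ≥0∞) < radius p := by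
    refine lt_of_le_of_ne h1 fun h => ?_
    have := hp.genFun_radius
    rw [← h, genFun_one] at this
    simp at this
  obtain ⟨r, ⟨hr1, hr2⟩, hr⟩ := lt_sSup_iff.1 h2
  have hr3 : r ≠ ∞ ∨ r = ∞ := ne_or_eq r ∞
  rcases hr3 with hr3 | rfl
  · have h5 : (1 : ℝ) < r.toReal := by
      rw [← ENNReal.toReal_one]
      exact (ENNReal.toReal_lt_toReal (by simp) hr3).2 hr
    exact ⟨r.toReal, h5, summable_of_genFun_ne_top p (by linarith) (by
      rw [ENNReal.ofReal_toReal hr3]; exact hr2.ne)⟩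
  · exact ⟨2, by norm_num, summable_of_genFun_ne_top p (by norm_num)
      ((genFun_mono p le_top).trans_lt hr2).ne⟩

/-- The mean as a real number. -/
def meanR (p : PMF ℕ) : ℝ := (mean p).toReal

theorem IsSupercritical.one_lt_meanR {p : PMF ℕ} (hp : IsSupercritical p) : 1 < meanR p := by
  rw [meanR, ← ENNReal.toReal_one]
  exact (ENNReal.toReal_lt_toReal (by simp) hp.mean_lt_top.ne).2 hp.one_lt_mean

theorem IsSupercritical.meanR_pos {p : PMF ℕ} (hp : IsSupercritical p) : 0 < meanR p :=
  zero_lt_one.trans hp.one_lt_meanR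

theorem IsSupercritical.hasSum_mean {p : PMF ℕ} (hp : IsSupercritical p) :
    HasSum (fun n => (p n).toReal * n) (meanR p) := by
  have h := ENNReal.hasSum_toReal hp.mean_lt_top.ne
  rw [← ENNReal.tsum_toReal_eq (fun n => ENNReal.mul_ne_top (p.apply_ne_top n) (by simp))] at h
  simpa [meanR, mean] using h

theorem one_add_pow_le {y δ : ℝ} (hy : -1 ≤ y) (hyδ : y ≤ δ) (hδ : 0 ≤ δ) (n : ℕ) :
    (1 + y) ^ n ≤ 1 + n * y + n ^ 2 * (1 + δ) ^ n * y ^ 2 := by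
  induction n with
  | zero => simp
  | succ n ih =>
    have h1 : (1 : ℝ) ≤ (1 + δ) ^ (n + 1) := one_le_pow₀ (by linarith)
    have h2 : 0 ≤ (n : ℝ) ^ 2 * (1 + δ) ^ n * y ^ 2 := by positivity
    calc (1 + y) ^ (n + 1) = (1 + y) * (1 + y) ^ n := by ring
      _ ≤ (1 + y) * (1 + n * y + n ^ 2 * (1 + δ) ^ n * y ^ 2) := by
        apply mul_le_mul_of_nonneg_left ih (by linarith)
      _ = 1 + (n + 1) * y + n * 1 * y ^ 2 + (1 + y) * (n ^ 2 * (1 + δ) ^ n * y ^ 2) := by ring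
      _ ≤ 1 + (n + 1) * y + n * (1 + δ) ^ (n + 1) * y ^ 2
          + (1 + δ) * (n ^ 2 * (1 + δ) ^ n * y ^ 2) := by gcongr
      _ = 1 + (n + 1) * y + (n ^ 2 + n) * (1 + δ) ^ (n + 1) * y ^ 2 := by ring
      _ ≤ 1 + (n + 1) * y + (n + 1) ^ 2 * (1 + δ) ^ (n + 1) * y ^ 2 := by
        gcongr; nlinarith [(Nat.cast_nonneg n : (0 : ℝ) ≤ n)]
      _ = _ := by push_cast; ring

/-- Second-order control of f on both sides of 1. It makes the explicit comparison sequences for c_n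
and for the exponential moments of Z_n / c_n work. -/
theorem IsSupercritical.exists_quadratic_bound {p : PMF ℕ} (hp : IsSupercritical p) :
    ∃ δ > 0, ∃ κ > 0, (Summable fun n => (p n).toReal * (1 + δ) ^ n) ∧
      ∀ y, -1 ≤ y → y ≤ δ → gf p (1 + y) ≤ 1 + meanR p * y + κ * y ^ 2 := by
  obtain ⟨r, hr, hs⟩ := hp.exists_summable
  obtain ⟨r', h1r', hr'⟩ := exists_between hr
  have hr'0 : 0 < r' := by linarith
  have hq : Summable fun n : ℕ => (n : ℝ) ^ 2 * (r' / r) ^ n :=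
    summable_pow_mul_geometric_of_norm_lt_one 2 (by
      rw [Real.norm_of_nonneg (by positivity), div_lt_one (by linarith)]; exact hr')
  obtain ⟨M, hM⟩ := hq.tendsto_atTop_zero.bddAbove_range
  have hu : Summable fun n => (p n).toReal * (n ^ 2 * r' ^ n) := by
    refine Summable.of_nonneg_of_le (fun n => by positivity) (fun n => ?_) (hs.mul_left M)
    have h1 : (n : ℝ) ^ 2 * (r' / r) ^ n ≤ M := hM ⟨n, rfl⟩
    rw [div_pow, mul_div_assoc', div_le_iff₀ (by positivity)] at h1
    calc _ ≤ (p n).toReal * (M * r ^ n) := by gcongr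
      _ = _ := by ring
  have hs' : Summable fun n => (p n).toReal * r' ^ n :=
    hs.of_nonneg_of_le (fun n => by positivity) fun n => by gcongr
  -- The summand 1 only ensures κ > 0.
  refine ⟨r' - 1, by linarith, (∑' n, (p n).toReal * (n ^ 2 * r' ^ n)) + 1, ?_, ?_, ?_⟩
  · have : 0 ≤ ∑' n, (p n).toReal * (n ^ 2 * r' ^ n) := tsum_nonneg fun n => by positivity
    linarith
  · simpa using hs'
  · intro y hy1 hy2
    have hsum := ((hasSum_toReal p).add (hp.hasSum_mean.mul_right y)).add
      (hu.hasSum.mul_right (y ^ 2))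
    have hsy : Summable fun n => (p n).toReal * (1 + y) ^ n :=
      hs'.of_nonneg_of_le (fun n => mul_nonneg ENNReal.toReal_nonneg (pow_nonneg (by linarith) n))
        fun n => mul_le_mul_of_nonneg_left (pow_le_pow_left₀ (by linarith) (by linarith) n)
          ENNReal.toReal_nonneg
    have h2 : gf p (1 + y) ≤ 1 + meanR p * y + (∑' n, (p n).toReal * (n ^ 2 * r' ^ n)) * y ^ 2 := by
      refine (hasSum_le (fun n => ?_) hsy.hasSum hsum).trans_eq' ?_
      · have := one_add_pow_le hy1 hy2 (by linarith) n
        rw [add_sub_cancel] at this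
        calc (p n).toReal * (1 + y) ^ n
            ≤ (p n).toReal * (1 + n * y + n ^ 2 * r' ^ n * y ^ 2) := by gcongr
          _ = _ := by ring
      · simp [gf]
    nlinarith [sq_nonneg y]

theorem IsSupercritical.one_add_mul_le_gf {p : PMF ℕ} (hp : IsSupercritical p) {y : ℝ}
    (hy1 : -1 ≤ y) (hy2 : y ≤ 0) : 1 + meanR p * y ≤ gf p (1 + y) := by
  have h := (hasSum_toReal p).add (hp.hasSum_mean.mul_right y)
  have h2 := (summable_of_le_one p (x := 1 + y) (by linarith) (by linarith)).hasSum
  refine (hasSum_le (fun n => ?_) h h2).trans_eq (by simp [gf])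
  have := one_add_mul_le_pow (a := y) (by linarith) n
  calc (p n).toReal + (p n).toReal * n * y = (p n).toReal * (1 + n * y) := by ring
    _ ≤ _ := by gcongr

theorem exists_lt_of_nondeg {p : PMF ℕ} (h : (lowerBd p : ℕ∞) < upperBd p) :
    ∃ a b : ℕ, a < b ∧ p a ≠ 0 ∧ p b ≠ 0 := by
  have hne : {n | p n ≠ 0}.Nonempty := p.support_nonempty
  rw [upperBd, lt_iSup_iff] at h
  obtain ⟨b, hb⟩ := h
  rw [lt_iSup_iff] at hb
  obtain ⟨hb1, hb2⟩ := hb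
  exact ⟨lowerBd p, b, by exact_mod_cast hb2, Nat.sInf_mem hne, hb1⟩

theorem IsSupercritical.exists_mean_lt {p : PMF ℕ} (hp : IsSupercritical p) :
    ∃ k : ℕ, meanR p < k ∧ p k ≠ 0 := by
  obtain ⟨a, b, hab, ha, hb⟩ := exists_lt_of_nondeg hp.nondeg
  by_contra! h
  have h' : ∀ k : ℕ, p k ≠ 0 → (k : ℝ) ≤ meanR p := fun k hk => by
    by_contra hlt
    exact hk (h k (by linarith))
  have h1 := hp.hasSum_mean
  have h2 := (hasSum_toReal p).mul_right (meanR p)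
  refine absurd (hasSum_lt (fun n => ?_) (i := a) ?_ h1 h2) (by simp)
  · by_cases hn : p n = 0
    · simp [hn]
    · have := h' n hn
      dsimp only
      gcongr
  · have h3 := h' b hb
    have h4 : (a : ℝ) < b := by exact_mod_cast hab
    exact mul_lt_mul_of_pos_left (by linarith) (toReal_apply_pos ha)

theorem IsSupercritical.exists_lt_mean {p : PMF ℕ} (hp : IsSupercritical p) :
    ∃ k : ℕ, (k : ℝ) < meanR p ∧ p k ≠ 0 := by
  obtain ⟨a, b, hab, ha, hb⟩ := exists_lt_of_nondeg hp.nondeg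
  by_contra! h
  have h' : ∀ k : ℕ, p k ≠ 0 → meanR p ≤ k := fun k hk => by
    by_contra hlt
    exact hk (h k (by linarith))
  have h1 := hp.hasSum_mean
  have h2 := (hasSum_toReal p).mul_right (meanR p)
  refine absurd (hasSum_lt (fun n => ?_) (i := b) ?_ h2 h1) (by simp)
  · by_cases hn : p n = 0
    · simp [hn]
    · have := h' n hn
      dsimp only
      gcongr
  · have h3 := h' a ha
    have h4 : (a : ℝ) < b := by exact_mod_cast hab
    exact mul_lt_mul_of_pos_left (by linarith) (toReal_apply_pos hb)

theorem IsSupercritical.exists_two_le {p : PMF ℕ} (hp : IsSupercritical p) :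
    ∃ k : ℕ, 2 ≤ k ∧ p k ≠ 0 := by
  obtain ⟨k, hk, hk'⟩ := hp.exists_mean_lt
  refine ⟨k, ?_, hk'⟩
  have : (1 : ℝ) < k := hp.one_lt_meanR.trans hk
  exact_mod_cast this

/-- Strict convexity on the chord from a fixed point to `1`. -/
theorem IsSupercritical.gf_lt_self {p : PMF ℕ} (hp : IsSupercritical p) {a s : ℝ} (ha : 0 ≤ a)
    (hfa : gf p a = a) (has : a < s) (hs : s < 1) : gf p s < s := by
  obtain ⟨k, hk2, hk⟩ := hp.exists_two_le
  obtain ⟨θ, hθ⟩ : ∃ θ, θ = (s - a) / (1 - a) := ⟨_, rfl⟩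
  have h1a : 0 < 1 - a := by linarith
  have hθ0 : 0 < θ := by rw [hθ]; exact div_pos (by linarith) h1a
  have hθ1 : θ < 1 := by rw [hθ, div_lt_one h1a]; linarith
  have hsθ : s = (1 - θ) * a + θ * 1 := by rw [hθ]; field_simp; ring
  have hsa := (summable_of_le_one p ha (by linarith)).hasSum
  have hss := (summable_of_le_one p (ha.trans has.le) hs.le).hasSum
  have hsum := (hsa.mul_left (1 - θ)).add ((hasSum_toReal p).mul_left θ)
  have hga : ∑' n, (p n).toReal * a ^ n = a := by simpa [gf] using hfa
  have hgs : gf p s = ∑' n, (p n).toReal * s ^ n := by simp [gf]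
  have hle : ∀ n : ℕ, s ^ n ≤ (1 - θ) * a ^ n + θ := fun n => by
    have := (convexOn_pow (𝕜 := ℝ) n).2 (show a ∈ Set.Ici (0 : ℝ) from ha)
      (Set.mem_Ici.2 (zero_le_one (α := ℝ))) (sub_nonneg.2 hθ1.le) hθ0.le (by ring)
    simp only [smul_eq_mul, one_pow] at this
    rw [hsθ]
    linarith
  have hlt := (strictConvexOn_pow hk2).2 (show a ∈ Set.Ici (0 : ℝ) from ha)
      (Set.mem_Ici.2 (zero_le_one (α := ℝ))) (by linarith) (sub_pos.2 hθ1) hθ0 (by ring)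
  simp only [smul_eq_mul, one_pow] at hlt
  rw [← hsθ] at hlt
  have := hasSum_lt (fun n => ?_) (i := k) ?_ hss hsum
  · rw [hga] at this
    rw [hgs]
    linarith
  · have h0 : 0 ≤ (p n).toReal := ENNReal.toReal_nonneg
    have := mul_le_mul_of_nonneg_left (hle n) h0
    dsimp only
    linarith
  · have := mul_lt_mul_of_pos_left hlt (toReal_apply_pos hk)
    linarith

theorem IsSupercritical.continuousOn_gf {p : PMF ℕ} (hp : IsSupercritical p) :
    ContinuousOn (gf p) (Set.Icc (0 : ℝ) 1) := by
  obtain ⟨r, hr, hs⟩ := hp.exists_summable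
  intro x hx
  refine (hasDerivAt_gf p (by linarith) hs ?_).continuousAt.continuousWithinAt
  rw [Real.norm_of_nonneg hx.1]
  linarith [hx.2]

theorem IsSupercritical.fixed_of_tendsto {p : PMF ℕ} (hp : IsSupercritical p) {x l : ℝ}
    (hx : x ∈ Set.Icc (0 : ℝ) 1) (h : Tendsto (fun n => (gf p)^[n] x) atTop (𝓝 l)) :
    l ∈ Set.Icc (0 : ℝ) 1 ∧ gf p l = l := by
  have hl : l ∈ Set.Icc (0 : ℝ) 1 :=
    isClosed_Icc.mem_of_tendsto h (Eventually.of_forall fun n => iterate_gf_mem_Icc p hx n)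
  refine ⟨hl, ?_⟩
  have h1 : Tendsto (fun n => gf p ((gf p)^[n] x)) atTop (𝓝 (gf p l)) :=
    (hp.continuousOn_gf l hl).tendsto.comp (tendsto_nhdsWithin_iff.2
      ⟨h, Eventually.of_forall fun n => iterate_gf_mem_Icc p hx n⟩)
  have h2 : Tendsto (fun n => (gf p)^[n + 1] x) atTop (𝓝 l) := h.comp (tendsto_add_atTop_nat 1)
  simp only [Function.iterate_succ_apply'] at h2
  exact tendsto_nhds_unique h1 h2

/-! ### The extinction probability and the iterates of f. -/

/-- The extinction probability as a real number. -/
def extR (p : PMF ℕ) : ℝ := (extProb p).toReal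

theorem extProb_le_one (p : PMF ℕ) : extProb p ≤ 1 := by
  have : IsProbabilityMeasure (tauLaw p).1 := (tauLaw p).2
  exact prob_le_one

theorem ofReal_extR (p : PMF ℕ) : ENNReal.ofReal (extR p) = extProb p :=
  ENNReal.ofReal_toReal ((extProb_le_one p).trans_lt (by simp)).ne

theorem extR_nonneg (p : PMF ℕ) : 0 ≤ extR p := ENNReal.toReal_nonneg

theorem genSize_succ_eq_zero {t : PlaneTree} {n : ℕ} (h : t.genSize n = 0) :
    t.genSize (n + 1) = 0 := by
  rw [PlaneTree.genSize, Set.encard_eq_zero] at h ⊢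
  by_contra hne
  obtain ⟨v, hv, hl⟩ := Set.nonempty_iff_ne_empty.2 hne
  rcases v with - | ⟨i, u⟩
  · simp at hl
  · exact (Set.eq_empty_iff_forall_notMem.1 h) u ⟨t.parent_mem i u hv, by simpa using hl⟩

theorem tendsto_iterate_genFun_zero (p : PMF ℕ) :
    Tendsto (fun n => (genFun p)^[n] 0) atTop (𝓝 (extProb p)) := by
  have h1 : ∀ n, (genFun p)^[n] 0 = (tauLaw p : Measure PlaneTree) {t | t.genSize n = 0} := by
    intro n
    have hms : MeasurableSet {t : PlaneTree | t.genSize n = 0} :=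
      measurable_genSize n (measurableSet_singleton 0)
    rw [← lintegral_pow_genSize, ← lintegral_indicator_one hms]
    refine lintegral_congr_ae ?_
    filter_upwards [ae_genSize_ne_top p] with t ht
    by_cases h : t.genSize n = 0
    · simp [h]
    · rw [Set.indicator_of_notMem (show t ∉ {t : PlaneTree | t.genSize n = 0} from h), zero_pow]
      simp [h, ht n]
  have h2 : {t : PlaneTree | ∃ n, t.genSize n = 0} = ⋃ n, {t | t.genSize n = 0} := by
    ext t; simp
  rw [extProb, h2]
  simp only [h1]
  exact tendsto_measure_iUnion_atTop (monotone_nat_of_le_succ fun n t ht => genSize_succ_eq_zero ht)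

theorem tendsto_iterate_gf_zero (p : PMF ℕ) :
    Tendsto (fun n => (gf p)^[n] (0 : ℝ)) atTop (𝓝 (extR p)) := by
  have h := (ENNReal.tendsto_toReal ((extProb_le_one p).trans_lt (by simp)).ne).comp
    (tendsto_iterate_genFun_zero p)
  refine h.congr fun n => ?_
  have := iterate_genFun_ofReal p (x := 0) ⟨le_rfl, zero_le_one⟩ n
  rw [ENNReal.ofReal_zero] at this
  rw [Function.comp_apply, this,
    ENNReal.toReal_ofReal (iterate_gf_mem_Icc p ⟨le_rfl, zero_le_one⟩ n).1]

theorem IsSupercritical.gf_extR {p : PMF ℕ} (hp : IsSupercritical p) : gf p (extR p) = extR p :=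
  (hp.fixed_of_tendsto ⟨le_rfl, zero_le_one⟩ (tendsto_iterate_gf_zero p)).2

theorem IsSupercritical.genFun_extProb {p : PMF ℕ} (hp : IsSupercritical p) :
    genFun p (extProb p) = extProb p := by
  have h1 : extR p ≤ 1 := by
    rw [extR, ← ENNReal.toReal_one]
    exact ENNReal.toReal_mono (by simp) (extProb_le_one p)
  rw [← ofReal_extR, genFun_ofReal p (extR_nonneg p) (summable_of_le_one p (extR_nonneg p) h1),
    hp.gf_extR]

theorem IsSupercritical.eq_extR {p : PMF ℕ} (hp : IsSupercritical p) (hc : extR p < 1) {s : ℝ}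
    (hs0 : 0 ≤ s) (hs1 : s < 1) (hs : gf p s = s) : s = extR p := by
  rcases lt_trichotomy s (extR p) with h | h | h
  · exact absurd hp.gf_extR (hp.gf_lt_self hs0 hs h hc).ne
  · exact h
  · exact absurd hs (hp.gf_lt_self (extR_nonneg p) hp.gf_extR h hs1).ne

theorem IsSupercritical.tendsto_iterate_gf {p : PMF ℕ} (hp : IsSupercritical p) (hc : extR p < 1)
    {s : ℝ} (hs0 : 0 ≤ s) (hs1 : s < 1) :
    Tendsto (fun n => (gf p)^[n] s) atTop (𝓝 (extR p)) := by
  -- The orbit of s lies between the orbit of 0, which tends to 𝔠, and that of t, which decreases to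
  -- a fixed point below 1. The only such fixed point is 𝔠.
  obtain ⟨t, ht⟩ : ∃ t, t = max s (extR p) := ⟨_, rfl⟩
  have htI : t ∈ Set.Icc (0 : ℝ) 1 :=
    ⟨hs0.trans (ht ▸ le_max_left _ _), ht ▸ (max_lt hs1 hc).le⟩
  have hle : gf p t ≤ t := by
    rcases (ht ▸ le_max_right s (extR p) : extR p ≤ t).eq_or_lt with h | h
    · rw [← h, hp.gf_extR]
    · exact (hp.gf_lt_self (extR_nonneg p) hp.gf_extR h (ht ▸ max_lt hs1 hc)).le
  have hanti : Antitone fun n => (gf p)^[n] t := by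
    refine antitone_nat_of_succ_le fun n => ?_
    rw [Function.iterate_succ_apply]
    exact monotoneOn_iterate_gf p n (gf_mem_Icc p htI) htI hle
  obtain ⟨l, hl⟩ : ∃ l, Tendsto (fun n => (gf p)^[n] t) atTop (𝓝 l) :=
    ⟨_, tendsto_atTop_ciInf hanti ⟨0, by rintro _ ⟨n, rfl⟩; exact (iterate_gf_mem_Icc p htI n).1⟩⟩
  have hfix := hp.fixed_of_tendsto htI hl
  have hlt : l < 1 := (hanti.le_of_tendsto hl 0).trans_lt (ht ▸ max_lt hs1 hc)
  rw [hp.eq_extR hc hfix.1.1 hlt hfix.2] at hl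
  exact tendsto_of_tendsto_of_tendsto_of_le_of_le (tendsto_iterate_gf_zero p) hl
    (fun n => monotoneOn_iterate_gf p n ⟨le_rfl, zero_le_one⟩ ⟨hs0, hs1.le⟩ hs0)
    (fun n => monotoneOn_iterate_gf p n ⟨hs0, hs1.le⟩ htI (ht ▸ le_max_left _ _))

theorem gfDeriv_nonneg (p : PMF ℕ) {x : ℝ} (hx : 0 ≤ x) : 0 ≤ gfDeriv p x :=
  tsum_nonneg fun n => by simpa using by positivity

/-- Mean value theorem between 𝔠 and some b < 1, where f(𝔠) = 𝔠 and f(b) < b. The number f'(s) < 1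
is later the contraction factor for the derivative of the characteristic function of W. -/
theorem IsSupercritical.exists_gfDeriv_lt_one {p : PMF ℕ} (hp : IsSupercritical p)
    (hc : extR p < 1) : ∃ s, extR p < s ∧ s < 1 ∧ gfDeriv p s < 1 := by
  obtain ⟨r, hr, hsr⟩ := hp.exists_summable
  obtain ⟨b, hb, hb1⟩ := exists_between hc
  have h0 := extR_nonneg p
  have hd : ∀ x ∈ Set.Icc (extR p) b, HasDerivAt (gf p) (gfDeriv p x) x := fun x hx =>
    hasDerivAt_gf p (by linarith) hsr (by
      rw [Real.norm_of_nonneg (h0.trans hx.1)]; linarith [hx.2])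
  obtain ⟨s, hs, hs'⟩ := exists_hasDerivAt_eq_slope (gf p) (gfDeriv p) hb
    (fun x hx => (hd x hx).continuousAt.continuousWithinAt) (fun x hx => hd x ⟨hx.1.le, hx.2.le⟩)
  refine ⟨s, hs.1, hs.2.trans hb1, ?_⟩
  rw [hs', div_lt_one (by linarith), hp.gf_extR]
  linarith [hp.gf_lt_self h0 hp.gf_extR hb hb1]

/-! ### The Seneta-Heyde norming -/

instance (p : PMF ℕ) : IsProbabilityMeasure (tauLaw p : Measure PlaneTree) := (tauLaw p).2

theorem IsSupercritical.strictMonoOn_gf {p : PMF ℕ} (hp : IsSupercritical p) :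
    StrictMonoOn (gf p) (Set.Icc (0 : ℝ) 1) := by
  obtain ⟨k, hk2, hk⟩ := hp.exists_two_le
  intro x hx y hy hxy
  have hsx := (summable_of_le_one p hx.1 hx.2).hasSum
  have hsy := (summable_of_le_one p hy.1 hy.2).hasSum
  have h := hasSum_lt (fun n => ?_) (i := k) ?_ hsx hsy
  · simpa [gf] using h
  · exact mul_le_mul_of_nonneg_left (pow_le_pow_left₀ hx.1 hxy.le n) ENNReal.toReal_nonneg
  · exact mul_lt_mul_of_pos_left (pow_lt_pow_left₀ hxy hx.1 (by omega)) (toReal_apply_pos hk)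

theorem IsSupercritical.strictMonoOn_iterate_gf {p : PMF ℕ} (hp : IsSupercritical p) (n : ℕ) :
    StrictMonoOn ((gf p)^[n]) (Set.Icc (0 : ℝ) 1) := by
  induction n with
  | zero => exact strictMonoOn_id
  | succ n ih =>
    intro x hx y hy hxy
    rw [Function.iterate_succ_apply', Function.iterate_succ_apply']
    exact hp.strictMonoOn_gf (iterate_gf_mem_Icc p hx n) (iterate_gf_mem_Icc p hy n) (ih hx hy hxy)

theorem exp_neg_mem_Icc {x : ℝ} (hx : 0 ≤ x) : Real.exp (-x) ∈ Set.Icc (0 : ℝ) 1 :=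
  ⟨(Real.exp_pos _).le, Real.exp_le_one_iff.2 (by linarith)⟩

theorem lintegral_exp_genSize (p : PMF ℕ) (a : ℝ) (n : ℕ) :
    ∫⁻ t, ENNReal.ofReal (Real.exp (a * ((t.genSize n).toNat : ℝ)))
      ∂(tauLaw p : Measure PlaneTree) = (genFun p)^[n] (ENNReal.ofReal (Real.exp a)) := by
  rw [← lintegral_pow_genSize]
  refine lintegral_congr fun t => ?_
  rw [← ENNReal.ofReal_pow (Real.exp_pos _).le, ← Real.exp_nat_mul, mul_comm]

theorem lintegral_exp_neg_genSize (p : PMF ℕ) {a : ℝ} (ha : 0 ≤ a) (n : ℕ) :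
    ∫⁻ t, ENNReal.ofReal (Real.exp (-a * ((t.genSize n).toNat : ℝ)))
      ∂(tauLaw p : Measure PlaneTree) = ENNReal.ofReal ((gf p)^[n] (Real.exp (-a))) := by
  rw [lintegral_exp_genSize, iterate_genFun_ofReal p (exp_neg_mem_Icc ha)]

theorem measurable_genSize_toNat (n : ℕ) :
    Measurable fun t : PlaneTree => ((t.genSize n).toNat : ℝ) :=
  (measurable_of_countable fun k : ℕ∞ => (k.toNat : ℝ)).comp (measurable_genSize n)

/-- The value `exp (-1/c_n)`. -/
def normExp (c : ℕ → ℝ) (n : ℕ) : ℝ := Real.exp (-(c n)⁻¹)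

theorem IsSenetaHeyde.inv_pos {p : PMF ℕ} {c : ℕ → ℝ} (hc : IsSenetaHeyde p c) (n : ℕ) :
    0 < (c n)⁻¹ := by
  have := hc.1 n
  positivity

theorem IsSenetaHeyde.normExp_mem {p : PMF ℕ} {c : ℕ → ℝ} (hc : IsSenetaHeyde p c) (n : ℕ) :
    normExp c n ∈ Set.Icc (0 : ℝ) 1 := exp_neg_mem_Icc (hc.inv_pos n).le

theorem IsSenetaHeyde.normExp_lt_one {p : PMF ℕ} {c : ℕ → ℝ} (hc : IsSenetaHeyde p c) (n : ℕ) :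
    normExp c n < 1 := by
  have := hc.inv_pos n
  exact Real.exp_lt_one_iff.2 (by linarith)

theorem IsSenetaHeyde.extR_lt {p : PMF ℕ} {c : ℕ → ℝ} (hc : IsSenetaHeyde p c) :
    extR p < normExp c 0 := by
  have h := hc.2.1
  rw [← ofReal_extR, ENNReal.ofReal_lt_ofReal_iff (Real.exp_pos _)] at h
  rwa [normExp, inv_eq_one_div, ← neg_div]

theorem IsSenetaHeyde.extR_lt_one {p : PMF ℕ} {c : ℕ → ℝ} (hc : IsSenetaHeyde p c) :
    extR p < 1 := hc.extR_lt.trans (hc.normExp_lt_one 0)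

/-- A martingale has constant expectation, and the expectation of exp(-Z_n/c_n) is the n-th iterate
of f at exp(-1/c_n). This and almost sure convergence are all that is taken from the martingale
property. -/
theorem IsSenetaHeyde.iterate_normExp {p : PMF ℕ} {c : ℕ → ℝ} (hc : IsSenetaHeyde p c) (n : ℕ) :
    (gf p)^[n] (normExp c n) = normExp c 0 := by
  obtain ⟨ℱ, hM⟩ := hc.2.2
  have hint : ∀ n, ∫ t, Real.exp (-((t.genSize n).toNat : ℝ) / c n) ∂(tauLaw p : Measure PlaneTree)
      = (gf p)^[n] (normExp c n) := by
    intro n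
    have h1 : ∀ t : PlaneTree, Real.exp (-((t.genSize n).toNat : ℝ) / c n)
        = Real.exp (-(c n)⁻¹ * ((t.genSize n).toNat : ℝ)) := fun t => by congr 1; ring
    simp only [h1]
    rw [integral_eq_lintegral_of_nonneg_ae (Eventually.of_forall fun t => (Real.exp_pos _).le)
      (((measurable_genSize_toNat n).const_mul _).exp.aestronglyMeasurable),
      lintegral_exp_neg_genSize p (hc.inv_pos n).le]
    exact ENNReal.toReal_ofReal (iterate_gf_mem_Icc p (hc.normExp_mem n) n).1
  have h := hM.setIntegral_eq (Nat.zero_le n) (s := Set.univ) MeasurableSet.univ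
  rw [setIntegral_univ, setIntegral_univ, hint, hint] at h
  exact h.symm

theorem IsSenetaHeyde.gf_normExp {p : PMF ℕ} (hp : IsSupercritical p) {c : ℕ → ℝ}
    (hc : IsSenetaHeyde p c) (n : ℕ) : gf p (normExp c (n + 1)) = normExp c n := by
  refine (hp.strictMonoOn_iterate_gf n).injOn (gf_mem_Icc p (hc.normExp_mem _)) (hc.normExp_mem _) ?_
  rw [← Function.iterate_succ_apply, hc.iterate_normExp, hc.iterate_normExp]

/-- The points exp(-1/c_n) stay in (𝔠, 1), where f(s) < s, so they increase with n. -/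
theorem IsSenetaHeyde.normExp_zero_le {p : PMF ℕ} (hp : IsSupercritical p) {c : ℕ → ℝ}
    (hc : IsSenetaHeyde p c) (n : ℕ) : normExp c 0 ≤ normExp c n := by
  have h1 : extR p < normExp c n ∧ normExp c 0 ≤ normExp c n := by
    induction n with
    | zero => exact ⟨hc.extR_lt, le_rfl⟩
    | succ n ih =>
      have h2 : extR p < normExp c (n + 1) := by
        by_contra! h
        have := hp.strictMonoOn_gf.monotoneOn (hc.normExp_mem _)
          ⟨extR_nonneg p, hc.extR_lt_one.le⟩ h
        rw [hc.gf_normExp hp, hp.gf_extR] at this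
        linarith [ih.1]
      have h3 := hp.gf_lt_self (extR_nonneg p) hp.gf_extR h2 (hc.normExp_lt_one _)
      rw [hc.gf_normExp hp] at h3
      exact ⟨h2, ih.2.trans h3.le⟩
  exact h1.2

/-- With y_n = ε/μ^n, the sequence 1 - u_n, u_n = y_n - b y_n², satisfies f(1 - u_{n+1}) ≤ 1 - u_n,
the quadratic correction absorbing the error term of f. The backward orbit exp(-1/c_n) is compared
with it through the monotonicity of the iterates. -/
theorem IsSenetaHeyde.exists_one_sub_normExp_le {p : PMF ℕ} (hp : IsSupercritical p) {c : ℕ → ℝ}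
    (hc : IsSenetaHeyde p c) : ∃ C > 0, ∀ n, 1 - normExp c n ≤ C / meanR p ^ n := by
  obtain ⟨δ, hδ, κ, hκ, -, hquad⟩ := hp.exists_quadratic_bound
  have hμ := hp.one_lt_meanR
  have hμ0 := hp.meanR_pos
  generalize meanR p = μ at *
  obtain ⟨b, hb⟩ : ∃ b, b = κ / (μ * (μ - 1)) := ⟨_, rfl⟩
  have hbpos : 0 < b := by rw [hb]; exact div_pos hκ (mul_pos hμ0 (by linarith))
  -- The choice of b makes b μ² = b μ + κ, which is exactly what the induction step `hstep` needs.
  have hbκ : b * μ * (μ - 1) = κ := by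
    have : μ - 1 ≠ 0 := by linarith
    rw [hb]; field_simp
  obtain ⟨ε, hε⟩ : ∃ ε, ε = min 1 (1 / (2 * b)) := ⟨_, rfl⟩
  have hε0 : 0 < ε := by rw [hε]; positivity
  have hε1 : ε ≤ 1 := hε ▸ min_le_left _ _
  have hεb : b * ε ≤ 1 / 2 := by
    calc b * ε ≤ b * (1 / (2 * b)) := by gcongr; exact hε ▸ min_le_right _ _
      _ = 1 / 2 := by field_simp
  have hy0 : ∀ n : ℕ, 0 < ε / μ ^ n := fun n => by positivity
  have hyε : ∀ n : ℕ, ε / μ ^ n ≤ ε := fun n => div_le_self hε0.le (one_le_pow₀ hμ.le)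
  obtain ⟨u, hu⟩ : ∃ u : ℕ → ℝ, ∀ n, u n = ε / μ ^ n - b * (ε / μ ^ n) ^ 2 := ⟨_, fun _ => rfl⟩
  have hu_le : ∀ n, u n ≤ ε / μ ^ n := fun n => by
    rw [hu]; nlinarith [sq_nonneg (ε / μ ^ n)]
  have hu_pos : ∀ n, 0 < u n := fun n => by
    rw [hu]
    have h1 : b * (ε / μ ^ n) ≤ 1 / 2 := (mul_le_mul_of_nonneg_left (hyε n) hbpos.le).trans hεb
    nlinarith [hy0 n]
  have hu_mem : ∀ n, 1 - u n ∈ Set.Icc (0 : ℝ) 1 := fun n =>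
    ⟨by linarith [hu_le n, hyε n], by linarith [hu_pos n]⟩
  have hstep : ∀ n, gf p (1 - u (n + 1)) ≤ 1 - u n := by
    intro n
    have h1 := hquad (-u (n + 1)) (by linarith [(hu_mem (n + 1)).1]) (by linarith [hu_pos (n + 1)])
    rw [← sub_eq_add_neg] at h1
    obtain ⟨y, hy⟩ : ∃ y, y = ε / μ ^ (n + 1) := ⟨_, rfl⟩
    have hyn : ε / μ ^ n = μ * y := by rw [hy, pow_succ]; field_simp
    have h2 : u (n + 1) ^ 2 ≤ y ^ 2 := by
      have := hu_pos (n + 1)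
      have := hu_le (n + 1)
      rw [hy]
      gcongr
    have h3 : u (n + 1) = y - b * y ^ 2 := by rw [hu, hy]
    have h4 : u n = μ * y - b * (μ * y) ^ 2 := by rw [hu, hyn]
    have h5 : κ * u (n + 1) ^ 2 ≤ κ * y ^ 2 := by gcongr
    rw [h4]
    calc gf p (1 - u (n + 1)) ≤ 1 + μ * (-u (n + 1)) + κ * y ^ 2 := by linarith
      _ = 1 - (μ * y - b * (μ * y) ^ 2) := by rw [h3, ← hbκ]; ring
  have hiter : ∀ n, (gf p)^[n] (1 - u n) ≤ 1 - u 0 := by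
    intro n
    induction n with
    | zero => exact le_rfl
    | succ n ih =>
      rw [Function.iterate_succ_apply]
      exact (monotoneOn_iterate_gf p n (gf_mem_Icc p (hu_mem _)) (hu_mem n) (hstep n)).trans ih
  -- A fixed number m of further iterations brings 1 - u_0 below exp(-1/c_0) > 𝔠. This costs a
  -- factor μ^m in the constant, and for n ≤ m the bound is trivial.
  obtain ⟨m, hm⟩ := ((hp.tendsto_iterate_gf hc.extR_lt_one (hu_mem 0).1
    (by linarith [hu_pos 0])).eventually_lt_const hc.extR_lt).exists
  have hmain : ∀ n, 1 - u n ≤ normExp c (m + n) := by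
    intro n
    rw [← (hp.strictMonoOn_iterate_gf (m + n)).le_iff_le (hu_mem n) (hc.normExp_mem _),
      hc.iterate_normExp, Function.iterate_add_apply]
    exact (monotoneOn_iterate_gf p m (iterate_gf_mem_Icc p (hu_mem n) n) (hu_mem 0)
      (hiter n)).trans hm.le
  refine ⟨μ ^ m, by positivity, fun n => ?_⟩
  rcases le_total m n with h | h
  · obtain ⟨k, rfl⟩ := Nat.exists_eq_add_of_le h
    calc 1 - normExp c (m + k) ≤ u k := by linarith [hmain k]
      _ ≤ 1 / μ ^ k := (hu_le k).trans (by gcongr)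
      _ = μ ^ m / μ ^ (m + k) := by rw [pow_add]; field_simp
  · have h1 : (1 : ℝ) ≤ μ ^ m / μ ^ n := by
      rw [one_le_div (by positivity)]
      exact pow_le_pow_right₀ hμ.le h
    linarith [(hc.normExp_mem n).1]

theorem neg_log_le_div {x : ℝ} (hx : 0 < x) : -Real.log x ≤ (1 - x) / x := by
  have := Real.one_sub_inv_le_log_of_pos hx
  rw [sub_div, div_self hx.ne', one_div]
  linarith

theorem inv_eq_neg_log_normExp (c : ℕ → ℝ) (n : ℕ) : (c n)⁻¹ = -Real.log (normExp c n) := by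
  rw [normExp, Real.log_exp, neg_neg]

theorem IsSenetaHeyde.exists_inv_le {p : PMF ℕ} (hp : IsSupercritical p) {c : ℕ → ℝ}
    (hc : IsSenetaHeyde p c) : ∃ C > 0, ∀ n, (c n)⁻¹ ≤ C / meanR p ^ n := by
  obtain ⟨C, hC, h⟩ := hc.exists_one_sub_normExp_le hp
  have h0 : 0 < normExp c 0 := Real.exp_pos _
  refine ⟨C / normExp c 0, by positivity, fun n => ?_⟩
  have hn : 0 < normExp c n := Real.exp_pos _
  have hμ := hp.meanR_pos
  calc (c n)⁻¹ ≤ (1 - normExp c n) / normExp c n := by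
        rw [inv_eq_neg_log_normExp]; exact neg_log_le_div hn
    _ ≤ (C / meanR p ^ n) / normExp c 0 := by
        gcongr
        · exact h n
        · exact hc.normExp_zero_le hp n
    _ = _ := by field_simp

theorem IsSenetaHeyde.tendsto_normExp {p : PMF ℕ} (hp : IsSupercritical p) {c : ℕ → ℝ}
    (hc : IsSenetaHeyde p c) : Tendsto (fun n => 1 - normExp c n) atTop (𝓝 0) := by
  obtain ⟨C, hC, h⟩ := hc.exists_one_sub_normExp_le hp
  refine squeeze_zero (fun n => sub_nonneg.2 (hc.normExp_mem n).2) h ?_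
  simpa using tendsto_const_nhds.div_atTop (tendsto_pow_atTop_atTop_of_one_lt hp.one_lt_meanR)

/-- Near 1, 1 - f(s) = μ(1 - s) + O((1 - s)²) and -log s is equivalent to 1 - s. Applied to s =
exp(-1/c_{n+1}), whose image is exp(-1/c_n), this gives two-sided bounds on the ratio that tend to
1. -/
theorem IsSenetaHeyde.tendsto_ratio {p : PMF ℕ} (hp : IsSupercritical p) {c : ℕ → ℝ}
    (hc : IsSenetaHeyde p c) :
    Tendsto (fun n => meanR p * (c (n + 1))⁻¹ / (c n)⁻¹) atTop (𝓝 1) := by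
  obtain ⟨δ, hδ, κ, hκ, -, hquad⟩ := hp.exists_quadratic_bound
  have hμ := hp.one_lt_meanR
  have hlim := hc.tendsto_normExp hp
  have hlim1 : Tendsto (fun n => 1 - normExp c (n + 1)) atTop (𝓝 0) :=
    hlim.comp (tendsto_add_atTop_nat 1)
  have hup : ∀ n, 1 - normExp c n ≤ meanR p * (1 - normExp c (n + 1)) := fun n => by
    have := hp.one_add_mul_le_gf (y := normExp c (n + 1) - 1)
      (by linarith [(hc.normExp_mem (n + 1)).1]) (by linarith [(hc.normExp_mem (n + 1)).2])
    rw [add_sub_cancel, hc.gf_normExp hp] at this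
    linarith
  have hlow : ∀ n, meanR p * (1 - normExp c (n + 1)) - κ * (1 - normExp c (n + 1)) ^ 2
      ≤ 1 - normExp c n := fun n => by
    have := hquad (normExp c (n + 1) - 1)
      (by linarith [(hc.normExp_mem (n + 1)).1]) (by linarith [(hc.normExp_mem (n + 1)).2])
    rw [add_sub_cancel, hc.gf_normExp hp] at this
    nlinarith
  generalize meanR p = μ at *
  have hg1 : Tendsto (fun n => 1 - (1 - normExp c n)) atTop (𝓝 1) := by
    simpa using hlim.const_sub 1
  have hg2 : Tendsto (fun n => μ / ((1 - (1 - normExp c (n + 1))) *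
      (μ - κ * (1 - normExp c (n + 1))))) atTop (𝓝 1) := by
    have := (tendsto_const_nhds (x := μ)).div ((hlim1.const_sub 1).mul
      ((hlim1.const_mul κ).const_sub μ)) (by simp; linarith)
    simp only [sub_zero, mul_zero, one_mul, div_self (by linarith : μ ≠ 0)] at this
    exact this
  have hev : ∀ᶠ n in atTop, κ * (1 - normExp c (n + 1)) < μ := by
    have := hlim1.const_mul κ
    rw [mul_zero] at this
    exact this.eventually_lt_const (by linarith)
  refine tendsto_of_tendsto_of_tendsto_of_le_of_le' hg1 hg2 (Eventually.of_forall fun n => ?_) ?_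
  · have hpos := hc.inv_pos n
    rw [le_div_iff₀ hpos]
    have h1 : 1 - normExp c (n + 1) ≤ (c (n + 1))⁻¹ := by
      have := Real.add_one_le_exp (-(c (n + 1))⁻¹)
      rw [normExp]; linarith
    have hn : 0 < normExp c n := Real.exp_pos _
    have h2 : normExp c n * (c n)⁻¹ ≤ 1 - normExp c n := by
      have := neg_log_le_div hn
      rw [← inv_eq_neg_log_normExp, le_div_iff₀ hn] at this
      linarith
    have h3 : μ * (1 - normExp c (n + 1)) ≤ μ * (c (n + 1))⁻¹ := by gcongr
    calc _ = normExp c n * (c n)⁻¹ := by ring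
      _ ≤ _ := by linarith [hup n]
  · filter_upwards [hev] with n hn
    have hpos := hc.inv_pos n
    have hx : 0 < normExp c (n + 1) := Real.exp_pos _
    have h1 : 1 - normExp c n ≤ (c n)⁻¹ := by
      have := Real.add_one_le_exp (-(c n)⁻¹)
      rw [normExp]; linarith
    have h2 : normExp c (n + 1) * (c (n + 1))⁻¹ ≤ 1 - normExp c (n + 1) := by
      have := neg_log_le_div hx
      rw [← inv_eq_neg_log_normExp, le_div_iff₀ hx] at this
      linarith
    have h4 := hlow n
    generalize normExp c (n + 1) = x at *
    generalize normExp c n = x' at *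
    have h5 : 0 < x * (μ - κ * (1 - x)) := mul_pos hx (by linarith)
    rw [sub_sub_cancel, div_le_div_iff₀ hpos h5]
    have h6 : (1 - x) * (μ - κ * (1 - x)) ≤ (c n)⁻¹ := by nlinarith
    calc μ * (c (n + 1))⁻¹ * (x * (μ - κ * (1 - x)))
        = μ * ((x * (c (n + 1))⁻¹) * (μ - κ * (1 - x))) := by ring
      _ ≤ μ * ((1 - x) * (μ - κ * (1 - x))) := by
        gcongr
      _ ≤ μ * (c n)⁻¹ := by gcongr

/-- The same comparison on the other side of 1: v_n = y_n + b y_n² satisfies f(1 + v_{n+1}) ≤ 1 +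
v_n. Since v_n is only bounded by 2 y_n, the constant is 4κ instead of κ. -/
theorem IsSenetaHeyde.exists_exp_moment {p : PMF ℕ} (hp : IsSupercritical p) {c : ℕ → ℝ}
    (hc : IsSenetaHeyde p c) : ∃ l > 0, ∃ B : ℝ, ∀ n,
      ∫⁻ t, ENNReal.ofReal (Real.exp (l * (c n)⁻¹ * ((t.genSize n).toNat : ℝ)))
        ∂(tauLaw p : Measure PlaneTree) ≤ ENNReal.ofReal B := by
  obtain ⟨δ, hδ, κ, hκ, hs, hquad⟩ := hp.exists_quadratic_bound
  obtain ⟨C, hC, hCn⟩ := hc.exists_inv_le hp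
  have hμ := hp.one_lt_meanR
  have hμ0 := hp.meanR_pos
  generalize meanR p = μ at *
  obtain ⟨b, hb⟩ : ∃ b, b = 4 * κ / (μ * (μ - 1)) := ⟨_, rfl⟩
  have hbpos : 0 < b := by rw [hb]; exact div_pos (by linarith) (mul_pos hμ0 (by linarith))
  have hbκ : b * μ * (μ - 1) = 4 * κ := by
    have : μ - 1 ≠ 0 := by linarith
    rw [hb]; field_simp
  obtain ⟨ε, hε⟩ : ∃ ε, ε = min 1 (min (δ / 2) (1 / b)) := ⟨_, rfl⟩
  have hε0 : 0 < ε := by rw [hε]; positivity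
  have hε1 : ε ≤ 1 := hε ▸ min_le_left _ _
  have hεδ : 2 * ε ≤ δ := by
    have : ε ≤ δ / 2 := hε ▸ (min_le_right _ _).trans (min_le_left _ _)
    linarith
  have hεb : b * ε ≤ 1 := by
    calc b * ε ≤ b * (1 / b) := by gcongr; exact hε ▸ (min_le_right _ _).trans (min_le_right _ _)
      _ = 1 := by field_simp
  have hy0 : ∀ n : ℕ, 0 < ε / μ ^ n := fun n => by positivity
  have hyε : ∀ n : ℕ, ε / μ ^ n ≤ ε := fun n => div_le_self hε0.le (one_le_pow₀ hμ.le)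
  obtain ⟨v, hv⟩ : ∃ v : ℕ → ℝ, ∀ n, v n = ε / μ ^ n + b * (ε / μ ^ n) ^ 2 := ⟨_, fun _ => rfl⟩
  have hv_ge : ∀ n, ε / μ ^ n ≤ v n := fun n => by
    rw [hv]; nlinarith [sq_nonneg (ε / μ ^ n)]
  have hv_le : ∀ n, v n ≤ 2 * (ε / μ ^ n) := fun n => by
    rw [hv]
    have h1 : b * (ε / μ ^ n) ≤ 1 := (mul_le_mul_of_nonneg_left (hyε n) hbpos.le).trans hεb
    nlinarith [hy0 n]
  have hv_pos : ∀ n, 0 < v n := fun n => (hy0 n).trans_le (hv_ge n)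
  have hvδ : ∀ n, v n ≤ δ := fun n => (hv_le n).trans (by linarith [hyε n])
  have hstep : ∀ n, genFun p (ENNReal.ofReal (1 + v (n + 1))) ≤ ENNReal.ofReal (1 + v n) := by
    intro n
    have h0 := hv_pos (n + 1)
    have h1 := hquad (v (n + 1)) (by linarith) (hvδ _)
    rw [genFun_ofReal p (by linarith) (hs.of_nonneg_of_le (fun n => by positivity) fun k => by
      gcongr; exact hvδ _)]
    refine ENNReal.ofReal_le_ofReal (h1.trans ?_)
    obtain ⟨y, hy⟩ : ∃ y, y = ε / μ ^ (n + 1) := ⟨_, rfl⟩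
    have hyn : ε / μ ^ n = μ * y := by rw [hy, pow_succ]; field_simp
    have h2 : v (n + 1) ^ 2 ≤ (2 * y) ^ 2 := by
      have := hv_le (n + 1)
      rw [hy]
      gcongr
    have h3 : v (n + 1) = y + b * y ^ 2 := by rw [hv, hy]
    have h4 : v n = μ * y + b * (μ * y) ^ 2 := by rw [hv, hyn]
    have h5 : κ * v (n + 1) ^ 2 ≤ κ * (2 * y) ^ 2 := by gcongr
    calc 1 + μ * v (n + 1) + κ * v (n + 1) ^ 2 ≤ 1 + μ * v (n + 1) + κ * (2 * y) ^ 2 := by linarith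
      _ = 1 + μ * v (n + 1) + 4 * κ * y ^ 2 := by ring
      _ = 1 + v n := by rw [h3, h4, ← hbκ]; ring
  have hiter : ∀ n, (genFun p)^[n] (ENNReal.ofReal (1 + v n)) ≤ ENNReal.ofReal (1 + v 0) := by
    intro n
    induction n with
    | zero => exact le_rfl
    | succ n ih =>
      rw [Function.iterate_succ_apply]
      exact ((genFun_mono p).iterate n (hstep n)).trans ih
  -- With a = l/c_n ≤ y_n/2 ≤ 1, one gets exp(a) ≤ 1 + a + a² ≤ 1 + 2a ≤ 1 + v_n.
  refine ⟨ε / (2 * C), by positivity, 1 + v 0, fun n => ?_⟩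
  rw [lintegral_exp_genSize]
  refine ((genFun_mono p).iterate n (ENNReal.ofReal_le_ofReal ?_)).trans (hiter n)
  have hcn := hc.inv_pos n
  have h1 : ε / (2 * C) * (c n)⁻¹ ≤ ε / μ ^ n / 2 := by
    calc ε / (2 * C) * (c n)⁻¹ ≤ ε / (2 * C) * (C / μ ^ n) := by gcongr; exact hCn n
      _ = _ := by field_simp
  have h0 : 0 ≤ ε / (2 * C) * (c n)⁻¹ := by positivity
  generalize ε / (2 * C) * (c n)⁻¹ = a at *
  have h2 : a ≤ 1 := by linarith [hyε n]
  have h3 := Real.abs_exp_sub_one_sub_id_le (x := a) (by rwa [abs_of_nonneg h0])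
  have h4 := (abs_le.1 h3).2
  nlinarith [hv_ge n]

/-! ### The limit `W` -/

theorem measurable_limW (c : ℕ → ℝ) : Measurable (limW c) := by
  refine Measurable.ennreal_toReal (Measurable.limsup fun n => ?_)
  exact ((measurable_of_countable fun k : ℕ∞ => (k : ℝ≥0∞)).comp (measurable_genSize n)).div_const _

theorem limW_nonneg (c : ℕ → ℝ) (t : PlaneTree) : 0 ≤ limW c t := ENNReal.toReal_nonneg

theorem limW_eq_of_tendsto {c : ℕ → ℝ} (hc : ∀ n, 0 < c n) {t : PlaneTree}
    (ht : ∀ n, t.genSize n ≠ ⊤) {w : ℝ}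
    (h : Tendsto (fun n => (c n)⁻¹ * ((t.genSize n).toNat : ℝ)) atTop (𝓝 w)) : limW c t = w := by
  have hw : 0 ≤ w := ge_of_tendsto' h fun n => by
    have := hc n
    positivity
  have h1 : ∀ n, ((t.genSize n : ℕ∞) : ℝ≥0∞) / ENNReal.ofReal (c n)
      = ENNReal.ofReal ((c n)⁻¹ * ((t.genSize n).toNat : ℝ)) := by
    intro n
    obtain ⟨k, hk⟩ := ENat.ne_top_iff_exists.1 (ht n)
    rw [← hk, ENat.toNat_natCast, mul_comm, ← div_eq_mul_inv, ENNReal.ofReal_div_of_pos (hc n)]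
    simp
  have h2 : Tendsto (fun n => ENNReal.ofReal ((c n)⁻¹ * ((t.genSize n).toNat : ℝ))) atTop
      (𝓝 (ENNReal.ofReal w)) := (ENNReal.continuous_ofReal.tendsto w).comp h
  rw [limW, funext h1, h2.limsup_eq, ENNReal.toReal_ofReal hw]

/-- The bounded martingale exp(-Z_n/c_n) converges. Its limit is not 0, since otherwise Z_n/c_n
would tend to ∞, which Fatou's lemma and the uniform exponential moment exclude. One can then take
logarithms. -/
theorem IsSenetaHeyde.ae_tendsto_limW {p : PMF ℕ} (hp : IsSupercritical p) {c : ℕ → ℝ}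
    (hc : IsSenetaHeyde p c) : ∀ᵐ t ∂(tauLaw p : Measure PlaneTree),
      Tendsto (fun n => (c n)⁻¹ * ((t.genSize n).toNat : ℝ)) atTop (𝓝 (limW c t)) := by
  obtain ⟨ℱ, hM⟩ := hc.2.2
  have h1 : ∀ᵐ t ∂(tauLaw p : Measure PlaneTree), ∃ y : ℝ,
      Tendsto (fun n => Real.exp (-((c n)⁻¹ * ((t.genSize n).toNat : ℝ)))) atTop (𝓝 y) := by
    have := hM.submartingale.ae_tendsto_limitProcess (R := 1) fun n => by
      rw [ENNReal.coe_one]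
      refine (eLpNorm_le_of_ae_bound (C := 1) (Eventually.of_forall fun t => ?_)).trans (by simp)
      rw [Real.norm_of_nonneg (Real.exp_pos _).le, Real.exp_le_one_iff, neg_div, neg_nonpos]
      have := hc.1 n
      positivity
    filter_upwards [this] with t ht
    refine ⟨_, ht.congr fun n => ?_⟩
    congr 1
    ring
  obtain ⟨l, hl, B, hB⟩ := hc.exists_exp_moment hp
  have h2 : ∀ᵐ t ∂(tauLaw p : Measure PlaneTree), liminf (fun n =>
      ENNReal.ofReal (Real.exp (l * (c n)⁻¹ * ((t.genSize n).toNat : ℝ)))) atTop < ∞ := by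
    have hmeas : ∀ n, Measurable fun t : PlaneTree =>
        ENNReal.ofReal (Real.exp (l * (c n)⁻¹ * ((t.genSize n).toNat : ℝ))) := fun n =>
      ((measurable_genSize_toNat n).const_mul _).exp.ennreal_ofReal
    refine ae_lt_top (Measurable.liminf hmeas) (ne_top_of_le_ne_top (b := ENNReal.ofReal B)
      (by simp) ((lintegral_liminf_le hmeas).trans ?_))
    exact (liminf_le_liminf (Eventually.of_forall hB)).trans (by simp)
  filter_upwards [h1, h2, ae_genSize_ne_top p] with t ⟨y, hy⟩ ht2 ht3
  have hy0 : 0 ≤ y := ge_of_tendsto' hy fun n => (Real.exp_pos _).le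
  rcases hy0.eq_or_lt with rfl | hypos
  · exfalso
    have h3 : Tendsto (fun n => (c n)⁻¹ * ((t.genSize n).toNat : ℝ)) atTop atTop := by
      have := Real.tendsto_exp_comp_nhds_zero.1 hy
      exact tendsto_neg_atBot_iff.1 this
    have h4 : Tendsto (fun n => ENNReal.ofReal (Real.exp (l * (c n)⁻¹ *
        ((t.genSize n).toNat : ℝ)))) atTop (𝓝 ∞) := by
      refine ENNReal.tendsto_ofReal_nhds_top.2 (Real.tendsto_exp_atTop.comp ?_)
      simp only [mul_assoc]
      exact h3.const_mul_atTop hl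
    rw [h4.liminf_eq] at ht2
    exact lt_irrefl _ ht2
  · have h3 := ((Real.continuousAt_log hypos.ne').tendsto.comp hy).neg
    simp only [Function.comp_def, Real.log_exp, neg_neg] at h3
    rwa [limW_eq_of_tendsto hc.1 ht3 h3]

/-- The law of `W`. -/
def limLaw (p : PMF ℕ) (c : ℕ → ℝ) : Measure ℝ := (tauLaw p : Measure PlaneTree).map (limW c)

instance (p : PMF ℕ) (c : ℕ → ℝ) : IsProbabilityMeasure (limLaw p c) :=
  Measure.isProbabilityMeasure_map (measurable_limW c).aemeasurable

theorem ae_limLaw_nonneg (p : PMF ℕ) (c : ℕ → ℝ) : ∀ᵐ x ∂limLaw p c, 0 ≤ x := by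
  rw [limLaw, ae_map_iff (measurable_limW c).aemeasurable measurableSet_Ici]
  exact Eventually.of_forall (limW_nonneg c)

/-- The Laplace transform `∫ exp (l x) ν(dx)`. -/
def lap (ν : Measure ℝ) (l : ℝ) : ℝ≥0∞ := ∫⁻ x, ENNReal.ofReal (Real.exp (l * x)) ∂ν

theorem measurable_exp_mul (l : ℝ) : Measurable fun x : ℝ => ENNReal.ofReal (Real.exp (l * x)) := by
  fun_prop

theorem lap_limLaw (p : PMF ℕ) (c : ℕ → ℝ) (l : ℝ) : lap (limLaw p c) l
    = ∫⁻ t, ENNReal.ofReal (Real.exp (l * limW c t)) ∂(tauLaw p : Measure PlaneTree) := by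
  rw [lap, limLaw, lintegral_map (measurable_exp_mul l) (measurable_limW c)]

theorem IsSenetaHeyde.exists_lap_lt_top {p : PMF ℕ} (hp : IsSupercritical p) {c : ℕ → ℝ}
    (hc : IsSenetaHeyde p c) : ∃ l > 0, lap (limLaw p c) l < ∞ := by
  obtain ⟨l, hl, B, hB⟩ := hc.exists_exp_moment hp
  refine ⟨l, hl, ?_⟩
  rw [lap_limLaw]
  have hmeas : ∀ n, Measurable fun t : PlaneTree =>
      ENNReal.ofReal (Real.exp (l * (c n)⁻¹ * ((t.genSize n).toNat : ℝ))) := fun n =>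
    ((measurable_genSize_toNat n).const_mul _).exp.ennreal_ofReal
  refine lt_of_le_of_lt ?_ (ENNReal.ofReal_lt_top (r := B))
  calc _ = ∫⁻ t, liminf (fun n => ENNReal.ofReal (Real.exp (l * (c n)⁻¹ *
        ((t.genSize n).toNat : ℝ)))) atTop ∂(tauLaw p : Measure PlaneTree) := by
        refine lintegral_congr_ae ?_
        filter_upwards [hc.ae_tendsto_limW hp] with t ht
        have : Continuous fun x : ℝ => ENNReal.ofReal (Real.exp (l * x)) :=
          ENNReal.continuous_ofReal.comp (by fun_prop)
        have h := ((this.tendsto _).comp ht).liminf_eq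
        rw [← h]
        simp only [Function.comp_def, mul_assoc]
    _ ≤ _ := lintegral_liminf_le hmeas
    _ ≤ _ := (liminf_le_liminf (Eventually.of_forall hB)).trans (by simp)

/-- The parameter varies with n in order to absorb the ratio μ c_n / c_{n+1} in the functional
equation. -/
theorem IsSenetaHeyde.tendsto_iterate_lap {p : PMF ℕ} (hp : IsSupercritical p) {c : ℕ → ℝ}
    (hc : IsSenetaHeyde p c) {l : ℝ} {a : ℕ → ℝ} (ha0 : ∀ n, 0 ≤ a n)
    (ha : Tendsto a atTop (𝓝 l)) :
    Tendsto (fun n => (gf p)^[n] (Real.exp (-(a n * (c n)⁻¹)))) atTop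
      (𝓝 (lap (limLaw p c) (-l)).toReal) := by
  have hl0 : 0 ≤ l := ge_of_tendsto' ha ha0
  have h1 : Tendsto (fun n => ∫⁻ t, ENNReal.ofReal (Real.exp (-(a n * (c n)⁻¹) *
      ((t.genSize n).toNat : ℝ))) ∂(tauLaw p : Measure PlaneTree)) atTop
      (𝓝 (lap (limLaw p c) (-l))) := by
    rw [lap_limLaw]
    refine tendsto_lintegral_of_dominated_convergence (fun _ => 1) (fun n => ?_) (fun n => ?_)
      (by simp) ?_
    · exact ((measurable_genSize_toNat n).const_mul _).exp.ennreal_ofReal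
    · refine Eventually.of_forall fun t => ?_
      rw [← ENNReal.ofReal_one]
      refine ENNReal.ofReal_le_ofReal (Real.exp_le_one_iff.2 ?_)
      have := ha0 n
      have := hc.inv_pos n
      rw [neg_mul, neg_nonpos]
      positivity
    · filter_upwards [hc.ae_tendsto_limW hp] with t ht
      have h2 : Tendsto (fun n => -(a n * (c n)⁻¹) * ((t.genSize n).toNat : ℝ)) atTop
          (𝓝 (-l * limW c t)) := by
        refine ((ha.neg).mul ht).congr fun n => ?_
        ring
      exact (ENNReal.continuous_ofReal.comp Real.continuous_exp).continuousAt.tendsto.comp h2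
  have hne : lap (limLaw p c) (-l) ≠ ∞ := by
    refine ne_top_of_le_ne_top (b := 1) (by simp) ?_
    rw [lap_limLaw]
    refine (lintegral_mono (g := fun _ => 1) fun t => ?_).trans (by simp)
    rw [← ENNReal.ofReal_one]
    refine ENNReal.ofReal_le_ofReal (Real.exp_le_one_iff.2 ?_)
    have := limW_nonneg c t
    rw [neg_mul, neg_nonpos]
    positivity
  refine ((ENNReal.tendsto_toReal hne).comp h1).congr fun n => ?_
  have h0 : 0 ≤ a n * (c n)⁻¹ := mul_nonneg (ha0 n) (hc.inv_pos n).le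
  rw [Function.comp_apply, lintegral_exp_neg_genSize p h0,
    ENNReal.toReal_ofReal (iterate_gf_mem_Icc p (exp_neg_mem_Icc h0) n).1]

theorem lap_neg_le_one (p : PMF ℕ) (c : ℕ → ℝ) {l : ℝ} (hl : l ≤ 0) : lap (limLaw p c) l ≤ 1 := by
  rw [lap_limLaw]
  refine (lintegral_mono (g := fun _ => 1) fun t => ?_).trans (by simp)
  rw [← ENNReal.ofReal_one]
  exact ENNReal.ofReal_le_ofReal (Real.exp_le_one_iff.2
    (mul_nonpos_of_nonpos_of_nonneg hl (limW_nonneg c t)))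

/-- Applying f to the n-th iterate at exp(-μl/c_{n+1}) gives the (n+1)-st iterate. In the scale of
c_n the parameter μl/c_{n+1} is l times a ratio tending to 1, so the two limits are the transforms
at -l and at -μl. -/
theorem IsSenetaHeyde.gf_lap {p : PMF ℕ} (hp : IsSupercritical p) {c : ℕ → ℝ}
    (hc : IsSenetaHeyde p c) {l : ℝ} (hl : 0 ≤ l) :
    gf p (lap (limLaw p c) (-l)).toReal = (lap (limLaw p c) (-(meanR p * l))).toReal := by
  have hμ := hp.meanR_pos
  have h0 : ∀ n, 0 ≤ l * (meanR p * (c (n + 1))⁻¹ / (c n)⁻¹) := fun n => by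
    have := hc.inv_pos n
    have := hc.inv_pos (n + 1)
    positivity
  have h1 := hc.tendsto_iterate_lap hp h0 (by simpa using (hc.tendsto_ratio hp).const_mul l)
  have hmem : ∀ n, (gf p)^[n] (Real.exp (-(l * (meanR p * (c (n + 1))⁻¹ / (c n)⁻¹) * (c n)⁻¹)))
      ∈ Set.Icc (0 : ℝ) 1 := fun n =>
    iterate_gf_mem_Icc p (exp_neg_mem_Icc (mul_nonneg (h0 n) (hc.inv_pos n).le)) n
  have hlim := isClosed_Icc.mem_of_tendsto h1 (Eventually.of_forall hmem)
  have h2 := (hp.continuousOn_gf _ hlim).tendsto.comp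
    (tendsto_nhdsWithin_iff.2 ⟨h1, Eventually.of_forall hmem⟩)
  have h3 := (hc.tendsto_iterate_lap hp (a := fun _ => meanR p * l) (fun _ => by positivity)
    tendsto_const_nhds).comp (tendsto_add_atTop_nat 1)
  refine tendsto_nhds_unique h2 (h3.congr fun n => ?_)
  simp only [Function.comp_apply]
  rw [Function.iterate_succ_apply']
  have := (hc.inv_pos n).ne'
  congr 4
  rw [mul_assoc l, div_mul_cancel₀ _ this]
  ring

theorem IsSenetaHeyde.genFun_lap_neg {p : PMF ℕ} (hp : IsSupercritical p) {c : ℕ → ℝ}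
    (hc : IsSenetaHeyde p c) {l : ℝ} (hl : l ≤ 0) :
    genFun p (lap (limLaw p c) l) = lap (limLaw p c) (meanR p * l) := by
  have h := hc.gf_lap hp (neg_nonneg.2 hl)
  rw [neg_neg, mul_neg, neg_neg] at h
  have h1 := lap_neg_le_one p c hl
  have h2 := lap_neg_le_one p c (mul_nonpos_of_nonneg_of_nonpos hp.meanR_pos.le hl)
  have h3 : (lap (limLaw p c) l).toReal ≤ 1 := by
    rw [← ENNReal.toReal_one]; exact ENNReal.toReal_mono (by simp) h1
  rw [← ENNReal.ofReal_toReal (h1.trans_lt (by simp)).ne,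
    genFun_ofReal p ENNReal.toReal_nonneg (summable_of_le_one p ENNReal.toReal_nonneg h3), h,
    ENNReal.ofReal_toReal (h2.trans_lt (by simp)).ne]

theorem IsSenetaHeyde.lap_neg_one {p : PMF ℕ} (hp : IsSupercritical p) {c : ℕ → ℝ}
    (hc : IsSenetaHeyde p c) : (lap (limLaw p c) (-1)).toReal = normExp c 0 := by
  have h := hc.tendsto_iterate_lap hp (a := fun _ => 1) (fun _ => zero_le_one) tendsto_const_nhds
  refine tendsto_nhds_unique h (tendsto_const_nhds.congr fun n => ?_)
  rw [one_mul, ← hc.iterate_normExp n]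
  rfl

theorem IsSenetaHeyde.lap_neg_pow {p : PMF ℕ} (hp : IsSupercritical p) {c : ℕ → ℝ}
    (hc : IsSenetaHeyde p c) (n : ℕ) :
    (lap (limLaw p c) (-meanR p ^ n)).toReal = (gf p)^[n] (normExp c 0) := by
  induction n with
  | zero => simpa using hc.lap_neg_one hp
  | succ n ih =>
    rw [Function.iterate_succ_apply', ← ih, hc.gf_lap hp (pow_nonneg hp.meanR_pos.le n), pow_succ']

/-- P(W = 0) is the limit of E[exp(-μ^n W)], which is the n-th iterate of f at exp(-1/c_0) and tends
to 𝔠. -/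
theorem IsSenetaHeyde.limLaw_singleton_zero {p : PMF ℕ} (hp : IsSupercritical p) {c : ℕ → ℝ}
    (hc : IsSenetaHeyde p c) : limLaw p c {0} = extProb p := by
  have h1 : Tendsto (fun n : ℕ => lap (limLaw p c) (-meanR p ^ n)) atTop (𝓝 (limLaw p c {0})) := by
    rw [← lintegral_indicator_one (measurableSet_singleton 0)]
    refine tendsto_lintegral_of_dominated_convergence (fun _ => 1)
      (fun n => measurable_exp_mul _) (fun n => ?_) (by simp) ?_
    · filter_upwards [ae_limLaw_nonneg p c] with x hx
      rw [← ENNReal.ofReal_one]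
      refine ENNReal.ofReal_le_ofReal (Real.exp_le_one_iff.2 ?_)
      have := hp.meanR_pos
      rw [neg_mul, neg_nonpos]
      positivity
    · filter_upwards [ae_limLaw_nonneg p c] with x hx
      rcases hx.eq_or_lt with rfl | hx
      · simp
      · rw [Set.indicator_of_notMem (by simpa using hx.ne')]
        rw [← ENNReal.ofReal_zero]
        refine (ENNReal.continuous_ofReal.tendsto _).comp
          (Real.tendsto_exp_atBot.comp ?_)
        simp only [neg_mul]
        exact tendsto_neg_atTop_atBot.comp
          ((tendsto_pow_atTop_atTop_of_one_lt hp.one_lt_meanR).atTop_mul_const hx)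
  have h2 := (ENNReal.tendsto_toReal (measure_ne_top (limLaw p c) {0})).comp h1
  have h3 := hp.tendsto_iterate_gf hc.extR_lt_one (hc.normExp_mem 0).1 (hc.normExp_lt_one 0)
  have h4 : (limLaw p c {0}).toReal = extR p :=
    tendsto_nhds_unique h2 (h3.congr fun n => (hc.lap_neg_pow hp n).symm)
  rw [← ofReal_extR, ← h4, ENNReal.ofReal_toReal (measure_ne_top _ _)]

/-! ### Laplace transforms on the half-line -/

theorem integral_pow_map_exp_neg {ν : Measure ℝ} (k : ℕ) :
    ∫ y, y ^ k ∂(ν.map fun x => Real.exp (-x)) = (lap ν (-k)).toReal := by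
  rw [integral_map (by fun_prop) (by fun_prop), integral_eq_lintegral_of_nonneg_ae
    (Eventually.of_forall fun x => pow_nonneg (Real.exp_pos _).le k) (by fun_prop), lap]
  congr 1
  refine lintegral_congr fun x => ?_
  rw [← Real.exp_nat_mul]
  congr 2
  ring

/-- The Laplace transform at integers gives the moments of the image of ν under exp(-x). That image
lives on [0, 1], so its characteristic function is the sum of its moment series. -/
theorem charFun_map_exp_neg {ν : Measure ℝ} [IsFiniteMeasure ν] (h0 : ∀ᵐ x ∂ν, 0 ≤ x) (t : ℝ) :
    HasSum (fun k : ℕ => (((lap ν (-k)).toReal : ℝ) : ℂ) * ((t * Complex.I) ^ k / k.factorial))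
      (charFun (ν.map fun x => Real.exp (-x)) t) := by
  have hm : Measurable fun x : ℝ => Real.exp (-x) := by fun_prop
  have : IsFiniteMeasure (ν.map fun x => Real.exp (-x)) := Measure.isFiniteMeasure_map _ _
  have hb : ∀ᵐ y ∂(ν.map fun x => Real.exp (-x)), y ∈ Set.Icc (0 : ℝ) 1 := by
    rw [ae_map_iff (p := fun y => y ∈ Set.Icc (0 : ℝ) 1) hm.aemeasurable measurableSet_Icc]
    filter_upwards [h0] with x hx
    exact exp_neg_mem_Icc hx
  have hnorm : ∀ k : ℕ, ∀ᵐ y : ℝ ∂(ν.map fun x => Real.exp (-x)),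
      ‖((y : ℂ) ^ k) * ((t * Complex.I) ^ k / (k.factorial : ℂ))‖ ≤ |t| ^ k / k.factorial := by
    intro k
    filter_upwards [hb] with y hy
    rw [norm_mul, norm_div, norm_pow, norm_pow, norm_mul, Complex.norm_I, mul_one,
      Complex.norm_real, Complex.norm_real, Complex.norm_natCast, Real.norm_eq_abs t]
    refine mul_le_of_le_one_left (by positivity) (pow_le_one₀ (norm_nonneg _) ?_)
    rw [Real.norm_of_nonneg hy.1]
    exact hy.2
  have h := hasSum_integral_of_dominated_convergence (μ := ν.map fun x => Real.exp (-x))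
    (F := fun (k : ℕ) (y : ℝ) => ((y : ℂ) ^ k) * ((t * Complex.I) ^ k / (k.factorial : ℂ)))
    (f := fun y : ℝ => Complex.exp (t * y * Complex.I)) (fun k _ => |t| ^ k / k.factorial)
    (fun k => by fun_prop) hnorm
    (Eventually.of_forall fun _ => Real.summable_pow_div_factorial |t|)
    (integrable_const _) (Eventually.of_forall fun y => ?_)
  · rw [charFun_apply_real]
    convert! h using 2 with k
    rw [integral_mul_const, ← integral_pow_map_exp_neg, ← integral_complex_ofReal]
    simp
  · have := NormedSpace.expSeries_div_hasSum_exp (𝔸 := ℂ) (t * y * Complex.I)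
    rw [← Complex.exp_eq_exp_ℂ] at this
    convert! this using 2 with k
    ring

/-- A finite measure on the half-line is determined by its Laplace transform. -/
theorem ext_of_lap {ν ν' : Measure ℝ} [IsFiniteMeasure ν] [IsFiniteMeasure ν']
    (h0 : ∀ᵐ x ∂ν, 0 ≤ x) (h0' : ∀ᵐ x ∂ν', 0 ≤ x) (h : ∀ k : ℕ, lap ν (-k) = lap ν' (-k)) :
    ν = ν' := by
  have hm : Measurable fun x : ℝ => Real.exp (-x) := by fun_prop
  have : IsFiniteMeasure (ν.map fun x => Real.exp (-x)) := Measure.isFiniteMeasure_map _ _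
  have : IsFiniteMeasure (ν'.map fun x => Real.exp (-x)) := Measure.isFiniteMeasure_map _ _
  have h1 : ν.map (fun x => Real.exp (-x)) = ν'.map fun x => Real.exp (-x) := by
    refine Measure.ext_of_charFun (funext fun t => ?_)
    have h2 := charFun_map_exp_neg h0 t
    simp only [h] at h2
    exact h2.unique (charFun_map_exp_neg h0' t)
  have h3 : ∀ ρ : Measure ℝ, (ρ.map fun x => Real.exp (-x)).map (fun y => -Real.log y) = ρ := by
    intro ρ
    rw [Measure.map_map (by fun_prop) hm]
    simp [Function.comp_def]
  rw [← h3 ν, h1, h3]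

/-! ### Convolution powers and the functional equation -/

theorem lap_conv (ν ρ : Measure ℝ) [SFinite ν] [SFinite ρ] (l : ℝ) :
    lap (ν ∗ ρ) l = lap ν l * lap ρ l := by
  rw [lap, Measure.lintegral_conv (measurable_exp_mul l), lap, lap, ← lintegral_mul_const _
    (measurable_exp_mul l)]
  refine lintegral_congr fun x => ?_
  rw [← lintegral_const_mul _ (measurable_exp_mul l)]
  refine lintegral_congr fun y => ?_
  rw [← ENNReal.ofReal_mul (Real.exp_pos _).le, ← Real.exp_add, mul_add]

theorem ae_nonneg_conv {ν ρ : Measure ℝ} [SFinite ν] [SFinite ρ] (h : ∀ᵐ x ∂ν, 0 ≤ x)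
    (h' : ∀ᵐ x ∂ρ, 0 ≤ x) : ∀ᵐ x ∂(ν ∗ ρ), 0 ≤ x := by
  rw [Measure.conv, ae_map_iff (by fun_prop) measurableSet_Ici]
  filter_upwards [Measure.quasiMeasurePreserving_fst.ae h,
    Measure.quasiMeasurePreserving_snd.ae h'] with x hx hy
  exact add_nonneg hx hy

/-- The convolution powers of a measure. -/
def convPow (ν : Measure ℝ) : ℕ → Measure ℝ
  | 0 => Measure.dirac 0
  | n + 1 => convPow ν n ∗ ν

instance (ν : Measure ℝ) [IsProbabilityMeasure ν] (n : ℕ) : IsProbabilityMeasure (convPow ν n) := by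
  induction n with
  | zero => unfold convPow; infer_instance
  | succ n ih => unfold convPow; infer_instance

theorem lap_convPow (ν : Measure ℝ) [IsProbabilityMeasure ν] (n : ℕ) (l : ℝ) :
    lap (convPow ν n) l = lap ν l ^ n := by
  induction n with
  | zero => simp [convPow, lap, lintegral_dirac' _ (measurable_exp_mul l)]
  | succ n ih => rw [convPow, lap_conv, ih, pow_succ]

theorem charFun_convPow (ν : Measure ℝ) [IsProbabilityMeasure ν] (n : ℕ) (t : ℝ) :
    charFun (convPow ν n) t = charFun ν t ^ n := by
  induction n with
  | zero => simp [convPow, charFun_dirac]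
  | succ n ih => rw [convPow, charFun_conv, ih, pow_succ]

theorem ae_nonneg_convPow {ν : Measure ℝ} [IsProbabilityMeasure ν] (h : ∀ᵐ x ∂ν, 0 ≤ x) (n : ℕ) :
    ∀ᵐ x ∂convPow ν n, 0 ≤ x := by
  induction n with
  | zero => rw [convPow, ae_dirac_iff measurableSet_Ici]
  | succ n ih => exact ae_nonneg_conv ih h

/-- The law of a sum of a random number, with law `p`, of independent variables of law `ν`. -/
def compound (p : PMF ℕ) (ν : Measure ℝ) : Measure ℝ :=
  Measure.sum fun n => p n • convPow ν n

theorem lintegral_compound (p : PMF ℕ) (ν : Measure ℝ) (g : ℝ → ℝ≥0∞) :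
    ∫⁻ x, g x ∂compound p ν = ∑' n, p n * ∫⁻ x, g x ∂convPow ν n := by
  rw [compound, lintegral_sum_measure]
  refine tsum_congr fun n => ?_
  rw [lintegral_smul_measure, smul_eq_mul]

instance (p : PMF ℕ) (ν : Measure ℝ) [IsProbabilityMeasure ν] :
    IsProbabilityMeasure (compound p ν) := by
  constructor
  have := lintegral_compound p ν fun _ => 1
  simpa [p.tsum_coe] using this

theorem lap_compound (p : PMF ℕ) (ν : Measure ℝ) [IsProbabilityMeasure ν] (l : ℝ) :
    lap (compound p ν) l = genFun p (lap ν l) := by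
  rw [lap, lintegral_compound, genFun]
  refine tsum_congr fun n => ?_
  rw [← lap_convPow]
  rfl

theorem charFun_compound (p : PMF ℕ) (ν : Measure ℝ) [IsProbabilityMeasure ν] (t : ℝ) :
    charFun (compound p ν) t = gf p (charFun ν t) := by
  have hint : Integrable (fun x : ℝ => Complex.exp (t * x * Complex.I)) (compound p ν) := by
    refine (integrable_const (1 : ℝ)).mono' (by fun_prop) (Eventually.of_forall fun x => ?_)
    rw [← Complex.ofReal_mul, Complex.norm_exp_ofReal_mul_I]
  rw [charFun_apply_real, gf]
  rw [compound] at hint ⊢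
  rw [integral_sum_measure hint]
  refine tsum_congr fun n => ?_
  rw [integral_smul_measure, ← charFun_apply_real, charFun_convPow]
  rfl

theorem ae_nonneg_compound (p : PMF ℕ) {ν : Measure ℝ} [IsProbabilityMeasure ν]
    (h : ∀ᵐ x ∂ν, 0 ≤ x) : ∀ᵐ x ∂compound p ν, 0 ≤ x := by
  rw [compound, Measure.ae_sum_iff]
  intro n
  exact (Measure.smul_absolutelyContinuous).ae_le (ae_nonneg_convPow h n)

theorem lap_map_mul (ν : Measure ℝ) (a l : ℝ) : lap (ν.map (a * ·)) l = lap ν (a * l) := by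
  rw [lap, lintegral_map (measurable_exp_mul l) (by fun_prop), lap]
  refine lintegral_congr fun x => ?_
  congr 2
  ring

/-- Transforms at nonpositive parameters determine the laws. Knowing that μW is a sum of a
p-distributed number of independent copies of W, one recovers the functional equation for every real
l, with values in [0, ∞], and for the characteristic function. -/
theorem IsSenetaHeyde.map_limLaw {p : PMF ℕ} (hp : IsSupercritical p) {c : ℕ → ℝ}
    (hc : IsSenetaHeyde p c) :
    (limLaw p c).map (meanR p * ·) = compound p (limLaw p c) := by
  have hm : Measurable fun x : ℝ => meanR p * x := by fun_prop
  have : IsProbabilityMeasure ((limLaw p c).map (meanR p * ·)) :=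
    Measure.isProbabilityMeasure_map hm.aemeasurable
  refine ext_of_lap ?_ (ae_nonneg_compound p (ae_limLaw_nonneg p c)) fun k => ?_
  · rw [ae_map_iff hm.aemeasurable measurableSet_Ici]
    filter_upwards [ae_limLaw_nonneg p c] with x hx
    exact mul_nonneg hp.meanR_pos.le hx
  · rw [lap_map_mul, lap_compound, hc.genFun_lap_neg hp (by simp)]

theorem IsSenetaHeyde.genFun_lap {p : PMF ℕ} (hp : IsSupercritical p) {c : ℕ → ℝ}
    (hc : IsSenetaHeyde p c) (l : ℝ) :
    genFun p (lap (limLaw p c) l) = lap (limLaw p c) (meanR p * l) := by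
  rw [← lap_map_mul, hc.map_limLaw hp, lap_compound]

theorem IsSenetaHeyde.gf_charFun {p : PMF ℕ} (hp : IsSupercritical p) {c : ℕ → ℝ}
    (hc : IsSenetaHeyde p c) (t : ℝ) :
    charFun (limLaw p c) (meanR p * t) = gf p (charFun (limLaw p c) t) := by
  rw [← charFun_compound, ← hc.map_limLaw hp, charFun_map_mul]

/-! ### Absolute continuity of the law of `W` -/

theorem norm_gf_le (p : PMF ℕ) {z : ℂ} {s : ℝ} (hz : ‖z‖ ≤ s) (hs : s ≤ 1) : ‖gf p z‖ ≤ gf p s := by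
  have hsum := summable_of_le_one p ((norm_nonneg z).trans hz) hs
  refine tsum_of_norm_bounded (by simpa [gf] using hsum.hasSum) fun n => ?_
  rw [norm_mul, norm_pow, RCLike.norm_ofReal, abs_of_nonneg ENNReal.toReal_nonneg]
  gcongr

theorem IsSupercritical.norm_gfDeriv_le {p : PMF ℕ} (hp : IsSupercritical p) {z : ℂ} {s : ℝ}
    (hz : ‖z‖ ≤ s) (hs : s ≤ 1) : ‖gfDeriv p z‖ ≤ gfDeriv p s := by
  have hs0 := (norm_nonneg z).trans hz
  have hsum : Summable fun n => (p n).toReal * (n * s ^ (n - 1)) :=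
    hp.hasSum_mean.summable.of_nonneg_of_le (fun n => by positivity) fun n => by
      have := pow_le_one₀ (n := n - 1) hs0 hs
      have : (n : ℝ) * s ^ (n - 1) ≤ n * 1 := by gcongr
      rw [mul_one] at this
      gcongr
  refine tsum_of_norm_bounded (by simpa [gfDeriv] using hsum.hasSum) fun n => ?_
  rw [norm_mul, norm_mul, norm_pow, RCLike.norm_ofReal, abs_of_nonneg ENNReal.toReal_nonneg,
    RCLike.norm_natCast]
  gcongr

/-- Equality case of the triangle inequality: after rotation by the conjugate of the mean, a real
part bounded by 1 has mean 1. -/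
theorem ae_exp_eq_of_norm_charFun {ν : Measure ℝ} [IsProbabilityMeasure ν] {s : ℝ}
    (h : ‖charFun ν s‖ = 1) : ∀ᵐ x : ℝ ∂ν, Complex.exp (s * x * Complex.I) = charFun ν s := by
  obtain ⟨z, hz⟩ : ∃ z, z = charFun ν s := ⟨_, rfl⟩
  rw [← hz] at h ⊢
  have hint : Integrable (fun x : ℝ => Complex.exp (s * x * Complex.I)) ν := by
    refine (integrable_const (1 : ℝ)).mono' (by fun_prop) (Eventually.of_forall fun x => ?_)
    rw [← Complex.ofReal_mul, Complex.norm_exp_ofReal_mul_I]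
  have hint2 : Integrable (fun x : ℝ => (starRingEnd ℂ z * Complex.exp (s * x * Complex.I)).re) ν :=
    (hint.const_mul _).re
  have hle : ∀ x : ℝ, (starRingEnd ℂ z * Complex.exp (s * x * Complex.I)).re ≤ 1 := fun x => by
    refine (Complex.re_le_norm _).trans ?_
    rw [norm_mul, RCLike.norm_conj, h, ← Complex.ofReal_mul, Complex.norm_exp_ofReal_mul_I, one_mul]
  have hI : ∫ x : ℝ, (1 - (starRingEnd ℂ z * Complex.exp (s * x * Complex.I)).re) ∂ν = 0 := by
    rw [integral_sub (integrable_const _) hint2]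
    have h3 := integral_re (hint.const_mul (starRingEnd ℂ z))
    have h4 : ∫ x : ℝ, (starRingEnd ℂ z * Complex.exp (s * x * Complex.I)).re ∂ν = 1 := by
      refine h3.trans ?_
      rw [integral_const_mul, ← charFun_apply_real, ← hz, mul_comm, Complex.mul_conj,
        Complex.normSq_eq_norm_sq, h]
      simp
    rw [h4]
    simp
  have h5 := (integral_eq_zero_iff_of_nonneg (fun x => sub_nonneg.2 (hle x))
    ((integrable_const _).sub hint2)).1 hI
  filter_upwards [h5] with x hx
  simp only [Pi.zero_apply] at hx
  have h6 : ‖Complex.exp (s * x * Complex.I)‖ = 1 := by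
    rw [← Complex.ofReal_mul, Complex.norm_exp_ofReal_mul_I]
  generalize Complex.exp (s * x * Complex.I) = e at *
  have h7 : ‖e - z‖ ^ 2 = 0 := by
    have hz2 : z.re * z.re + z.im * z.im = 1 := by
      rw [← Complex.normSq_apply, Complex.normSq_eq_norm_sq, h]; norm_num
    have he2 : e.re * e.re + e.im * e.im = 1 := by
      rw [← Complex.normSq_apply, Complex.normSq_eq_norm_sq, h6]; norm_num
    rw [← Complex.normSq_eq_norm_sq, Complex.normSq_apply]
    simp only [Complex.mul_re, Complex.conj_re, Complex.conj_im, Complex.sub_re,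
      Complex.sub_im] at hx ⊢
    nlinarith
  exact sub_eq_zero.1 (norm_eq_zero.1 (pow_eq_zero_iff (by norm_num) |>.1 h7))

/-- The constant 0 is excluded by 𝔠 < 1. If W = x₀ > 0, then f(exp(-l x₀)) = exp(-μ l x₀), whereas
the left side is at least p(k) exp(-k l x₀) for some k < μ with p(k) > 0. This fails for large l. -/
theorem IsSenetaHeyde.not_ae_eq_const {p : PMF ℕ} (hp : IsSupercritical p) {c : ℕ → ℝ}
    (hc : IsSenetaHeyde p c) (x₀ : ℝ) : ¬ ∀ᵐ x ∂limLaw p c, x = x₀ := by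
  intro h
  have hx0 : 0 < x₀ := by
    have h0 : 0 ≤ x₀ := by
      obtain ⟨x, hx, rfl⟩ := ((ae_limLaw_nonneg p c).and h).exists
      exact hx
    refine lt_of_le_of_ne h0 fun h1 => ?_
    have h2 : limLaw p c {0} = 1 := by
      rw [prob_compl_eq_zero_iff (measurableSet_singleton 0) |>.symm]
      rw [← h1] at h
      exact h
    rw [hc.limLaw_singleton_zero hp, ← ofReal_extR, ENNReal.ofReal_eq_one] at h2
    exact hc.extR_lt_one.ne h2
  have hlap : ∀ l, (lap (limLaw p c) l).toReal = Real.exp (l * x₀) := by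
    intro l
    have : lap (limLaw p c) l = ENNReal.ofReal (Real.exp (l * x₀)) := by
      rw [lap, lintegral_congr_ae (g := fun _ => ENNReal.ofReal (Real.exp (l * x₀)))]
      · simp
      · filter_upwards [h] with x hx
        rw [hx]
    rw [this, ENNReal.toReal_ofReal (Real.exp_pos _).le]
  obtain ⟨k, hk, hpk⟩ := hp.exists_lt_mean
  have hle : ∀ l : ℝ, 0 ≤ l → (p k).toReal ≤ Real.exp (-((meanR p - k) * x₀ * l)) := by
    intro l hl
    have h1 := hc.gf_lap hp hl
    rw [hlap, hlap] at h1
    have hsum := summable_of_le_one p (Real.exp_pos (-l * x₀)).le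
      (Real.exp_le_one_iff.2 (by rw [neg_mul, neg_nonpos]; positivity))
    have h2 : (p k).toReal * Real.exp (-l * x₀) ^ k ≤ gf p (Real.exp (-l * x₀)) := by
      refine (hsum.le_tsum k fun j _ => by positivity).trans_eq (by simp [gf])
    rw [h1, ← Real.exp_nat_mul, ← le_div_iff₀ (Real.exp_pos _), ← Real.exp_sub] at h2
    refine h2.trans_eq ?_
    congr 1
    ring
  have hlim : Tendsto (fun l : ℝ => Real.exp (-((meanR p - k) * x₀ * l))) atTop (𝓝 0) :=
    Real.tendsto_exp_neg_atTop_nhds_zero.comp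
      (tendsto_id.const_mul_atTop (mul_pos (by linarith) hx0))
  have := ge_of_tendsto hlim ((eventually_ge_atTop 0).mono hle)
  linarith [toReal_apply_pos hpk]

/-- Since |φ(μs)| ≤ f(|φ(s)|), modulus 1 at t forces modulus 1 at all t/μ^k. Then W lies almost
surely in x₀ + (2π μ^k/t)ℤ for every k, with the same x₀. The spacing tends to infinity, so W would
be constant. -/
theorem IsSenetaHeyde.norm_charFun_lt_one {p : PMF ℕ} (hp : IsSupercritical p) {c : ℕ → ℝ}
    (hc : IsSenetaHeyde p c) {t : ℝ} (ht : t ≠ 0) : ‖charFun (limLaw p c) t‖ < 1 := by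
  refine lt_of_le_of_ne (norm_charFun_le_one t) fun h => ?_
  have hμ := hp.one_lt_meanR
  have hμ0 := hp.meanR_pos
  have hall : ∀ k : ℕ, ‖charFun (limLaw p c) (t / meanR p ^ k)‖ = 1 := by
    intro k
    induction k with
    | zero => simpa using h
    | succ k ih =>
      refine le_antisymm (norm_charFun_le_one _) ?_
      by_contra! hlt
      have h1 : t / meanR p ^ k = meanR p * (t / meanR p ^ (k + 1)) := by
        rw [pow_succ]; field_simp
      have h2 := norm_gf_le p (le_refl ‖charFun (limLaw p c) (t / meanR p ^ (k + 1))‖) hlt.le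
      rw [← hc.gf_charFun hp, ← h1, ih] at h2
      have h3 := hp.strictMonoOn_gf (a := ‖charFun (limLaw p c) (t / meanR p ^ (k + 1))‖)
        ⟨norm_nonneg _, hlt.le⟩ ⟨zero_le_one, le_rfl⟩ hlt
      rw [gf_one] at h3
      linarith
  have hae := ae_all_iff.2 fun k => ae_exp_eq_of_norm_charFun (hall k)
  obtain ⟨x₀, hx₀⟩ := hae.exists
  refine hc.not_ae_eq_const hp x₀ ?_
  filter_upwards [hae] with x hx
  by_contra hne
  have hd : 0 < |t * (x - x₀)| := abs_pos.2 (mul_ne_zero ht (sub_ne_zero.2 hne))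
  obtain ⟨k, hk⟩ := pow_unbounded_of_one_lt (|t * (x - x₀)|) hμ
  have h1 := (hx k).trans (hx₀ k).symm
  obtain ⟨n, hn⟩ := Complex.exp_eq_exp_iff_exists_int.1 h1
  have h2 : t / meanR p ^ k * (x - x₀) = n * (2 * Real.pi) := by
    have h3 : ((t / meanR p ^ k * (x - x₀) : ℝ) : ℂ) = ((n * (2 * Real.pi) : ℝ) : ℂ) := by
      have := mul_right_cancel₀ Complex.I_ne_zero (b := Complex.I)
        (a := ((t / meanR p ^ k : ℝ) : ℂ) * x) (c := ((t / meanR p ^ k : ℝ) : ℂ) * x₀ + n * (2 * Real.pi))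
        (by rw [hn]; ring)
      push_cast at this ⊢
      linear_combination this
    exact_mod_cast h3
  have h4 : |t * (x - x₀)| = |(n : ℝ)| * (2 * Real.pi) * meanR p ^ k := by
    have : t * (x - x₀) = n * (2 * Real.pi) * meanR p ^ k := by
      rw [← h2]; field_simp
    rw [this, abs_mul, abs_mul, abs_of_pos (pow_pos hμ0 k), abs_of_pos Real.two_pi_pos]
  have hn0 : n ≠ 0 := by
    rintro rfl
    rw [h4] at hd
    simp at hd
  have hn1 : (1 : ℝ) ≤ |(n : ℝ)| := by exact_mod_cast Int.one_le_abs hn0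
  have h5 : (1 : ℝ) ≤ |(n : ℝ)| * (2 * Real.pi) := by
    nlinarith [Real.pi_gt_three]
  have h6 : meanR p ^ k ≤ |(n : ℝ)| * (2 * Real.pi) * meanR p ^ k :=
    le_mul_of_one_le_left (by positivity) h5
  linarith

/-- The set 1 ≤ |t| ≤ μ is a fundamental domain for multiplication by μ. On it |φ| is at most some r
< 1, and on its image under μ^k at most the k-th iterate of f at r, which tends to 𝔠 < s. -/
theorem IsSenetaHeyde.exists_norm_charFun_le {p : PMF ℕ} (hp : IsSupercritical p) {c : ℕ → ℝ}
    (hc : IsSenetaHeyde p c) {s : ℝ} (hs : extR p < s) :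
    ∃ T : ℝ, ∀ t : ℝ, T ≤ |t| → ‖charFun (limLaw p c) t‖ ≤ s := by
  have hμ := hp.one_lt_meanR
  have hμ0 := hp.meanR_pos
  have hcont : Continuous fun t : ℝ => ‖charFun (limLaw p c) t‖ := continuous_charFun.norm
  have hK : IsCompact ({t : ℝ | 1 ≤ |t| ∧ |t| ≤ meanR p}) := by
    refine Metric.isCompact_of_isClosed_isBounded ?_ ?_
    · exact (isClosed_le continuous_const continuous_abs).inter
        (isClosed_le continuous_abs continuous_const)
    · refine (Metric.isBounded_closedBall (x := (0 : ℝ)) (r := meanR p)).subset fun t ht => ?_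
      simpa using ht.2
  obtain ⟨t₀, ht₀, hmax⟩ := hK.exists_isMaxOn ⟨1, by simp; exact hμ.le⟩ hcont.continuousOn
  obtain ⟨r, hr⟩ : ∃ r, r = ‖charFun (limLaw p c) t₀‖ := ⟨_, rfl⟩
  have hr1 : r < 1 := hr ▸ hc.norm_charFun_lt_one hp (by
    rintro rfl
    simp at ht₀
    linarith [ht₀.1])
  have hr0 : 0 ≤ r := hr ▸ norm_nonneg _
  have hiter : ∀ (k : ℕ) (t : ℝ), 1 ≤ |t| → |t| ≤ meanR p →
      ‖charFun (limLaw p c) (meanR p ^ k * t)‖ ≤ (gf p)^[k] r := by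
    intro k
    induction k with
    | zero =>
      intro t h1 h2
      simpa [hr] using hmax (show t ∈ {t : ℝ | 1 ≤ |t| ∧ |t| ≤ meanR p} from ⟨h1, h2⟩)
    | succ k ih =>
      intro t h1 h2
      rw [pow_succ', mul_assoc, hc.gf_charFun hp, Function.iterate_succ_apply']
      exact norm_gf_le p (ih t h1 h2) (iterate_gf_mem_Icc p ⟨hr0, hr1.le⟩ k).2
  obtain ⟨K, hKs⟩ := eventually_atTop.1
    ((hp.tendsto_iterate_gf hc.extR_lt_one hr0 hr1).eventually_lt_const hs)
  refine ⟨meanR p ^ K, fun t ht => ?_⟩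
  obtain ⟨n, hn1, hn2⟩ := exists_nat_pow_near ((one_le_pow₀ hμ.le).trans ht) hμ
  have hKn : K ≤ n := by
    have : meanR p ^ K < meanR p ^ (n + 1) := ht.trans_lt hn2
    have := (pow_lt_pow_iff_right₀ hμ).1 this
    omega
  have hpos : 0 < meanR p ^ n := by positivity
  have h := hiter n (t / meanR p ^ n) (by
    rwa [abs_div, abs_of_pos hpos, one_le_div hpos]) (by
    rw [abs_div, abs_of_pos hpos, div_le_iff₀ hpos, ← pow_succ']
    exact hn2.le)
  rw [mul_div_cancel₀ _ hpos.ne'] at h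
  exact h.trans (hKs n hKn).le

/-! ### The characteristic function of the size-biased law of W. -/

theorem IsSenetaHeyde.integrable_id {p : PMF ℕ} (hp : IsSupercritical p) {c : ℕ → ℝ}
    (hc : IsSenetaHeyde p c) : Integrable (fun x => x) (limLaw p c) := by
  obtain ⟨l, hl, hlap⟩ := hc.exists_lap_lt_top hp
  have h1 : Integrable (fun x : ℝ => Real.exp (l * x)) (limLaw p c) := by
    refine ⟨by fun_prop, ?_⟩
    rw [hasFiniteIntegral_iff_ofReal (Eventually.of_forall fun x => (Real.exp_pos _).le)]
    exact hlap
  refine (h1.const_mul (1 / l)).mono' (by fun_prop) ?_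
  filter_upwards [ae_limLaw_nonneg p c] with x hx
  rw [Real.norm_of_nonneg hx, div_mul_eq_mul_div, one_mul, le_div_iff₀ hl]
  linarith [Real.add_one_le_exp (l * x)]

/-- The measure `x ν(dx)`. -/
def sizeBiased (ν : Measure ℝ) : Measure ℝ := ν.withDensity fun x => ENNReal.ofReal x

theorem IsSenetaHeyde.isFiniteMeasure_sizeBiased {p : PMF ℕ} (hp : IsSupercritical p) {c : ℕ → ℝ}
    (hc : IsSenetaHeyde p c) : IsFiniteMeasure (sizeBiased (limLaw p c)) :=
  isFiniteMeasure_withDensity_ofReal (hc.integrable_id hp).2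

theorem IsSenetaHeyde.hasDerivAt_charFun {p : PMF ℕ} (hp : IsSupercritical p) {c : ℕ → ℝ}
    (hc : IsSenetaHeyde p c) (t : ℝ) : HasDerivAt (charFun (limLaw p c))
      (Complex.I * charFun (sizeBiased (limLaw p c)) t) t := by
  have hint : MemLp id (1 : ℕ) (limLaw p c) := by
    rw [Nat.cast_one]
    exact memLp_one_iff_integrable.2 (hc.integrable_id hp)
  have h1 : Differentiable ℝ (charFun (limLaw p c)) :=
    (contDiff_charFun hint).differentiable (by simp)
  have h2 := iteratedDeriv_charFun (t := t) hint
  rw [iteratedDeriv_one] at h2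
  have h3 : charFun (sizeBiased (limLaw p c)) t
      = ∫ x, (x : ℂ) ^ 1 * Complex.exp (t * x * Complex.I) ∂limLaw p c := by
    rw [charFun_apply_real, sizeBiased, integral_withDensity_eq_integral_toReal_smul (by fun_prop)
      (Eventually.of_forall fun x => by simp)]
    refine integral_congr_ae ?_
    filter_upwards [ae_limLaw_nonneg p c] with x hx
    rw [ENNReal.toReal_ofReal hx, pow_one]
    rfl
  have h4 := (h1 t).hasDerivAt
  rw [h2, pow_one] at h4
  rw [h3]
  exact h4

/-- Up to the factor i, this characteristic function is φ', and differentiating φ(μt) = f(φ(t))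
gives μ φ'(μt) = f'(φ(t)) φ'(t). Size-biasing removes the atom of W at 0, because of which φ itself
need not tend to 0. -/
theorem IsSenetaHeyde.norm_charFun_sizeBiased_le {p : PMF ℕ} (hp : IsSupercritical p) {c : ℕ → ℝ}
    (hc : IsSenetaHeyde p c) {s : ℝ} (hs : s ≤ 1) {t : ℝ} (ht : ‖charFun (limLaw p c) t‖ ≤ s) :
    ‖charFun (sizeBiased (limLaw p c)) (meanR p * t)‖
      ≤ gfDeriv p s / meanR p * ‖charFun (sizeBiased (limLaw p c)) t‖ := by
  obtain ⟨r, hr, hsum⟩ := hp.exists_summable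
  have hμ0 := hp.meanR_pos
  have h1 := ((hc.hasDerivAt_charFun hp (meanR p * t)).scomp t
    ((hasDerivAt_id t).const_mul (meanR p)))
  have h2 : HasDerivAt (gf p ∘ charFun (limLaw p c)) _ t :=
    (hasDerivAt_gf (𝕜 := ℂ) p (by linarith) hsum (by linarith)).comp t
      (hc.hasDerivAt_charFun hp t)
  have h3 : charFun (limLaw p c) ∘ (HMul.hMul (meanR p)) = gf p ∘ charFun (limLaw p c) := by
    funext y
    exact hc.gf_charFun hp y
  rw [h3] at h1
  have h4 := congrArg norm (h1.unique h2)
  rw [mul_one, norm_smul, norm_mul, norm_mul, norm_mul, Complex.norm_I, one_mul, one_mul,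
    Real.norm_of_nonneg hμ0.le] at h4
  rw [div_mul_eq_mul_div, le_div_iff₀ hμ0, mul_comm, h4]
  gcongr
  exact hp.norm_gfDeriv_le ht hs

/-- With I(R) the integral of h over [-R, R], the substitution t ↦ mt gives I(mR) ≤ ρ I(R) + B. As ρ
< 1, I is bounded along R = m^n. -/
theorem integrable_of_contracting {h : ℝ → ℝ} (hcont : Continuous h) (h0 : ∀ t, 0 ≤ h t)
    {m ρ T M : ℝ} (hm : 1 < m) (hρ0 : 0 ≤ ρ) (hρ : ρ < 1) (hM : ∀ t, h t ≤ M)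
    (hh : ∀ t, T ≤ |t| → h (m * t) ≤ ρ / m * h t) : Integrable h := by
  have hm0 : 0 < m := by linarith
  have hM0 : 0 ≤ M := (h0 0).trans (hM 0)
  -- The contraction fails for |t| < T. There the bound M is dominated by a multiple of 1/(1 + t²),
  -- whose integral over [-R, R] is at most π times the factor, uniformly in R.
  have hpt : ∀ t, h (m * t) ≤ ρ / m * h t + M * (1 + T ^ 2) * (1 + t ^ 2)⁻¹ := by
    intro t
    rcases le_or_gt T |t| with ht | ht
    · exact (hh t ht).trans (le_add_of_nonneg_right (by positivity))
    · refine (hM _).trans (le_add_of_nonneg_of_le (mul_nonneg (by positivity) (h0 t)) ?_)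
      rw [← div_eq_mul_inv, le_div_iff₀ (by positivity)]
      have : t ^ 2 ≤ T ^ 2 := by
        rw [← sq_abs t]
        gcongr
      gcongr
  obtain ⟨B, hB⟩ : ∃ B, B = m * (M * (1 + T ^ 2) * Real.pi) := ⟨_, rfl⟩
  have hB0 : 0 ≤ B := by rw [hB]; positivity
  have hstep : ∀ R, 0 ≤ R → ∫ t in -(m * R)..m * R, h t ≤ ρ * (∫ t in -R..R, h t) + B := by
    intro R hR
    have h1 := intervalIntegral.mul_integral_comp_mul_left (a := -R) (b := R) (f := h) m
    rw [mul_neg] at h1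
    rw [← h1]
    have h2 : ∫ t in -R..R, h (m * t)
        ≤ ∫ t in -R..R, (ρ / m * h t + M * (1 + T ^ 2) * (1 + t ^ 2)⁻¹) := by
      refine intervalIntegral.integral_mono_on (by linarith) ?_ ?_ fun t _ => hpt t
      · exact (hcont.comp (continuous_const.mul continuous_id)).intervalIntegrable _ _
      · exact ((hcont.const_mul _).intervalIntegrable _ _).add
          ((integrable_inv_one_add_sq.intervalIntegrable).const_mul _)
    rw [intervalIntegral.integral_add ((hcont.const_mul _).intervalIntegrable _ _)
      ((integrable_inv_one_add_sq.intervalIntegrable).const_mul _),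
      intervalIntegral.integral_const_mul, intervalIntegral.integral_const_mul] at h2
    have h3 : ∫ t in -R..R, (1 + t ^ 2)⁻¹ ≤ Real.pi := by
      rw [integral_inv_one_add_sq]
      linarith [Real.arctan_lt_pi_div_two R, Real.neg_pi_div_two_lt_arctan (-R)]
    calc m * ∫ t in -R..R, h (m * t)
        ≤ m * (ρ / m * (∫ t in -R..R, h t) + M * (1 + T ^ 2) * Real.pi) := by
          gcongr
          exact h2.trans (by gcongr)
      _ = ρ * (∫ t in -R..R, h t) + B := by
          rw [hB]
          field_simp
  -- B/(1 - ρ) is the fixed point of x ↦ ρx + B, so any larger K is preserved by the recursion.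
  obtain ⟨K, hK⟩ : ∃ K, K = max (∫ t in -1..1, h t) (B / (1 - ρ)) := ⟨_, rfl⟩
  have hbound : ∀ n : ℕ, ∫ t in -(m ^ n)..m ^ n, h t ≤ K := by
    intro n
    induction n with
    | zero => simp [hK]
    | succ n ih =>
      rw [pow_succ']
      refine (hstep _ (by positivity)).trans ?_
      have h1 : B ≤ (1 - ρ) * K := by
        rw [← div_le_iff₀' (by linarith), hK]
        exact le_max_right _ _
      nlinarith
  refine integrable_of_intervalIntegral_norm_bounded (l := atTop) (a := fun n : ℕ => -(m ^ n))
    (b := fun n : ℕ => m ^ n) K (fun n => ?_) ?_ (tendsto_pow_atTop_atTop_of_one_lt hm)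
    (Eventually.of_forall fun n => ?_)
  · exact (hcont.integrableOn_Icc).mono_set Set.Ioc_subset_Icc_self
  · exact tendsto_neg_atTop_atBot.comp (tendsto_pow_atTop_atTop_of_one_lt hm)
  · simpa only [Real.norm_of_nonneg (h0 _)] using hbound n

theorem IsSenetaHeyde.integrable_charFun_sizeBiased {p : PMF ℕ} (hp : IsSupercritical p)
    {c : ℕ → ℝ} (hc : IsSenetaHeyde p c) :
    Integrable (charFun (sizeBiased (limLaw p c))) := by
  have := hc.isFiniteMeasure_sizeBiased hp
  obtain ⟨s, hs, hs1, hρ⟩ := hp.exists_gfDeriv_lt_one hc.extR_lt_one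
  obtain ⟨T, hT⟩ := hc.exists_norm_charFun_le hp hs
  have hcont : Continuous (charFun (sizeBiased (limLaw p c))) := continuous_charFun
  rw [← integrable_norm_iff hcont.aestronglyMeasurable]
  exact integrable_of_contracting hcont.norm (fun t => norm_nonneg _) hp.one_lt_meanR
    (gfDeriv_nonneg p ((extR_nonneg p).trans hs.le)) hρ (fun t => norm_charFun_le t)
    fun t ht => hc.norm_charFun_sizeBiased_le hp hs1.le (hT t ht)

/-! ### From an integrable characteristic function to a density. -/

/-- The bump exp(-(x - x₀)²/(2ε²)) is at least exp(-1/2) on the interval. It is also an average of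
characters over a centred Gaussian of variance 1/ε², whose density is at most ε. Fubini then bounds
its N-integral by ε ∫ |charFun N|. -/
theorem measureReal_Icc_le_of_integrable_charFun {N : Measure ℝ} [IsFiniteMeasure N]
    (hN : Integrable (charFun N)) (x₀ : ℝ) {ε : ℝ} (hε : 0 < ε) :
    N.real (Set.Icc (x₀ - ε) (x₀ + ε))
      ≤ Real.exp (1 / 2) * (∫ t, ‖charFun N t‖) * ε := by
  obtain ⟨v, hv⟩ : ∃ v : NNReal, (v : ℝ) = 1 / ε ^ 2 := ⟨⟨1 / ε ^ 2, by positivity⟩, rfl⟩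
  have hv0 : v ≠ 0 := by
    rw [← NNReal.coe_ne_zero, hv]
    positivity
  have hgauss : ∀ x : ℝ, ((Real.exp (-(x - x₀) ^ 2 / (2 * ε ^ 2)) : ℝ) : ℂ)
      = ∫ t : ℝ, Complex.exp (t * (x - x₀) * Complex.I) ∂gaussianReal 0 v := by
    intro x
    have h1 := charFun_gaussianReal (μ := 0) (v := v) (x - x₀)
    rw [charFun_apply_real] at h1
    have h2 : ∫ t : ℝ, Complex.exp (t * (x - x₀) * Complex.I) ∂gaussianReal 0 v
        = ∫ t : ℝ, Complex.exp (((x - x₀ : ℝ) : ℂ) * t * Complex.I) ∂gaussianReal 0 v := by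
      congr 1 with t
      push_cast
      ring_nf
    rw [h2, h1, Complex.ofReal_exp]
    congr 1
    have : ((v : ℝ) : ℂ) = ((1 / ε ^ 2 : ℝ) : ℂ) := by rw [hv]
    rw [this]
    have : (ε : ℂ) ≠ 0 := by exact_mod_cast hε.ne'
    push_cast
    field_simp
    ring
  have hswap : ((∫ x, Real.exp (-(x - x₀) ^ 2 / (2 * ε ^ 2)) ∂N : ℝ) : ℂ)
      = ∫ t : ℝ, Complex.exp (-(t * x₀) * Complex.I) * charFun N t ∂gaussianReal 0 v := by
    rw [← integral_complex_ofReal]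
    simp_rw [hgauss]
    rw [integral_integral_swap]
    · congr 1 with t
      rw [charFun_apply_real, ← integral_const_mul]
      congr 1 with x
      rw [← Complex.exp_add]
      congr 1
      ring
    · refine (integrable_const (1 : ℝ)).mono' (by fun_prop) (Eventually.of_forall fun z => ?_)
      simp only [Function.uncurry]
      rw [← Complex.ofReal_sub, ← Complex.ofReal_mul, Complex.norm_exp_ofReal_mul_I]
  have hpdf : ∀ t, gaussianPDFReal 0 v t ≤ ε := by
    intro t
    rw [gaussianPDFReal_def]
    have h1 : Real.exp (-(t - 0) ^ 2 / (2 * v)) ≤ 1 := by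
      rw [Real.exp_le_one_iff, neg_div, neg_nonpos]
      positivity
    have h2 : (√(2 * Real.pi * v))⁻¹ ≤ ε := by
      rw [inv_le_comm₀ (by positivity) hε, hv]
      refine Real.le_sqrt_of_sq_le ?_
      rw [inv_pow, mul_one_div, ← one_div]
      gcongr
      nlinarith [Real.pi_gt_three]
    calc (√(2 * Real.pi * v))⁻¹ * Real.exp (-(t - 0) ^ 2 / (2 * v)) ≤ ε * 1 := by gcongr
      _ = ε := mul_one _
  have hupper : ∫ x, Real.exp (-(x - x₀) ^ 2 / (2 * ε ^ 2)) ∂N ≤ ε * ∫ t, ‖charFun N t‖ := by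
    refine (le_abs_self _).trans ?_
    rw [← RCLike.norm_ofReal (K := ℂ)]
    refine (congrArg norm hswap).trans_le ?_
    rw [integral_gaussianReal_eq_integral_smul hv0, ← integral_const_mul]
    refine norm_integral_le_of_norm_le (hN.norm.const_mul ε) (Eventually.of_forall fun t => ?_)
    rw [norm_smul, norm_mul, ← Complex.ofReal_mul, ← Complex.ofReal_neg,
      Complex.norm_exp_ofReal_mul_I, one_mul, Real.norm_of_nonneg (gaussianPDFReal_nonneg _ _ _)]
    gcongr
    exact hpdf t
  have hlower : Real.exp (-(1 / 2)) * N.real (Set.Icc (x₀ - ε) (x₀ + ε))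
      ≤ ∫ x, Real.exp (-(x - x₀) ^ 2 / (2 * ε ^ 2)) ∂N := by
    have h1 : ∫ x, (Set.Icc (x₀ - ε) (x₀ + ε)).indicator (fun _ => Real.exp (-(1 / 2))) x ∂N
        = Real.exp (-(1 / 2)) * N.real (Set.Icc (x₀ - ε) (x₀ + ε)) := by
      rw [integral_indicator measurableSet_Icc, setIntegral_const, smul_eq_mul, mul_comm]
    rw [← h1]
    refine integral_mono_of_nonneg (Eventually.of_forall fun x =>
      Set.indicator_nonneg (fun _ _ => (Real.exp_pos _).le) x) ?_ (Eventually.of_forall fun x => ?_)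
    · refine (integrable_const (1 : ℝ)).mono' (by fun_prop) (Eventually.of_forall fun x => ?_)
      rw [Real.norm_of_nonneg (Real.exp_pos _).le, Real.exp_le_one_iff, neg_div, neg_nonpos]
      positivity
    · refine Set.indicator_apply_le' (fun hx => ?_) fun _ => (Real.exp_pos _).le
      rw [Real.exp_le_exp, neg_div, neg_le_neg_iff, div_le_iff₀ (by positivity)]
      have : |x - x₀| ≤ ε := abs_le.2 ⟨by linarith [hx.1], by linarith [hx.2]⟩
      have : (x - x₀) ^ 2 ≤ ε ^ 2 := by
        rw [← sq_abs]
        gcongr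
      linarith
  have h := hlower.trans hupper
  rw [Real.exp_neg, inv_mul_le_iff₀ (Real.exp_pos _)] at h
  linarith

/-- The linear bound on intervals passes to the outer measures, so N is at most a multiple of
Lebesgue measure. -/
theorem absolutelyContinuous_of_integrable_charFun {N : Measure ℝ} [IsFiniteMeasure N]
    (hN : Integrable (charFun N)) : N ≪ volume := by
  obtain ⟨K, hK0, hK⟩ : ∃ K, 0 < K ∧ Real.exp (1 / 2) * (∫ t, ‖charFun N t‖) ≤ K :=
    ⟨_, lt_max_of_lt_right one_pos, le_max_left _ _⟩
  have hIoc : ∀ a b, N (Set.Ioc a b) ≤ ENNReal.ofReal K * ENNReal.ofReal (b - a) := by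
    intro a b
    rcases le_or_gt b a with hab | hab
    · simp [Set.Ioc_eq_empty_of_le hab]
    · have h1 := measureReal_Icc_le_of_integrable_charFun hN ((a + b) / 2) (ε := (b - a) / 2)
        (by linarith)
      rw [show (a + b) / 2 - (b - a) / 2 = a by ring,
        show (a + b) / 2 + (b - a) / 2 = b by ring] at h1
      rw [← ENNReal.ofReal_mul hK0.le, ← ofReal_measureReal]
      refine ENNReal.ofReal_le_ofReal ((measureReal_mono Set.Ioc_subset_Icc_self).trans
        (h1.trans ?_))
      exact mul_le_mul hK (by linarith) (by linarith) hK0.le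
  have hle : N.toOuterMeasure ≤ ENNReal.ofReal K • StieltjesFunction.id.outer := by
    rw [StieltjesFunction.outer, OuterMeasure.smul_ofFunction ENNReal.ofReal_ne_top,
      OuterMeasure.le_ofFunction]
    intro s
    rw [Pi.smul_apply, smul_eq_mul, StieltjesFunction.length_eq,
      ← ENNReal.inv_mul_le_iff (ENNReal.ofReal_pos.2 hK0).ne' ENNReal.ofReal_ne_top]
    refine le_iInf fun a => le_iInf fun b => le_iInf fun hab => ?_
    rw [ENNReal.inv_mul_le_iff (ENNReal.ofReal_pos.2 hK0).ne' ENNReal.ofReal_ne_top]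
    have hbot : ∀ x ∈ s, x ∉ {x : ℝ | IsBot x} := fun x _ => not_isBot x
    exact (measure_mono fun x hx => hab ⟨hx, hbot x hx⟩).trans (hIoc a b)
  intro s hs
  have h1 := hle s
  rw [Real.volume_eq_stieltjes_id, StieltjesFunction.measure_def] at hs
  have h2 : StieltjesFunction.id.outer s = 0 := by
    rw [← hs]; rfl
  rw [smul_apply, h2, smul_zero] at h1
  exact le_antisymm h1 bot_le

theorem IsSenetaHeyde.limLaw_restrict_absolutelyContinuous {p : PMF ℕ} (hp : IsSupercritical p)
    {c : ℕ → ℝ} (hc : IsSenetaHeyde p c) : (limLaw p c).restrict (Set.Ioi 0) ≪ volume := by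
  have := hc.isFiniteMeasure_sizeBiased hp
  intro s hs
  have h1 := absolutelyContinuous_of_integrable_charFun (hc.integrable_charFun_sizeBiased hp) hs
  rw [sizeBiased, withDensity_apply_eq_zero (by fun_prop)] at h1
  have h2 : {x : ℝ | ENNReal.ofReal x ≠ 0} = Set.Ioi 0 := by
    ext x
    simp
  rw [h2] at h1
  rw [Measure.restrict_apply' measurableSet_Ioi, Set.inter_comm]
  exact h1

theorem measurable_dens (p : PMF ℕ) (c : ℕ → ℝ) : Measurable (dens p c) :=
  (measurable_deriv _).ennreal_ofReal

/-- A distribution function is differentiable almost everywhere, with derivative the density of the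
absolutely continuous part. Thus `dens` is a version of the density on (0, ∞). -/
theorem IsSenetaHeyde.limLaw_restrict_eq_withDensity {p : PMF ℕ} (hp : IsSupercritical p)
    {c : ℕ → ℝ} (hc : IsSenetaHeyde p c) : (limLaw p c).restrict (Set.Ioi 0)
      = (volume.restrict (Set.Ioi 0)).withDensity (dens p c) := by
  rw [← Measure.withDensity_rnDeriv_eq _ _ (hc.limLaw_restrict_absolutelyContinuous hp),
    ← withDensity_indicator measurableSet_Ioi]
  refine withDensity_congr_ae ((Measure.rnDeriv_restrict _ _ measurableSet_Ioi).trans ?_)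
  have h1 := StieltjesFunction.ae_hasDerivAt (cdf (limLaw p c))
  rw [measure_cdf] at h1
  filter_upwards [h1, Measure.rnDeriv_ne_top (limLaw p c) volume] with x hx hx'
  have h2 : dens p c x = (limLaw p c).rnDeriv volume x := by
    have h3 : (fun y => ((tauLaw p : Measure PlaneTree) {t | limW c t ≤ y}).toReal)
        = cdf (limLaw p c) := by
      funext y
      rw [cdf_eq_real, limLaw, Measure.real, Measure.map_apply (measurable_limW c) measurableSet_Iic]
      rfl
    rw [dens, h3, hx.deriv, ENNReal.ofReal_toReal hx']
  by_cases hmem : x ∈ Set.Ioi (0 : ℝ)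
  · rw [Set.indicator_of_mem hmem, Set.indicator_of_mem hmem, h2]
  · rw [Set.indicator_of_notMem hmem, Set.indicator_of_notMem hmem]

/-! ### Laplace transforms of the density and of its convolution powers. -/

/-- The Laplace transform of the density `w` on `(0, ∞)`. -/
def densLap (p : PMF ℕ) (c : ℕ → ℝ) (l : ℝ) : ℝ≥0∞ :=
  ∫⁻ x in Set.Ioi 0, ENNReal.ofReal (Real.exp (l * x)) * dens p c x

theorem IsSenetaHeyde.lap_limLaw_eq_add {p : PMF ℕ} (hp : IsSupercritical p) {c : ℕ → ℝ}
    (hc : IsSenetaHeyde p c) (l : ℝ) : lap (limLaw p c) l = extProb p + densLap p c l := by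
  rw [lap, ← lintegral_add_compl _ (measurableSet_Iic (a := (0 : ℝ))), Set.compl_Iic,
    hc.limLaw_restrict_eq_withDensity hp,
    lintegral_withDensity_eq_lintegral_mul _ (measurable_dens p c) (measurable_exp_mul l)]
  congr 1
  · have h1 : (Set.Iic 0 : Set ℝ) =ᵐ[limLaw p c] ({0} : Set ℝ) := by
      filter_upwards [ae_limLaw_nonneg p c] with x hx
      exact propext ⟨fun h => le_antisymm h hx, fun h => le_of_eq h⟩
    rw [setLIntegral_congr h1, lintegral_singleton, hc.limLaw_singleton_zero hp]
    simp
  · rw [densLap]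
    congr 1 with x
    rw [Pi.mul_apply, mul_comm]

/-- The convolution powers, extended by zero to the negative half line. -/
def densConvExt (p : PMF ℕ) (c : ℕ → ℝ) (i : ℕ) : ℝ → ℝ≥0∞ :=
  (Set.Ioi 0).indicator (densConv p c i)

theorem densConv_add_two (p : PMF ℕ) (c : ℕ → ℝ) (i : ℕ) (x : ℝ) :
    densConv p c (i + 2) x = ∫⁻ y, densConvExt p c (i + 1) (x - y) * densConvExt p c 1 y := by
  rw [densConv, ← lintegral_indicator measurableSet_Ioo]
  congr 1 with y
  simp only [densConvExt, Set.indicator_apply, Set.mem_Ioo, Set.mem_Ioi, sub_pos, densConv]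
  by_cases h1 : 0 < y <;> by_cases h2 : y < x <;> simp [h1, h2]

theorem densConvExt_add_two (p : PMF ℕ) (c : ℕ → ℝ) (i : ℕ) (x : ℝ) :
    densConvExt p c (i + 2) x
      = ∫⁻ y, densConvExt p c (i + 1) (x - y) * densConvExt p c 1 y := by
  rw [← densConv_add_two, densConvExt, Set.indicator_apply]
  split_ifs with h
  · rfl
  · rw [densConv, Set.Ioo_eq_empty h]
    simp

theorem measurable_densConv (p : PMF ℕ) (c : ℕ → ℝ) : ∀ i, Measurable (densConv p c i)
  | 0 => measurable_const
  | 1 => measurable_dens p c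
  | i + 2 => by
    have h1 := (measurable_densConv p c (i + 1)).indicator (measurableSet_Ioi (a := (0 : ℝ)))
    have h2 := (measurable_densConv p c 1).indicator (measurableSet_Ioi (a := (0 : ℝ)))
    have h3 : densConv p c (i + 2)
        = fun x => ∫⁻ y, densConvExt p c (i + 1) (x - y) * densConvExt p c 1 y :=
      funext (densConv_add_two p c i)
    rw [h3]
    exact Measurable.lintegral_prod_right'
      (f := fun z : ℝ × ℝ => densConvExt p c (i + 1) (z.1 - z.2) * densConvExt p c 1 z.2)
      ((h1.comp (measurable_fst.sub measurable_snd)).mul (h2.comp measurable_snd))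

theorem measurable_densConvExt (p : PMF ℕ) (c : ℕ → ℝ) (i : ℕ) :
    Measurable (densConvExt p c i) :=
  (measurable_densConv p c i).indicator measurableSet_Ioi

theorem lintegral_exp_mul_densConvExt (p : PMF ℕ) (c : ℕ → ℝ) (l : ℝ) (i : ℕ) :
    ∫⁻ x, ENNReal.ofReal (Real.exp (l * x)) * densConvExt p c (i + 1) x
      = densLap p c l ^ (i + 1) := by
  have h1 : ∫⁻ x, ENNReal.ofReal (Real.exp (l * x)) * densConvExt p c 1 x = densLap p c l := by
    rw [densLap, ← lintegral_indicator measurableSet_Ioi]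
    congr 1 with x
    rw [densConvExt, Set.indicator_mul_right]
    rfl
  induction i with
  | zero => simpa using h1
  | succ i ih =>
    have h2 : ∀ x, ENNReal.ofReal (Real.exp (l * x)) * densConvExt p c (i + 2) x
        = ∫⁻ y, (ENNReal.ofReal (Real.exp (l * (x - y))) * densConvExt p c (i + 1) (x - y))
          * (ENNReal.ofReal (Real.exp (l * y)) * densConvExt p c 1 y) := by
      intro x
      rw [densConvExt_add_two, ← lintegral_const_mul' _ _ ENNReal.ofReal_ne_top]
      congr 1 with y
      rw [show l * x = l * (x - y) + l * y by ring, Real.exp_add,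
        ENNReal.ofReal_mul (Real.exp_pos _).le]
      ring
    have hm : ∀ j, Measurable fun x =>
        ENNReal.ofReal (Real.exp (l * x)) * densConvExt p c j x := fun j =>
      (measurable_exp_mul l).mul (measurable_densConvExt p c j)
    simp_rw [h2]
    rw [lintegral_lintegral_swap]
    · have h3 : ∀ y, ∫⁻ x, (ENNReal.ofReal (Real.exp (l * (x - y)))
            * densConvExt p c (i + 1) (x - y))
          * (ENNReal.ofReal (Real.exp (l * y)) * densConvExt p c 1 y)
          = densLap p c l ^ (i + 1)
            * (ENNReal.ofReal (Real.exp (l * y)) * densConvExt p c 1 y) := by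
        intro y
        have h4 : Measurable fun x => ENNReal.ofReal (Real.exp (l * (x - y)))
            * densConvExt p c (i + 1) (x - y) := (hm (i + 1)).comp (measurable_id.sub_const y)
        rw [lintegral_mul_const _ h4,
          lintegral_sub_right_eq_self
            (fun x => ENNReal.ofReal (Real.exp (l * x)) * densConvExt p c (i + 1) x) y, ih]
      simp_rw [h3]
      rw [lintegral_const_mul _ (hm 1), h1, ← pow_succ]
    · exact (((hm (i + 1)).comp (measurable_fst.sub measurable_snd)).mul
        ((hm 1).comp measurable_snd)).aemeasurable

/-- Used with a = μ^j, so that x ↦ a w^{*r}(a x) accounts for r vertices of type s in generation j,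
each carrying an independent copy of μ^{-j} W restricted to W > 0. -/
theorem lintegral_exp_mul_densConv (p : PMF ℕ) (c : ℕ → ℝ) (l : ℝ) {r : ℕ} (hr : r ≠ 0) {a : ℝ}
    (ha : 0 < a) :
    ∫⁻ x in Set.Ioi 0, ENNReal.ofReal (Real.exp (l * x)) *
      (ENNReal.ofReal a * densConv p c r (a * x)) = densLap p c (l / a) ^ r := by
  obtain ⟨i, rfl⟩ := Nat.exists_eq_succ_of_ne_zero hr
  rw [Nat.succ_eq_add_one, ← lintegral_exp_mul_densConvExt, ← lintegral_indicator measurableSet_Ioi]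
  have h1 : Measurable fun x => ENNReal.ofReal (Real.exp (l / a * x)) * densConvExt p c (i + 1) x :=
    (measurable_exp_mul (l / a)).mul (measurable_densConvExt p c (i + 1))
  have h2 := congrArg (fun m : Measure ℝ => ∫⁻ x, ENNReal.ofReal (Real.exp (l / a * x))
    * densConvExt p c (i + 1) x ∂m) (Real.smul_map_volume_mul_left ha.ne')
  rw [lintegral_smul_measure, lintegral_map h1 (measurable_const_mul a), abs_of_pos ha,
    smul_eq_mul, ← lintegral_const_mul' _ _ ENNReal.ofReal_ne_top] at h2
  rw [← h2]
  congr 1 with x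
  rw [← mul_assoc (l / a), div_mul_cancel₀ _ ha.ne']
  by_cases hx : 0 < x
  · rw [Set.indicator_of_mem (Set.mem_Ioi.2 hx), densConvExt,
      Set.indicator_of_mem (Set.mem_Ioi.2 (mul_pos ha hx))]
    ring
  · have hx' : x ∉ Set.Ioi (0 : ℝ) := hx
    have hax : a * x ∉ Set.Ioi (0 : ℝ) := fun h => hx (pos_of_mul_pos_right h ha.le)
    rw [Set.indicator_of_notMem hx', densConvExt, Set.indicator_of_notMem hax, mul_zero, mul_zero]

/-! ### Densities of the generations of the two-type tree. -/

instance : Countable TypedGen :=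
  Function.Injective.countable (f := fun g : TypedGen => (g.all, g.surv)) fun g g' h => by
    ext1
    · exact (Prod.ext_iff.1 h).1
    · exact (Prod.ext_iff.1 h).2

instance : DiscreteMeasurableSpace TypedGen := ⟨fun _ => trivial⟩

/-- The typed generations that contain vertices of type `s`. -/
def Admissible (g : TypedGen) : Prop := g.surv ⊆ g.all ∧ g.surv.Nonempty

theorem IsNextGen.admissible {g g' : TypedGen} (h : IsNextGen g g') (hg : Admissible g) :
    Admissible g' := by
  classical
  obtain ⟨u, hu⟩ := hg.2
  have h1 := (h.2.2 u (hg.1 hu)).2 hu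
  obtain ⟨v, hv⟩ := Finset.card_pos.1 h1
  exact ⟨h.2.1, v, (Finset.mem_filter.1 hv).1⟩

theorem stepWeight_eq_zero (γ : List ℕ → ℕ → ℝ≥0∞) {g g' : TypedGen} (hg : Admissible g)
    (hg' : ¬ Admissible g') : stepWeight γ g g' = 0 :=
  if_neg fun h => hg' (h.admissible hg)

open Classical in
theorem colorProd_const (a b : ℝ≥0∞) {g : TypedGen} (hg : g.surv ⊆ g.all) :
    colorProd (fun _ => a) (fun _ => b) g = a ^ (g.all \ g.surv).card * b ^ g.surv.card := by
  rw [colorProd, Finset.prod_ite, Finset.prod_const, Finset.prod_const, Finset.filter_notMem_eq_sdiff,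
    Finset.filter_mem_eq_inter, Finset.inter_eq_right.2 hg, mul_comm]

/-- The sum of the weights of the transitions from a generation. -/
def genStep (γ : List ℕ → ℕ → ℝ≥0∞) (φ : TypedGen → ℝ≥0∞) (g : TypedGen) : ℝ≥0∞ :=
  ∑' g', stepWeight γ g g' * φ g'

theorem genStep_congr (γ : List ℕ → ℕ → ℝ≥0∞) {φ φ' : TypedGen → ℝ≥0∞}
    (h : ∀ g, Admissible g → φ g = φ' g) {g : TypedGen} (hg : Admissible g) :
    genStep γ φ g = genStep γ φ' g := by
  refine tsum_congr fun g' => ?_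
  by_cases hg' : Admissible g'
  · rw [h g' hg']
  · rw [stepWeight_eq_zero γ hg hg', zero_mul, zero_mul]

theorem genStep_iterate_congr (γ : List ℕ → ℕ → ℝ≥0∞) (n : ℕ) {φ φ' : TypedGen → ℝ≥0∞}
    (h : ∀ g, Admissible g → φ g = φ' g) {g : TypedGen} (hg : Admissible g) :
    (genStep γ)^[n] φ g = (genStep γ)^[n] φ' g := by
  induction n generalizing φ φ' with
  | zero => exact h g hg
  | succ n ih => exact ih fun g hg => genStep_congr γ h hg

theorem measurable_genStep (γ : List ℕ → ℕ → ℝ≥0∞) {φ : TypedGen → ℝ → ℝ≥0∞}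
    (hφ : ∀ g, Measurable (φ g)) (g : TypedGen) :
    Measurable fun θ => genStep γ (fun g' => φ g' θ) g :=
  Measurable.tsum fun g' => (hφ g').const_mul _

theorem lintegral_genStep (γ : List ℕ → ℕ → ℝ≥0∞) {ν : Measure ℝ} {e : ℝ → ℝ≥0∞} (he : Measurable e)
    {φ : TypedGen → ℝ → ℝ≥0∞} (hφ : ∀ g, Measurable (φ g)) (g : TypedGen) :
    ∫⁻ θ, e θ * genStep γ (fun g' => φ g' θ) g ∂ν
      = genStep γ (fun g' => ∫⁻ θ, e θ * φ g' θ ∂ν) g := by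
  simp_rw [genStep, ← ENNReal.tsum_mul_left]
  have hm : ∀ g', AEMeasurable (fun θ => e θ * (stepWeight γ g g' * φ g' θ)) ν := fun g' =>
    (he.mul ((hφ g').const_mul _)).aemeasurable
  rw [lintegral_tsum hm]
  refine tsum_congr fun g' => ?_
  have hm' : Measurable fun θ => e θ * φ g' θ := he.mul (hφ g')
  rw [← lintegral_const_mul _ hm']
  congr 1 with θ
  ring

theorem lintegral_genStep_iterate (γ : List ℕ → ℕ → ℝ≥0∞) {ν : Measure ℝ} {e : ℝ → ℝ≥0∞}
    (he : Measurable e) (n : ℕ) {φ : TypedGen → ℝ → ℝ≥0∞} (hφ : ∀ g, Measurable (φ g))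
    (g : TypedGen) :
    ∫⁻ θ, e θ * (genStep γ)^[n] (fun g' => φ g' θ) g ∂ν
      = (genStep γ)^[n] (fun g' => ∫⁻ θ, e θ * φ g' θ ∂ν) g := by
  induction n generalizing φ with
  | zero => rfl
  | succ n ih =>
    simp only [Function.iterate_succ_apply]
    refine (ih (φ := fun g θ => genStep γ (fun g' => φ g' θ) g)
      fun g => measurable_genStep γ hφ g).trans ?_
    exact congrArg (fun f => (genStep γ)^[n] f g) (funext fun g' => lintegral_genStep γ he hφ g')

/-- Product weights remain product weights. The new weight of type s is known only through its sum
with the weight of type e, and that sum is all that is needed later. -/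
theorem genStep_iterate_colorProd (γ : List ℕ → ℕ → ℝ≥0∞) (n : ℕ) (a b : List ℕ → ℝ≥0∞) :
    ∃ b', (genStep γ)^[n] (colorProd a b) = colorProd ((branch γ)^[n] a) b' ∧
      (branch γ)^[n] a + b' = (branch γ)^[n] (a + b) := by
  induction n generalizing a b with
  | zero => exact ⟨b, rfl, rfl⟩
  | succ n ih =>
    obtain ⟨b', h1, h2⟩ := ih (branch γ a) (survBranch γ a b)
    refine ⟨b', ?_, ?_⟩
    · rw [Function.iterate_succ_apply, Function.iterate_succ_apply, ← h1]
      congr 1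
      exact funext (tsum_stepWeight_mul_colorProd γ a b)
    · rw [Function.iterate_succ_apply, Function.iterate_succ_apply, h2]
      congr 1
      exact funext (branch_add_survBranch γ a b)

theorem branch_const (p : PMF ℕ) (a : ℝ≥0∞) (u : List ℕ) :
    branch (fun _ k => p k) (fun _ => a) u = genFun p a := by
  simp [branch, genFun]

theorem IsSenetaHeyde.genFun_extProb_add_densLap {p : PMF ℕ} (hp : IsSupercritical p) {c : ℕ → ℝ}
    (hc : IsSenetaHeyde p c) (l : ℝ) : genFun p (extProb p + densLap p c l)
      = extProb p + densLap p c (meanR p * l) := by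
  rw [← hc.lap_limLaw_eq_add hp, ← hc.lap_limLaw_eq_add hp, hc.genFun_lap hp]

/-- Subtract f(𝔠) = 𝔠 from f(𝔠 + φ(l)) = 𝔠 + φ(μl): what remains is the total weight of offspring
with at least one child of type s. -/
theorem IsSenetaHeyde.genStep_colorProd {p : PMF ℕ} (hp : IsSupercritical p) {c : ℕ → ℝ}
    (hc : IsSenetaHeyde p c) (l : ℝ) (g : TypedGen) :
    genStep (fun _ k => p k) (colorProd (fun _ => extProb p) fun _ => densLap p c l) g
      = colorProd (fun _ => extProb p) (fun _ => densLap p c (meanR p * l)) g := by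
  have h1 : extProb p ≠ ∞ := ((extProb_le_one p).trans_lt (by simp)).ne
  have ha : branch (fun _ k => p k) (fun _ => extProb p) = fun _ => extProb p :=
    funext fun u => (branch_const p _ u).trans hp.genFun_extProb
  refine (tsum_stepWeight_mul_colorProd _ _ _ g).trans ?_
  rw [ha]
  congr 1
  funext u
  have h2 := branch_add_survBranch (fun _ k => p k) (fun _ => extProb p) (fun _ => densLap p c l) u
  rw [ha] at h2
  have h3 : branch (fun _ k => p k) ((fun _ => extProb p) + fun _ => densLap p c l) u
      = extProb p + densLap p c (meanR p * l) :=
    (branch_const p _ u).trans (hc.genFun_extProb_add_densLap hp l)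
  rw [h3] at h2
  exact (ENNReal.add_right_inj h1).1 h2

open Classical in
/-- The density at `θ` of the event that generation `j` of the two-type tree is `g`, relative to
the weight of its first generations. -/
def genDens (p : PMF ℕ) (c : ℕ → ℝ) (j : ℕ) (g : TypedGen) (θ : ℝ) : ℝ≥0∞ :=
  extProb p ^ (g.all \ g.surv).card *
    (ENNReal.ofReal (meanR p ^ j) * densConv p c g.surv.card (meanR p ^ j * θ))

theorem measurable_genDens (p : PMF ℕ) (c : ℕ → ℝ) (j : ℕ) (g : TypedGen) :
    Measurable (genDens p c j g) :=
  (((measurable_densConv p c _).comp (measurable_const_mul _)).const_mul _).const_mul _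

theorem lintegral_exp_mul_genDens {p : PMF ℕ} (hp : IsSupercritical p) (c : ℕ → ℝ) (l : ℝ) (j : ℕ)
    {g : TypedGen} (hg : Admissible g) :
    ∫⁻ θ in Set.Ioi 0, ENNReal.ofReal (Real.exp (l * θ)) * genDens p c j g θ
      = colorProd (fun _ => extProb p) (fun _ => densLap p c (l / meanR p ^ j)) g := by
  classical
  rw [colorProd_const _ _ hg.1, ← lintegral_exp_mul_densConv p c l (Finset.card_pos.2 hg.2).ne'
    (pow_pos hp.meanR_pos j), ← lintegral_const_mul']
  · congr 1 with θ
    rw [genDens]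
    simp only [mul_left_comm]
  · exact ENNReal.pow_ne_top ((extProb_le_one p).trans_lt (by simp)).ne

theorem IsSenetaHeyde.densLap_le_one {p : PMF ℕ} (hp : IsSupercritical p) {c : ℕ → ℝ}
    (hc : IsSenetaHeyde p c) {l : ℝ} (hl : l ≤ 0) : densLap p c l ≤ 1 :=
  le_add_self.trans ((hc.lap_limLaw_eq_add hp l).symm.trans_le (lap_neg_le_one p c hl))

theorem IsSenetaHeyde.lintegral_genDens_le_one {p : PMF ℕ} (hp : IsSupercritical p) {c : ℕ → ℝ}
    (hc : IsSenetaHeyde p c) (j : ℕ) {g : TypedGen} (hg : Admissible g) :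
    ∫⁻ θ in Set.Ioi 0, genDens p c j g θ ≤ 1 := by
  have h := lintegral_exp_mul_genDens hp c 0 j hg
  simp only [zero_mul, Real.exp_zero, ENNReal.ofReal_one, one_mul, zero_div] at h
  rw [h, colorProd_const _ _ hg.1]
  exact mul_le_one' (pow_le_one' (extProb_le_one p) _) (pow_le_one' (hc.densLap_le_one hp le_rfl) _)

/-- Both sides are integrable on (0, ∞) with the same Laplace transform, by
`IsSenetaHeyde.genStep_colorProd`. Equality is obtained only for almost every θ, whence the notion
of regular θ. -/
theorem IsSenetaHeyde.ae_genStep_genDens {p : PMF ℕ} (hp : IsSupercritical p) {c : ℕ → ℝ}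
    (hc : IsSenetaHeyde p c) (j : ℕ) {g : TypedGen} (hg : Admissible g) :
    ∀ᵐ θ ∂volume.restrict (Set.Ioi (0 : ℝ)),
      genStep (fun _ k => p k) (fun g' => genDens p c (j + 1) g' θ) g = genDens p c j g θ := by
  have hm := measurable_genStep (fun _ k => p k) (measurable_genDens p c (j + 1)) g
  have hlap : ∀ l : ℝ, ∫⁻ θ in Set.Ioi 0, ENNReal.ofReal (Real.exp (l * θ)) *
      genStep (fun _ k => p k) (fun g' => genDens p c (j + 1) g' θ) g
      = ∫⁻ θ in Set.Ioi 0, ENNReal.ofReal (Real.exp (l * θ)) * genDens p c j g θ := by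
    intro l
    rw [lintegral_genStep _ (measurable_exp_mul l) (measurable_genDens p c (j + 1)),
      lintegral_exp_mul_genDens hp c l j hg,
      genStep_congr _ (fun g' hg' => lintegral_exp_mul_genDens hp c l (j + 1) hg') hg,
      hc.genStep_colorProd hp]
    congr! 3
    have := hp.meanR_pos.ne'
    rw [pow_succ]
    field_simp
  have hlt := (hc.lintegral_genDens_le_one hp j hg).trans_lt ENNReal.one_lt_top
  have h0 := hlap 0
  simp only [zero_mul, Real.exp_zero, ENNReal.ofReal_one, one_mul] at h0
  refine (withDensity_eq_iff hm.aemeasurable (measurable_genDens p c j g).aemeasurable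
    (h0.trans_lt hlt).ne).1 ?_
  have : IsFiniteMeasure ((volume.restrict (Set.Ioi (0 : ℝ))).withDensity fun θ =>
      genStep (fun _ k => p k) (fun g' => genDens p c (j + 1) g' θ) g) :=
    isFiniteMeasure_withDensity (h0.trans_lt hlt).ne
  have : IsFiniteMeasure ((volume.restrict (Set.Ioi (0 : ℝ))).withDensity (genDens p c j g)) :=
    isFiniteMeasure_withDensity hlt.ne
  have hae : ∀ᵐ θ ∂volume.restrict (Set.Ioi (0 : ℝ)), 0 ≤ θ :=
    (ae_restrict_mem measurableSet_Ioi).mono fun θ hθ => le_of_lt hθ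
  refine ext_of_lap (withDensity_absolutelyContinuous _ _ hae)
    (withDensity_absolutelyContinuous _ _ hae) fun k => ?_
  rw [lap, lap, lintegral_withDensity_eq_lintegral_mul _ hm (measurable_exp_mul _),
    lintegral_withDensity_eq_lintegral_mul _ (measurable_genDens p c j g) (measurable_exp_mul _)]
  have := hlap (-k)
  simp only [Pi.mul_apply, mul_comm (genDens _ _ _ _ _), mul_comm (genStep _ _ _)]
  exact this

/-- The values of `θ` at which the densities of consecutive generations are finite and
consistent. -/
def IsRegular (p : PMF ℕ) (c : ℕ → ℝ) (θ : ℝ) : Prop :=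
  ∀ j g, Admissible g →
    genStep (fun _ k => p k) (fun g' => genDens p c (j + 1) g' θ) g = genDens p c j g θ ∧
      genDens p c j g θ ≠ ∞

theorem IsSenetaHeyde.ae_isRegular {p : PMF ℕ} (hp : IsSupercritical p) {c : ℕ → ℝ}
    (hc : IsSenetaHeyde p c) : ∀ᵐ θ ∂volume.restrict (Set.Ioi (0 : ℝ)), IsRegular p c θ := by
  refine ae_all_iff.2 fun j => ae_all_iff.2 fun g => ?_
  by_cases hg : Admissible g
  · filter_upwards [hc.ae_genStep_genDens hp j hg, ae_lt_top (measurable_genDens p c j g)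
      ((hc.lintegral_genDens_le_one hp j hg).trans_lt ENNReal.one_lt_top).ne] with θ h1 h2 _
    exact ⟨h1, h2.ne⟩
  · exact Eventually.of_forall fun θ h => absurd h hg

/-! ### The transition probabilities of the extremal two-type tree -/

open Classical in
theorem card_eq_sum_numChildren {V A : Finset (List ℕ)} (h : ∀ v ∈ V, ∃ u ∈ A, ∃ i, v = i :: u) :
    V.card = ∑ u ∈ A, numChildren u V := by
  rw [Finset.card_eq_sum_card_fiberwise (f := List.tail) (t := A)]
  · refine Finset.sum_congr rfl fun u _ => ?_
    rw [numChildren]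
    congr 1
    refine Finset.filter_congr fun v hv => ?_
    obtain ⟨w, -, i, rfl⟩ := h v hv
    simp [eq_comm]
  · intro v hv
    obtain ⟨u, hu, i, rfl⟩ := h v hv
    exact hu

theorem numChildren_mono (u : List ℕ) {V V' : Finset (List ℕ)} (h : V ⊆ V') :
    numChildren u V ≤ numChildren u V' := by
  classical
  exact Finset.card_le_card (Finset.filter_subset_filter _ h)

open Classical in
theorem IsNextGen.card_surv {g g' : TypedGen} (h : IsNextGen g g') (hg : g.surv ⊆ g.all) :
    g'.surv.card = ∑ u ∈ g.surv, numChildren u g'.surv := by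
  rw [card_eq_sum_numChildren (A := g.all), ← Finset.sum_subset hg]
  · intro u hu hu'
    have := mt (h.2.2 u hu).1 hu'
    omega
  · intro v hv
    obtain ⟨u, hu, i, -, hi⟩ := (h.1 v).1 (h.2.1 hv)
    exact ⟨u, hu, i, hi⟩

open Classical in
theorem IsNextGen.card_sdiff {g g' : TypedGen} (h : IsNextGen g g') (hg : g.surv ⊆ g.all) :
    (g'.all \ g'.surv).card = ∑ u ∈ g.all \ g.surv, numChildren u g'.all
      + ∑ u ∈ g.surv, (numChildren u g'.all - numChildren u g'.surv) := by
  have h1 : g'.all.card = ∑ u ∈ g.all, numChildren u g'.all := by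
    refine card_eq_sum_numChildren fun v hv => ?_
    obtain ⟨u, hu, i, -, hi⟩ := (h.1 v).1 hv
    exact ⟨u, hu, i, hi⟩
  rw [Finset.card_sdiff_of_subset h.2.1, h1, h.card_surv hg, ← Finset.sum_sdiff hg,
    Finset.sum_tsub_distrib _ fun u _ => numChildren_mono u h.2.1]
  have := Finset.sum_le_sum fun u (_ : u ∈ g.surv) => numChildren_mono u h.2.1
  omega

theorem extProb_ne_top (p : PMF ℕ) : extProb p ≠ ∞ :=
  ((extProb_le_one p).trans_lt ENNReal.one_lt_top).ne

theorem genFunDeriv_extProb_ne_top {p : PMF ℕ} (h : extR p < 1) (s : ℕ) :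
    genFunDeriv p s (extProb p) ≠ ∞ := by
  obtain ⟨y, hy, hy1⟩ := exists_between (max_lt h (zero_lt_one (α := ℝ)))
  have hy0 : 0 < y := (le_max_right _ _).trans_lt hy
  have hsum : Summable fun n : ℕ => (n : ℝ) ^ s * y ^ n :=
    summable_pow_mul_geometric_of_norm_lt_one s (by rwa [Real.norm_of_nonneg hy0.le])
  refine ne_top_of_le_ne_top (hsum.mul_left ((y ^ s)⁻¹)).tsum_ofReal_ne_top
    (ENNReal.tsum_le_tsum fun n => ?_)
  rcases lt_or_ge n s with hn | hn
  · simp [Nat.descFactorial_of_lt hn]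
  · have h1 : extProb p ≤ ENNReal.ofReal y := by
      rw [← ofReal_extR]
      exact ENNReal.ofReal_le_ofReal ((le_max_left _ _).trans hy.le)
    have h2 : (y ^ s)⁻¹ * ((n : ℝ) ^ s * y ^ n) = (n : ℝ) ^ s * y ^ (n - s) := by
      have : y ^ n = y ^ (n - s) * y ^ s := by rw [← pow_add, Nat.sub_add_cancel hn]
      rw [this]
      field_simp
    rw [h2, ENNReal.ofReal_mul (by positivity), ENNReal.ofReal_pow hy0.le]
    have h3 : ((n.descFactorial s : ℕ) : ℝ≥0∞) ≤ ENNReal.ofReal ((n : ℝ) ^ s) := by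
      rw [← Nat.cast_pow, ENNReal.ofReal_natCast]
      exact_mod_cast Nat.descFactorial_le_pow n s
    calc p n * (n.descFactorial s : ℝ≥0∞) * extProb p ^ (n - s)
        ≤ 1 * ENNReal.ofReal ((n : ℝ) ^ s) * ENNReal.ofReal y ^ (n - s) := by
          gcongr
          exact p.coe_le_one n
      _ = _ := by rw [one_mul]

/-- The factor f^{(s)}(𝔠)/s! of ρ, the uniform choice of positions and the normalisation of 𝔭_{[s]}
cancel out. This persists when f^{(s)}(𝔠) = 0, because then 𝔠^{k-s} p(k) = 0. -/
theorem mul_biased {p : PMF ℕ} (h : extR p < 1) {s k : ℕ} (hsk : s ≤ k) :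
    genFunDeriv p s (extProb p) / (s.factorial : ℝ≥0∞) *
      ((k.choose s : ℝ≥0∞)⁻¹ * biased p s k) = extProb p ^ (k - s) * p k := by
  rw [biased, if_pos hsk]
  have hC : (k.choose s : ℝ≥0∞) ≠ 0 := by exact_mod_cast (Nat.choose_pos hsk).ne'
  have hC' : (k.choose s : ℝ≥0∞) ≠ ∞ := ENNReal.natCast_ne_top _
  have hs : (s.factorial : ℝ≥0∞) ≠ 0 := by exact_mod_cast s.factorial_ne_zero
  have hs' : (s.factorial : ℝ≥0∞) ≠ ∞ := ENNReal.natCast_ne_top _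
  by_cases hD : genFunDeriv p s (extProb p) = 0
  · rw [hD, ENNReal.zero_div, zero_mul]
    have h1 := ENNReal.tsum_eq_zero.1 hD k
    have h2 : ((k.descFactorial s : ℕ) : ℝ≥0∞) ≠ 0 := by
      simp [Nat.descFactorial_eq_zero_iff_lt, hsk]
    rcases mul_eq_zero.1 h1 with h3 | h3
    · rw [(mul_eq_zero.1 h3).resolve_right h2, mul_zero]
    · rw [h3, zero_mul]
  · have hD' := genFunDeriv_extProb_ne_top h s
    generalize genFunDeriv p s (extProb p) = D at *
    generalize (s.factorial : ℝ≥0∞) = a at *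
    generalize (k.choose s : ℝ≥0∞) = b at *
    rw [div_eq_mul_inv, div_eq_mul_inv]
    calc D * a⁻¹ * (b⁻¹ * (b * a * D⁻¹ * extProb p ^ (k - s) * p k))
        = (D * D⁻¹) * (a * a⁻¹) * (b * b⁻¹) * (extProb p ^ (k - s) * p k) := by ring
      _ = extProb p ^ (k - s) * p k := by
        rw [ENNReal.mul_inv_cancel hD hD', ENNReal.mul_inv_cancel hs hs',
          ENNReal.mul_inv_cancel hC hC', one_mul, one_mul, one_mul]

/-- The hypothesis means that 𝔠 > 0 or that A is empty, so the convention for 𝔭 when 𝔠 = 0 plays no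
role. -/
theorem prod_extOffspring_mul (p : PMF ℕ) (A : Finset (List ℕ)) (k : List ℕ → ℕ)
    (h : extProb p ^ A.card ≠ 0) :
    (∏ u ∈ A, extOffspring p (k u)) * extProb p ^ A.card
      = ∏ u ∈ A, (extProb p ^ k u * p (k u)) := by
  rw [← Finset.prod_const, ← Finset.prod_mul_distrib]
  refine Finset.prod_congr rfl fun u hu => ?_
  have h0 : extProb p ≠ 0 := fun h0 => h (by
    rw [h0, zero_pow (Finset.card_pos.2 ⟨u, hu⟩).ne'])
  rw [extOffspring, if_neg h0, mul_right_comm, ENNReal.div_mul_cancel h0 (extProb_ne_top p)]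

theorem ofReal_meanR {p : PMF ℕ} (hp : IsSupercritical p) : ENNReal.ofReal (meanR p) = mean p :=
  ENNReal.ofReal_toReal hp.mean_lt_top.ne

/-- The transitions of the extremal tree are the Doob transform, by the function `genDens`, of the
weights ∏ p(k_u). The powers of 𝔠 and the densities w^{*r} in the definition of τ^θ are exactly the
ratio of two values of `genDens`. -/
theorem extremalWeight_mul_genDens {p : PMF ℕ} (hp : IsSupercritical p) (h1 : extR p < 1)
    (c : ℕ → ℝ) (θ : ℝ) (j : ℕ) {g : TypedGen} (hg : g.surv ⊆ g.all) (h0 : genDens p c j g θ ≠ 0)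
    (htop : genDens p c j g θ ≠ ∞) (g' : TypedGen) :
    extremalWeight p c θ j g g' * genDens p c j g θ
      = stepWeight (fun _ k => p k) g g' * genDens p c (j + 1) g' θ := by
  classical
  by_cases hgg : IsNextGen g g'
  swap
  · rw [extremalWeight, stepWeight, if_neg hgg, if_neg hgg, zero_mul, zero_mul]
  have hm0 : ENNReal.ofReal (meanR p ^ j) ≠ 0 := (ENNReal.ofReal_pos.2 (pow_pos hp.meanR_pos j)).ne'
  rw [genDens] at h0 htop
  have hV0 : densConv p c g.surv.card (meanR p ^ j * θ) ≠ 0 := by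
    intro h; rw [h, mul_zero, mul_zero] at h0; exact h0 rfl
  have hc0 : extProb p ^ (g.all \ g.surv).card ≠ 0 := by
    intro h; rw [h, zero_mul] at h0; exact h0 rfl
  have hV : densConv p c g.surv.card (meanR p ^ j * θ) ≠ ∞ := by
    intro h
    rw [h, ENNReal.mul_top hm0, ENNReal.mul_top hc0] at htop
    exact htop rfl
  have hV1 : (mean p).toReal * ((mean p).toReal ^ j * θ) = meanR p ^ (j + 1) * θ := by
    rw [meanR, pow_succ]; ring
  have hV2 : (mean p).toReal ^ j * θ = meanR p ^ j * θ := rfl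
  have hsurv : ∏ u ∈ g.surv, (extProb p ^ (numChildren u g'.all - numChildren u g'.surv)
      * p (numChildren u g'.all)) = (∏ u ∈ g.surv, (genFunDeriv p (numChildren u g'.surv) (extProb p)
        / ((numChildren u g'.surv).factorial : ℝ≥0∞))) * ∏ u ∈ g.surv,
          (((numChildren u g'.all).choose (numChildren u g'.surv) : ℝ≥0∞)⁻¹ *
            biased p (numChildren u g'.surv) (numChildren u g'.all)) := by
    rw [← Finset.prod_mul_distrib]
    exact Finset.prod_congr rfl fun u _ => (mul_biased h1 (numChildren_mono u hgg.2.1)).symm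
  rw [extremalWeight, stepWeight, if_pos hgg, if_pos hgg, rho, hV1, hV2, ← hgg.card_surv hg, genDens,
    genDens, hgg.card_sdiff hg, pow_add (extProb p), ← Finset.prod_pow_eq_pow_sum, ← Finset.prod_pow_eq_pow_sum,
    ← Finset.prod_sdiff hg]
  have hext := prod_extOffspring_mul p (g.all \ g.surv) (fun u => numChildren u g'.all) hc0
  rw [Finset.prod_mul_distrib] at hext hsurv
  generalize densConv p c g.surv.card (meanR p ^ j * θ) = V at *
  generalize densConv p c g'.surv.card (meanR p ^ (j + 1) * θ) = V' at *
  have hmm : ENNReal.ofReal (meanR p ^ (j + 1)) = mean p * ENNReal.ofReal (meanR p ^ j) := by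
    rw [pow_succ', ENNReal.ofReal_mul hp.meanR_pos.le, ofReal_meanR hp]
  rw [hmm]
  generalize ∏ u ∈ g.all \ g.surv, extOffspring p (numChildren u g'.all) = x1 at *
  generalize ∏ u ∈ g.all \ g.surv, extProb p ^ (numChildren u g'.all) = x2 at *
  generalize ∏ u ∈ g.all \ g.surv, p (numChildren u g'.all) = x3 at *
  generalize ∏ u ∈ g.surv, p (numChildren u g'.all) = x4 at *
  generalize ∏ u ∈ g.surv, extProb p ^ (numChildren u g'.all - numChildren u g'.surv) = x5 at *
  generalize ∏ u ∈ g.surv, (genFunDeriv p (numChildren u g'.surv) (extProb p)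
        / ((numChildren u g'.surv).factorial : ℝ≥0∞)) = x6 at *
  generalize ∏ u ∈ g.surv, (((numChildren u g'.all).choose (numChildren u g'.surv) : ℝ≥0∞)⁻¹ *
            biased p (numChildren u g'.surv) (numChildren u g'.all)) = x7 at *
  generalize ENNReal.ofReal (meanR p ^ j) = m at *
  generalize extProb p ^ (g.all \ g.surv).card = e at *
  rw [div_eq_mul_inv]
  calc x1 * (mean p * V' * V⁻¹ * x6 * x7) * (e * (m * V))
      = (x1 * e) * (x6 * x7) * (mean p * V' * m) * (V * V⁻¹) := by ring
    _ = x3 * x4 * (x2 * x5 * (mean p * m * V')) := by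
      rw [ENNReal.mul_inv_cancel hV0 hV, hext, ← hsurv]; ring

theorem ofWeights_apply {α : Type*} {w : α → ℝ≥0∞} (h : ∑' a, w a = 1) (a₀ a : α) :
    ofWeights w a₀ a = w a := by
  have h1 : ofWeights w a₀ = ⟨w, h ▸ ENNReal.summable.hasSum⟩ := dif_pos h
  rw [h1]
  rfl

theorem IsRegular.mul_lintegral_extremalStep {p : PMF ℕ} (hp : IsSupercritical p) (h1 : extR p < 1)
    {c : ℕ → ℝ} {θ : ℝ} (hθ : IsRegular p c θ) (j : ℕ) {g : TypedGen} (hg : Admissible g)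
    (G : TypedGen → ℝ≥0∞) :
    genDens p c j g θ * ∫⁻ g', G g' ∂extremalStep p c θ j g
      = genStep (fun _ k => p k) (fun g' => genDens p c (j + 1) g' θ * G g') g := by
  obtain ⟨h2, htop⟩ := hθ j g hg
  by_cases h0 : genDens p c j g θ = 0
  · rw [h0, zero_mul]
    rw [h0] at h2
    refine (ENNReal.tsum_eq_zero.2 fun g' => ?_).symm
    rw [← mul_assoc, ENNReal.tsum_eq_zero.1 h2 g', zero_mul]
  · have h3 := extremalWeight_mul_genDens hp h1 c θ j hg.1 h0 htop
    -- Consistency at a regular θ says that the transformed weights have total mass one, so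
    -- `ofWeights` does not take its default value.
    have h4 : ∑' g', extremalWeight p c θ j g g' = 1 := by
      have : (∑' g', extremalWeight p c θ j g g') * genDens p c j g θ = 1 * genDens p c j g θ := by
        rw [← ENNReal.tsum_mul_right, tsum_congr h3, one_mul]
        exact h2
      exact (ENNReal.mul_left_inj h0 htop).1 this
    rw [lintegral_countable', ← ENNReal.tsum_mul_left]
    refine tsum_congr fun g' => ?_
    have h5 : extremalStep p c θ j g {g'} = extremalWeight p c θ j g g' := by
      refine (PMF.toMeasure_apply_singleton _ _ (MeasurableSet.singleton g')).trans ?_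
      exact ofWeights_apply h4 _ _
    rw [h5]
    calc genDens p c j g θ * (G g' * extremalWeight p c θ j g g')
        = extremalWeight p c θ j g g' * genDens p c j g θ * G g' := by ring
      _ = _ := by rw [h3, mul_assoc]

/-! ### The law of the extremal tree -/

/-- The first generation of the two-type trees. -/
abbrev rootGen : TypedGen := ⟨{[]}, {[]}⟩

theorem admissible_rootGen : Admissible rootGen := ⟨subset_rfl, Finset.singleton_nonempty _⟩

instance (p : PMF ℕ) (c : ℕ → ℝ) (θ : ℝ) : IsProbabilityMeasure (extremalPathLaw p c θ) := by
  unfold extremalPathLaw; infer_instance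

theorem lintegral_extremalPathLaw_zero (p : PMF ℕ) (c : ℕ → ℝ) (θ : ℝ) (G : TypedGen → ℝ≥0∞) :
    ∫⁻ x, G (x 0) ∂extremalPathLaw p c θ = G rootGen := by
  have hG : Measurable G := measurable_from_top
  have hG' : Measurable fun x : ℕ → TypedGen => G (x 0) := hG.comp (measurable_pi_apply 0)
  rw [extremalPathLaw, Kernel.lintegral_traj _ hG']
  simp [Function.updateFinset]

/-- The Markov property at generation n. -/
theorem lintegral_extremalPathLaw_succ (p : PMF ℕ) (c : ℕ → ℝ) (θ : ℝ) (n : ℕ)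
    {H : ((i : Finset.Iic n) → (fun _ : ℕ => TypedGen) i) → ℝ≥0∞} (hH : Measurable H)
    (K : TypedGen → TypedGen → ℝ≥0∞) :
    ∫⁻ x, H (Preorder.frestrictLe n x) * K (x n) (x (n + 1)) ∂extremalPathLaw p c θ
      = ∫⁻ x, H (Preorder.frestrictLe n x) * ∫⁻ g', K (x n) g' ∂extremalStep p c θ n (x n)
        ∂extremalPathLaw p c θ := by
  have hK : Measurable (Function.uncurry K) := measurable_of_countable _
  have hn : Measurable fun y : (i : Finset.Iic n) → (fun _ : ℕ => TypedGen) i =>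
      y ⟨n, Finset.mem_Iic.2 le_rfl⟩ := measurable_pi_apply _
  have hf : Measurable fun z : ((i : Finset.Iic n) → (fun _ : ℕ => TypedGen) i) × TypedGen =>
      H z.1 * K (z.1 ⟨n, Finset.mem_Iic.2 le_rfl⟩) z.2 :=
    (hH.comp measurable_fst).mul (hK.comp ((hn.comp measurable_fst).prodMk measurable_snd))
  have hk : Measurable fun g => ∫⁻ g', K g g' ∂extremalStep p c θ n g := measurable_from_top
  rw [extremalPathLaw]
  have h1 := lintegral_map (μ := Kernel.traj (X := fun _ => TypedGen) (extremalKernel p c θ) 0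
    (fun _ => ⟨{[]}, {[]}⟩)) hf
    (g := fun x => (Preorder.frestrictLe n x, x (n + 1))) (by fun_prop)
  refine h1.symm.trans ?_
  rw [← Kernel.partialTraj_compProd_eq_map_traj (Nat.zero_le n), Measure.lintegral_compProd hf,
    ← Kernel.traj_map_frestrictLe_apply]
  have hg : Measurable fun y : (i : Finset.Iic n) → (fun _ : ℕ => TypedGen) i =>
      H y * ∫⁻ g', K (y ⟨n, Finset.mem_Iic.2 le_rfl⟩) g'
        ∂extremalStep p c θ n (y ⟨n, Finset.mem_Iic.2 le_rfl⟩) := hH.mul (hk.comp hn)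
  have h2 : ∀ y : (i : Finset.Iic n) → (fun _ : ℕ => TypedGen) i,
      ∫⁻ g', H y * K (y ⟨n, Finset.mem_Iic.2 le_rfl⟩) g' ∂extremalKernel p c θ n y
        = H y * ∫⁻ g', K (y ⟨n, Finset.mem_Iic.2 le_rfl⟩) g'
          ∂extremalStep p c θ n (y ⟨n, Finset.mem_Iic.2 le_rfl⟩) := by
    intro y
    rw [lintegral_const_mul _ measurable_from_top]
    rfl
  simp only [h2]
  rw [lintegral_map hg (Preorder.measurable_frestrictLe n)]
  rfl

/-- A transition between generations whose offspring numbers satisfy the constraints `C`. -/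
def IsConstrained (C : List ℕ → Set ℕ∞) (g g' : TypedGen) : Prop :=
  IsNextGen g g' ∧ ∀ u ∈ g.all, (numChildren u g'.all : ℕ∞) ∈ C u

open Classical in
/-- The weights `p(k)`, restricted to the offspring numbers which satisfy the constraints `C`. -/
def constrainedWeight (p : PMF ℕ) (C : List ℕ → Set ℕ∞) (u : List ℕ) (k : ℕ) : ℝ≥0∞ :=
  if (k : ℕ∞) ∈ C u then p k else 0

open Classical in
theorem stepWeight_mul_ite (p : PMF ℕ) (C : List ℕ → Set ℕ∞) (g g' : TypedGen) :
    stepWeight (fun _ k => p k) g g' * (if IsConstrained C g g' then 1 else 0)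
      = stepWeight (constrainedWeight p C) g g' := by
  by_cases h : IsNextGen g g'
  · rw [stepWeight, stepWeight, if_pos h, if_pos h]
    simp only [constrainedWeight]
    rw [Finset.prod_ite_zero, mul_ite, mul_one, mul_zero]
    simp only [IsConstrained, h, true_and]
  · rw [stepWeight, stepWeight, if_neg h, if_neg h, zero_mul]

open Classical in
-- The Doob transforms telescope along a path: the initial density times the path probability is the
-- product of the weights p(k_u) times the final density. The indicators restrict these weights to
-- the offspring numbers allowed by C.
theorem IsRegular.lintegral_prod_mul {p : PMF ℕ} (hp : IsSupercritical p) (h1 : extR p < 1)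
    {c : ℕ → ℝ} {θ : ℝ} (hθ : IsRegular p c θ) (C : List ℕ → Set ℕ∞) (n : ℕ)
    (G : TypedGen → ℝ≥0∞) :
    genDens p c 0 rootGen θ * ∫⁻ x, (∏ j ∈ Finset.range n,
        if IsConstrained C (x j) (x (j + 1)) then 1 else 0) * G (x n) ∂extremalPathLaw p c θ
      = (genStep (constrainedWeight p C))^[n] (fun g => genDens p c n g θ * G g) rootGen := by
  induction n generalizing G with
  | zero =>
    simp only [Finset.range_zero, Finset.prod_empty, one_mul]
    rw [lintegral_extremalPathLaw_zero]
    rfl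
  | succ n ih =>
    let e : TypedGen → TypedGen → ℝ≥0∞ := fun g g' => if IsConstrained C g g' then 1 else 0
    let H : ((i : Finset.Iic n) → (fun _ : ℕ => TypedGen) i) → ℝ≥0∞ := fun y =>
      ∏ j ∈ (Finset.range n).attach, e (y ⟨j.1, Finset.mem_Iic.2 (Finset.mem_range.1 j.2).le⟩)
        (y ⟨j.1 + 1, Finset.mem_Iic.2 (Finset.mem_range.1 j.2)⟩)
    have he : Measurable (Function.uncurry e) := measurable_of_countable _
    have hH : Measurable H := by
      refine Finset.measurable_fun_prod _ fun j _ => ?_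
      exact he.comp (Measurable.prodMk
        (f := fun y : (i : Finset.Iic n) → (fun _ : ℕ => TypedGen) i =>
          y ⟨j.1, Finset.mem_Iic.2 (Finset.mem_range.1 j.2).le⟩)
        (g := fun y : (i : Finset.Iic n) → (fun _ : ℕ => TypedGen) i =>
          y ⟨j.1 + 1, Finset.mem_Iic.2 (Finset.mem_range.1 j.2)⟩)
        (measurable_pi_apply _) (measurable_pi_apply _))
    have hHx : ∀ x : ℕ → TypedGen, H (Preorder.frestrictLe n x)
        = ∏ j ∈ Finset.range n, e (x j) (x (j + 1)) := fun x =>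
      Finset.prod_attach (Finset.range n) fun j => e (x j) (x (j + 1))
    have h2 := lintegral_extremalPathLaw_succ p c θ n hH fun g g' => e g g' * G g'
    simp only [hHx] at h2
    have h3 : ∀ x : ℕ → TypedGen, (∏ j ∈ Finset.range (n + 1),
        if IsConstrained C (x j) (x (j + 1)) then 1 else 0) * G (x (n + 1))
        = (∏ j ∈ Finset.range n, e (x j) (x (j + 1))) * (e (x n) (x (n + 1)) * G (x (n + 1))) :=
      fun x => by rw [Finset.prod_range_succ, mul_assoc]
    simp only [h3]
    rw [h2]
    refine (ih fun g => ∫⁻ g', e g g' * G g' ∂extremalStep p c θ n g).trans ?_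
    rw [Function.iterate_succ_apply]
    refine genStep_iterate_congr _ n (fun g hg => ?_) admissible_rootGen
    rw [hθ.mul_lintegral_extremalStep hp h1 n hg]
    refine tsum_congr fun g' => ?_
    rw [← stepWeight_mul_ite]
    simp only [e]
    ring

theorem IsRegular.genStep_iterate_genDens {p : PMF ℕ} {c : ℕ → ℝ} {θ : ℝ} (hθ : IsRegular p c θ)
    (n : ℕ) : (genStep fun _ k => p k)^[n] (fun g => genDens p c n g θ) rootGen
      = genDens p c 0 rootGen θ := by
  induction n with
  | zero => rfl
  | succ n ih =>
    rw [Function.iterate_succ_apply, ← ih]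
    exact genStep_iterate_congr _ n (fun g hg => (hθ n g hg).1) admissible_rootGen

theorem genDens_rootGen (p : PMF ℕ) (c : ℕ → ℝ) (θ : ℝ) : genDens p c 0 rootGen θ = dens p c θ := by
  simp [genDens, densConv]

/-- Without constraints, `IsRegular.lintegral_prod_mul` gives total mass one to the paths whose
steps are all admissible, because w(θ) is neither 0 nor infinite. -/
theorem IsRegular.ae_isNextGen {p : PMF ℕ} (hp : IsSupercritical p) (h1 : extR p < 1)
    {c : ℕ → ℝ} {θ : ℝ} (hθ : IsRegular p c θ) (h0 : dens p c θ ≠ 0) :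
    ∀ᵐ x ∂extremalPathLaw p c θ, ∀ j, IsNextGen (x j) (x (j + 1)) := by
  classical
  refine ae_all_iff.2 fun j => ?_
  have h2 := hθ.lintegral_prod_mul hp h1 (fun _ => Set.univ) (j + 1) fun _ => 1
  have h3 : constrainedWeight p (fun _ => Set.univ) = fun _ k => p k := by
    funext u k
    simp [constrainedWeight]
  simp only [h3, mul_one] at h2
  rw [hθ.genStep_iterate_genDens, genDens_rootGen] at h2
  have h4 := (ENNReal.mul_right_inj h0 ENNReal.ofReal_ne_top).1 (h2.trans (mul_one _).symm)
  let e : (ℕ → TypedGen) → ℝ≥0∞ := fun x => ∏ j ∈ Finset.range (j + 1),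
    if IsConstrained (fun _ => Set.univ) (x j) (x (j + 1)) then 1 else 0
  have he : Measurable e := by
    have he' : Measurable fun z : TypedGen × TypedGen =>
        if IsConstrained (fun _ => Set.univ) z.1 z.2 then (1 : ℝ≥0∞) else 0 :=
      measurable_of_countable _
    exact Finset.measurable_fun_prod _ fun j _ =>
      he'.comp (Measurable.prodMk (f := fun x : ℕ → TypedGen => x j)
        (g := fun x : ℕ → TypedGen => x (j + 1)) (measurable_pi_apply _) (measurable_pi_apply _))
  have hle : ∀ x, e x ≤ 1 := fun x => Finset.prod_le_one' fun j _ => by split_ifs <;> simp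
  have h5 : ∀ᵐ x ∂extremalPathLaw p c θ, e x = 1 := by
    have h6 : ∫⁻ x, (1 - e x) ∂extremalPathLaw p c θ = 0 := by
      rw [lintegral_sub he (by rw [h4]; simp) (Eventually.of_forall hle), h4]
      simp
    have hm : Measurable fun x => 1 - e x := measurable_const.sub he
    rw [lintegral_eq_zero_iff hm] at h6
    filter_upwards [h6] with x hx
    exact le_antisymm (hle x) (tsub_eq_zero_iff_le.1 hx)
  filter_upwards [h5] with x hx
  by_contra hcon
  have : e x = 0 := Finset.prod_eq_zero (Finset.mem_range.2 (Nat.lt_succ_self j))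
    (if_neg fun h => hcon h.1)
  rw [this] at hx
  exact zero_ne_one hx

theorem reached_iff_of_isNextGen {x : ℕ → TypedGen} (h0 : x 0 = rootGen)
    (h : ∀ j, IsNextGen (x j) (x (j + 1))) (u : List ℕ) :
    Reached (fun u => (numChildren u (x (u.length + 1)).all : ℕ∞)) u ↔ u ∈ (x u.length).all := by
  induction u with
  | nil => simp [Reached, h0]
  | cons i u ih =>
    simp only [Reached, ih, Nat.cast_lt, List.length_cons]
    rw [(h u.length).1]
    constructor
    · exact fun hu => ⟨u, hu.1, i, hu.2, rfl⟩
    · rintro ⟨v, hv, j, hj, hij⟩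
      obtain ⟨rfl, rfl⟩ := List.cons_eq_cons.1 hij
      exact ⟨hv, hj⟩

theorem length_eq_of_isNextGen {x : ℕ → TypedGen} (h0 : x 0 = rootGen)
    (h : ∀ j, IsNextGen (x j) (x (j + 1))) (j : ℕ) : ∀ u ∈ (x j).all, u.length = j := by
  induction j with
  | zero => simp [h0]
  | succ j ih =>
    intro u hu
    obtain ⟨v, hv, i, -, rfl⟩ := ((h j).1 u).1 hu
    simp [ih v hv]

theorem ae_extremalPathLaw_zero (p : PMF ℕ) (c : ℕ → ℝ) (θ : ℝ) :
    ∀ᵐ x ∂extremalPathLaw p c θ, x 0 = rootGen := by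
  classical
  have h := lintegral_extremalPathLaw_zero p c θ fun g => if g = rootGen then 0 else 1
  rw [if_pos rfl, lintegral_eq_zero_iff] at h
  · filter_upwards [h] with x hx
    by_contra hne
    simp [hne] at hx
  · have : Measurable fun g : TypedGen => if g = rootGen then (0 : ℝ≥0∞) else 1 :=
      measurable_from_top
    exact this.comp (measurable_pi_apply 0)

open Classical in
theorem IsRegular.dens_mul_extremalLaw {p : PMF ℕ} (hp : IsSupercritical p) (h1 : extR p < 1)
    {c : ℕ → ℝ} {θ : ℝ} (hθ : IsRegular p c θ) {F : Finset (List ℕ)} {C : List ℕ → Set ℕ∞}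
    (hF : IsFramed F C) {n : ℕ} (hn : ∀ u ∈ F, u.length < n) :
    dens p c θ * (extremalLaw p c θ : Measure PlaneTree) (boxEvent F C)
      = (genStep (constrainedWeight p C))^[n] (fun g => genDens p c n g θ) rootGen := by
  have h2 := hθ.lintegral_prod_mul hp h1 C n fun _ => 1
  simp only [mul_one] at h2
  rw [← h2, genDens_rootGen]
  -- Where w(θ) = 0 nothing is known about τ^θ, but both sides vanish.
  by_cases h0 : dens p c θ = 0
  · rw [h0, zero_mul, zero_mul]
  congr 1
  have hbox := (isClopen_boxEvent (F := F) hF.isClopen).isOpen.measurableSet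
  change Measure.map skeleton _ _ = _
  rw [Measure.map_apply measurable_skeleton hbox, ← lintegral_indicator_one (measurable_skeleton hbox)]
  refine lintegral_congr_ae ?_
  filter_upwards [hθ.ae_isNextGen hp h1 h0, ae_extremalPathLaw_zero p c θ] with x hx hx0
  rw [Finset.prod_ite_zero, Finset.prod_const_one, Set.indicator_apply]
  refine if_congr ?_ rfl rfl
  refine hF.treeOf_mem_iff.trans ?_
  simp only [reached_iff_of_isNextGen hx0 hx, Finset.mem_range]
  constructor
  · refine fun h j _ => ⟨hx j, fun u hu => ?_⟩
    have hl := length_eq_of_isNextGen hx0 hx j u hu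
    subst hl
    exact h u hu
  · intro h u hu
    by_cases huF : u ∈ F
    · exact (h u.length (hn u huF)).2 u hu
    · rw [hF.eq_univ u huF]
      trivial

/-! ### Tilted Galton-Watson trees -/

theorem branch_iterate_congr (γ : List ℕ → ℕ → ℝ≥0∞) (n : ℕ) {a b : List ℕ → ℝ≥0∞} (u : List ℕ)
    (h : ∀ v, v.length = u.length + n → a v = b v) :
    (branch γ)^[n] a u = (branch γ)^[n] b u := by
  induction n generalizing u with
  | zero => exact h u rfl
  | succ n ih =>
    rw [Function.iterate_succ_apply', Function.iterate_succ_apply', branch, branch]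
    refine tsum_congr fun k => ?_
    congr 1
    refine Finset.prod_congr rfl fun i _ => ih _ fun v hv => h v ?_
    rw [hv, List.length_cons]
    ring

theorem branch_constrainedWeight_le {p : PMF ℕ} (C : List ℕ → Set ℕ∞) {a : ℝ≥0∞}
    (ha : genFun p a = a) {b : List ℕ → ℝ≥0∞} (hb : ∀ u, b u ≤ a) (u : List ℕ) :
    branch (constrainedWeight p C) b u ≤ a := by
  refine le_trans ?_ ha.le
  refine ENNReal.tsum_le_tsum fun k => mul_le_mul' ?_ ?_
  · rw [constrainedWeight]
    split_ifs <;> simp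
  · exact (Finset.prod_le_pow_card _ _ a fun i _ => hb _).trans_eq (by rw [Finset.card_range])

/-- The number a is the weight of the constrained trees all of whose vertices are of type e. Adding
it to the integral merges the two colours, and 𝔠 + φ becomes the Laplace transform of W. -/
theorem IsSenetaHeyde.lintegral_exp_mul_extremalLaw_add {p : PMF ℕ} (hp : IsSupercritical p)
    {c : ℕ → ℝ} (hc : IsSenetaHeyde p c) (l : ℝ) {F : Finset (List ℕ)} {C : List ℕ → Set ℕ∞}
    (hF : IsFramed F C) {n : ℕ} (hn : ∀ u ∈ F, u.length < n) :
    ∃ a ≤ extProb p, a + ∫⁻ θ in Set.Ioi 0, ENNReal.ofReal (Real.exp (l * θ)) *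
        (dens p c θ * (extremalLaw p c θ : Measure PlaneTree) (boxEvent F C))
      = (branch (constrainedWeight p C))^[n] (fun _ => lap (limLaw p c) (l / meanR p ^ n)) [] := by
  obtain ⟨b, hb1, hb2⟩ := genStep_iterate_colorProd (constrainedWeight p C) n
    (fun _ => extProb p) fun _ => densLap p c (l / meanR p ^ n)
  refine ⟨(branch (constrainedWeight p C))^[n] (fun _ => extProb p) [], ?_, ?_⟩
  · have : ∀ n u, (branch (constrainedWeight p C))^[n] (fun _ => extProb p) u ≤ extProb p := by
      intro n
      induction n with
      | zero => exact fun u => le_rfl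
      | succ n ih =>
        intro u
        rw [Function.iterate_succ_apply']
        exact branch_constrainedWeight_le C hp.genFun_extProb ih u
    exact this n []
  · have h1 : ∫⁻ θ in Set.Ioi 0, ENNReal.ofReal (Real.exp (l * θ)) *
        (dens p c θ * (extremalLaw p c θ : Measure PlaneTree) (boxEvent F C))
        = ∫⁻ θ in Set.Ioi 0, ENNReal.ofReal (Real.exp (l * θ)) *
          (genStep (constrainedWeight p C))^[n] (fun g => genDens p c n g θ) rootGen := by
      refine lintegral_congr_ae ?_
      filter_upwards [hc.ae_isRegular hp] with θ hθ
      rw [hθ.dens_mul_extremalLaw hp hc.extR_lt_one hF hn]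
    rw [h1, lintegral_genStep_iterate _ (measurable_exp_mul l) n (measurable_genDens p c n),
      genStep_iterate_congr _ n (fun g hg => lintegral_exp_mul_genDens hp c l n hg)
        admissible_rootGen]
    have h2 := congrFun hb1 rootGen
    have h3 := congrFun hb2 []
    have h4 : ((fun _ => extProb p) + fun _ => densLap p c (l / meanR p ^ n))
        = fun _ : List ℕ => lap (limLaw p c) (l / meanR p ^ n) :=
      funext fun _ => (hc.lap_limLaw_eq_add hp _).symm
    rw [h4] at h3
    rw [← h3]
    have h5 : colorProd ((branch (constrainedWeight p C))^[n] fun _ => extProb p) b rootGen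
        = b [] := by simp [colorProd]
    rw [h5] at h2
    rw [Pi.add_apply, ← h2]

theorem expMoment_coe (p : PMF ℕ) (c : ℕ → ℝ) (l : ℝ) (h : ℕ) :
    expMoment p c l h = lap (limLaw p c) (l / meanR p ^ h) := by
  rw [lap_limLaw, expMoment]
  congr 1 with t
  rw [← EReal.coe_mul, EReal.exp_coe, ← mul_assoc]
  rfl

theorem one_le_lap (p : PMF ℕ) (c : ℕ → ℝ) {l : ℝ} (hl : 0 ≤ l) : 1 ≤ lap (limLaw p c) l := by
  have h : ∫⁻ _, (1 : ℝ≥0∞) ∂limLaw p c = 1 := by simp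
  rw [← h, lap]
  refine lintegral_mono_ae ?_
  filter_upwards [ae_limLaw_nonneg p c] with x hx
  rw [← ENNReal.ofReal_one]
  exact ENNReal.ofReal_le_ofReal (Real.one_le_exp (mul_nonneg hl hx))

theorem lap_limLaw_mono (p : PMF ℕ) (c : ℕ → ℝ) {l l' : ℝ} (h : l ≤ l') :
    lap (limLaw p c) l ≤ lap (limLaw p c) l' := by
  refine lintegral_mono_ae ?_
  filter_upwards [ae_limLaw_nonneg p c] with x hx
  gcongr

theorem IsSupercritical.div_meanR_pow_succ {p : PMF ℕ} (hp : IsSupercritical p) (l : ℝ) (h : ℕ) :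
    meanR p * (l / meanR p ^ (h + 1)) = l / meanR p ^ h := by
  have := hp.meanR_pos.ne'
  rw [pow_succ]
  field_simp

theorem IsSupercritical.div_meanR_pow_le {p : PMF ℕ} (hp : IsSupercritical p) {l : ℝ} (hl : 0 ≤ l)
    (h : ℕ) : l / meanR p ^ (h + 1) ≤ l / meanR p ^ h :=
  div_le_div_of_nonneg_left hl (pow_pos hp.meanR_pos h)
    (pow_le_pow_right₀ hp.one_lt_meanR.le (Nat.le_succ h))

theorem IsSenetaHeyde.tiltedOffspring_eq_map {p : PMF ℕ} (hp : IsSupercritical p) {c : ℕ → ℝ}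
    (hc : IsSenetaHeyde p c) {l : ℝ} (hl : 0 ≤ l) {h : ℕ}
    (hfin : lap (limLaw p c) (l / meanR p ^ h) ≠ ∞) :
    ∃ q : PMF ℕ, tiltedOffspring p c l h = q.map (fun n : ℕ => (n : ℕ∞)) ∧
      ∀ k, q k = lap (limLaw p c) (l / meanR p ^ (h + 1)) ^ k / lap (limLaw p c) (l / meanR p ^ h)
        * p k := by
  have h0 : lap (limLaw p c) (l / meanR p ^ h) ≠ 0 :=
    (zero_lt_one.trans_le (one_le_lap p c (div_nonneg hl (pow_pos hp.meanR_pos h).le))).ne'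
  refine ⟨_, by rw [tiltedOffspring, expMoment_coe, expMoment_coe, if_neg hfin, if_neg h0], ?_⟩
  intro k
  refine ofWeights_apply ?_ _ _
  have h1 := hc.genFun_lap hp (l / meanR p ^ (h + 1))
  rw [hp.div_meanR_pow_succ] at h1
  have h2 : ∀ k, lap (limLaw p c) (l / meanR p ^ (h + 1)) ^ k / lap (limLaw p c) (l / meanR p ^ h)
      * p k = p k * lap (limLaw p c) (l / meanR p ^ (h + 1)) ^ k
        * (lap (limLaw p c) (l / meanR p ^ h))⁻¹ := fun k => by
    rw [div_eq_mul_inv]; ring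
  simp only [h2]
  rw [ENNReal.tsum_mul_right]
  change genFun p _ * _ = 1
  rw [h1, ENNReal.mul_inv_cancel h0 hfin]

open Classical in
theorem toMeasure_map_natCast (q : PMF ℕ) (C : Set ℕ∞) (hC : MeasurableSet C) :
    (q.map fun n : ℕ => (n : ℕ∞)).toMeasure C = ∑' k : ℕ, if (k : ℕ∞) ∈ C then q k else 0 := by
  rw [PMF.toMeasure_map_apply _ _ _ (measurable_of_countable _) hC,
    PMF.toMeasure_apply (hs := MeasurableSet.of_discrete)]
  refine tsum_congr fun k => ?_
  rw [Set.indicator_apply]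
  rfl

theorem IsFramed.mem_of_suffix {F : Finset (List ℕ)} {C : List ℕ → Set ℕ∞} (hF : IsFramed F C)
    {u v : List ℕ} (hv : v ∈ F) (h : u <:+ v) : u ∈ F := by
  induction v with
  | nil => rwa [List.suffix_nil.1 h]
  | cons i v ih =>
    rcases List.suffix_cons_iff.1 h with rfl | h
    · exact hv
    · exact ih (hF.mem_parent i v hv) h

open Classical in
-- The strict descendants of u in F are sorted by the child of u from which they descend.
theorem IsFramed.prod_suffix_cons {F : Finset (List ℕ)} {C : List ℕ → Set ℕ∞} (hF : IsFramed F C)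
    (Q : List ℕ → ℝ≥0∞) {u : List ℕ} {k : ℕ} (hk : ∀ i, i :: u ∈ F → i < k) :
    ∏ i ∈ Finset.range k, ∏ v ∈ F with (i :: u) <:+ v, Q v = ∏ v ∈ F with u <:+ v ∧ v ≠ u, Q v := by
  rw [← Finset.prod_biUnion]
  · refine Finset.prod_congr ?_ fun _ _ => rfl
    ext v
    simp only [Finset.mem_biUnion, Finset.mem_range, Finset.mem_filter]
    constructor
    · rintro ⟨i, -, hv, hs⟩
      refine ⟨hv, (List.suffix_cons i u).trans hs, ?_⟩
      rintro rfl
      have := hs.length_le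
      simp at this
    · rintro ⟨hv, ⟨t, rfl⟩, hne⟩
      rcases List.eq_nil_or_concat t with rfl | ⟨s, i, rfl⟩
      · simp at hne
      · have hs : (i :: u) <:+ s ++ [i] ++ u := ⟨s, by simp⟩
        rw [List.concat_eq_append] at hv ⊢
        exact ⟨i, hk i (hF.mem_of_suffix hv hs), hv, hs⟩
  · intro i _ j _ hij
    rw [Function.onFun, Finset.disjoint_left]
    intro v hi hj
    have := List.suffix_of_suffix_length_le (Finset.mem_filter.1 hi).2 (Finset.mem_filter.1 hj).2
      (by simp)
    exact hij (List.cons_eq_cons.1 (this.eq_of_length (by simp))).1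

open Classical in
-- The fixed point is ζ_h times the probability that T^(l) obeys the constraints at and above u,
-- where h is the generation of u. Indeed k children contribute p(k) ζ_{h+1}^k, which is ζ_h times
-- the tilted offspring probability of k.
theorem IsSenetaHeyde.branch_tilted {p : PMF ℕ} (hp : IsSupercritical p) {c : ℕ → ℝ}
    (hc : IsSenetaHeyde p c) {l : ℝ} (hl : 0 ≤ l) (hfin : lap (limLaw p c) l ≠ ∞)
    {F : Finset (List ℕ)} {C : List ℕ → Set ℕ∞} (hF : IsFramed F C) (u : List ℕ) :
    branch (constrainedWeight p C) (fun u => lap (limLaw p c) (l / meanR p ^ u.length) *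
        ∏ v ∈ F with u <:+ v, (tiltedOffspring p c l v.length).toMeasure (C v)) u
      = lap (limLaw p c) (l / meanR p ^ u.length) *
        ∏ v ∈ F with u <:+ v, (tiltedOffspring p c l v.length).toMeasure (C v) := by
  have hfin' : ∀ h, lap (limLaw p c) (l / meanR p ^ h) ≠ ∞ := fun h =>
    ne_top_of_le_ne_top hfin (lap_limLaw_mono p c
      (div_le_self hl (one_le_pow₀ hp.one_lt_meanR.le)))
  have h0 : lap (limLaw p c) (l / meanR p ^ u.length) ≠ 0 :=
    (zero_lt_one.trans_le (one_le_lap p c (div_nonneg hl (pow_pos hp.meanR_pos _).le))).ne'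
  obtain ⟨q, hq, hqk⟩ := hc.tiltedOffspring_eq_map hp hl (hfin' u.length)
  let Q : List ℕ → ℝ≥0∞ := fun v => (tiltedOffspring p c l v.length).toMeasure (C v)
  have h1 : ∏ v ∈ F with u <:+ v, Q v = Q u * ∏ v ∈ F with u <:+ v ∧ v ≠ u, Q v := by
    by_cases hu : u ∈ F
    · rw [← Finset.prod_insert]
      · refine Finset.prod_congr ?_ fun _ _ => rfl
        ext v
        simp only [Finset.mem_filter, Finset.mem_insert]
        constructor
        · rintro ⟨hv, hs⟩
          by_cases hvu : v = u
          · exact Or.inl hvu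
          · exact Or.inr ⟨hv, hs, hvu⟩
        · rintro (rfl | ⟨hv, hs, -⟩)
          · exact ⟨hu, List.suffix_rfl⟩
          · exact ⟨hv, hs⟩
      · simp
    · have h2 : Q u = 1 := by
        simp only [Q, hF.eq_univ u hu]
        exact measure_univ
      rw [h2, one_mul]
      refine Finset.prod_congr ?_ fun _ _ => rfl
      refine Finset.filter_congr fun v hv => ⟨fun h => ⟨h, ?_⟩, fun h => h.1⟩
      rintro rfl
      exact hu hv
  have h2 : Q u = ∑' k : ℕ, if (k : ℕ∞) ∈ C u then q k else 0 := by
    simp only [Q, hq]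
    exact toMeasure_map_natCast q (C u) (hF.isClopen u).isOpen.measurableSet
  rw [h1, h2, ← ENNReal.tsum_mul_right, ← ENNReal.tsum_mul_left, branch]
  refine tsum_congr fun k => ?_
  rw [constrainedWeight]
  split_ifs with hk
  · have hk' : ∀ i, i :: u ∈ F → i < k := fun i hi => by
      exact_mod_cast hF.lt_of_mem i u hi k hk
    have h3 := hF.prod_suffix_cons Q hk'
    rw [Finset.prod_mul_distrib, h3]
    simp only [List.length_cons, Finset.prod_const, Finset.card_range]
    have hfin'' := hfin' u.length
    rw [hqk]
    generalize ∏ v ∈ F with u <:+ v ∧ v ≠ u, Q v = x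
    generalize lap (limLaw p c) (l / meanR p ^ u.length) = A at *
    generalize lap (limLaw p c) (l / meanR p ^ (u.length + 1)) = B
    rw [div_eq_mul_inv]
    calc p k * (B ^ k * x) = A * A⁻¹ * (p k * (B ^ k * x)) := by
          rw [ENNReal.mul_inv_cancel h0 hfin'', one_mul]
      _ = A * (B ^ k * A⁻¹ * p k * x) := by ring
  · simp

/-- The mixture formula. Beyond the depth of F the fixed point of `IsSenetaHeyde.branch_tilted`
reduces to ζ_n, so n iterations started from ζ_n give its value at the root. -/
theorem IsSenetaHeyde.lintegral_exp_mul_extremalLaw {p : PMF ℕ} (hp : IsSupercritical p)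
    {c : ℕ → ℝ} (hc : IsSenetaHeyde p c) {l : ℝ} (hl : 0 ≤ l) (hfin : lap (limLaw p c) l ≠ ∞)
    {F : Finset (List ℕ)} {C : List ℕ → Set ℕ∞} (hF : IsFramed F C) :
    ∃ a ≤ extProb p, a + ∫⁻ θ in Set.Ioi 0, ENNReal.ofReal (Real.exp (l * θ)) *
        (dens p c θ * (extremalLaw p c θ : Measure PlaneTree) (boxEvent F C))
      = lap (limLaw p c) l * (tiltedLaw p c l : Measure PlaneTree) (boxEvent F C) := by
  classical
  obtain ⟨n, hn⟩ : ∃ n, ∀ u ∈ F, u.length < n :=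
    ⟨F.sup List.length + 1, fun u hu => Nat.lt_succ_of_le (Finset.le_sup hu)⟩
  obtain ⟨a, ha, h⟩ := hc.lintegral_exp_mul_extremalLaw_add hp l hF hn
  refine ⟨a, ha, h.trans ?_⟩
  have h1 := Function.iterate_fixed (funext (hc.branch_tilted hp hl hfin hF)) n
  have h2 := congrFun h1 []
  rw [tiltedLaw, gwLaw_boxEvent _ hF]
  simp only [List.length_nil, pow_zero, div_one, List.nil_suffix, Finset.filter_true] at h2
  rw [← h2]
  refine branch_iterate_congr _ n [] fun v hv => ?_
  rw [List.length_nil, zero_add] at hv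
  rw [hv, Finset.filter_false_of_mem, Finset.prod_empty, mul_one]
  intro w hw hs
  have := hn w hw
  have := hs.length_le
  omega

/-! ### The critical parameter -/

theorem IsSenetaHeyde.exists_seq_lambdaC {p : PMF ℕ} (hp : IsSupercritical p) {c : ℕ → ℝ}
    (hc : IsSenetaHeyde p c) : ∃ l : ℕ → ℝ, StrictMono l ∧ (∀ n, 0 < l n) ∧
      (∀ n, lap (limLaw p c) (l n) ≠ ∞) ∧ (∀ n, (l n : EReal) < lambdaC p c) ∧
      Tendsto (fun n => (l n : EReal)) atTop (𝓝 (lambdaC p c)) := by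
  obtain ⟨l₀, hl₀, hlap⟩ := hc.exists_lap_lt_top hp
  have hpos : (0 : EReal) < lambdaC p c := by
    refine (EReal.coe_pos.2 hl₀).trans_le (le_sSup ⟨l₀, ?_, rfl⟩)
    change expMoment p c l₀ 0 < ∞
    rwa [expMoment_coe, pow_zero, div_one]
  obtain ⟨u, hu, hmem, hlim⟩ := exists_seq_strictMono_tendsto' hpos
  have hcoe : ∀ n, ((u n).toReal : EReal) = u n := fun n =>
    EReal.coe_toReal (hmem n).2.ne_top (hmem n).1.ne_bot
  refine ⟨fun n => (u n).toReal, fun m n hmn => ?_, fun n => ?_, fun n => ?_, fun n => ?_, ?_⟩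
  · rw [← EReal.coe_lt_coe_iff, hcoe, hcoe]
    exact hu hmn
  · rw [← EReal.coe_lt_coe_iff, hcoe]
    exact (hmem n).1
  · obtain ⟨_, ⟨l, hl, rfl⟩, hlt⟩ := lt_sSup_iff.1 (hmem n).2
    change expMoment p c l 0 < ∞ at hl
    rw [expMoment_coe, pow_zero, div_one] at hl
    rw [← hcoe n, EReal.coe_lt_coe_iff] at hlt
    exact ((lap_limLaw_mono p c hlt.le).trans_lt hl).ne
  · rw [hcoe]
    exact (hmem n).2
  · simpa only [hcoe] using hlim

theorem tendsto_expMoment (p : PMF ℕ) (c : ℕ → ℝ) {l : ℕ → ℝ} (hl : StrictMono l)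
    (hlim : Tendsto (fun n => (l n : EReal)) atTop (𝓝 (lambdaC p c)))
    (hlt : ∀ n, (l n : EReal) < lambdaC p c) (h : ℕ) :
    Tendsto (fun n => expMoment p c (l n) h) atTop (𝓝 (expMoment p c (lambdaC p c) h)) := by
  have hy : ∀ t, (0 : ℝ) ≤ ((mean p).toReal ^ h)⁻¹ * limW c t := fun t =>
    mul_nonneg (inv_nonneg.2 (pow_nonneg ENNReal.toReal_nonneg h)) (limW_nonneg c t)
  refine lintegral_tendsto_of_tendsto_of_monotone (fun n => ?_) (Eventually.of_forall fun t => ?_)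
    (Eventually.of_forall fun t => ?_)
  · simp only [← EReal.coe_mul, EReal.exp_coe]
    have := measurable_limW c
    exact (by fun_prop : Measurable _).aemeasurable
  · intro m n hmn
    refine EReal.exp_strictMono.monotone ?_
    rw [← EReal.coe_mul, ← EReal.coe_mul, EReal.coe_le_coe_iff]
    exact mul_le_mul_of_nonneg_right (hl.monotone hmn) (hy t)
  · refine (ENNReal.continuous_exp.tendsto _).comp ?_
    rcases (hy t).eq_or_lt with h0 | h0
    · rw [← h0]
      simp
    · refine EReal.Tendsto.mul hlim tendsto_const_nhds (Or.inr (EReal.coe_ne_bot _))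
        (Or.inr (EReal.coe_ne_top _)) (Or.inl ?_) (Or.inr ?_)
      · exact ((EReal.bot_lt_coe _).trans (hlt 0)).ne'
      · exact_mod_cast h0.ne'

theorem tendsto_lap_right {p : PMF ℕ} {c : ℕ → ℝ} {l l' : ℝ} (hll : l < l')
    (h : lap (limLaw p c) l' ≠ ∞) :
    Tendsto (fun n : ℕ => lap (limLaw p c) (l + (l' - l) / (n + 1))) atTop
      (𝓝 (lap (limLaw p c) l)) := by
  refine tendsto_lintegral_of_dominated_convergence
    (fun x => ENNReal.ofReal (Real.exp (l' * x))) (fun n => measurable_exp_mul _) (fun n => ?_) h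
    (Eventually.of_forall fun x => ?_)
  · filter_upwards [ae_limLaw_nonneg p c] with x hx
    have h1 : l + (l' - l) / (n + 1) ≤ l' := by
      have := div_le_self (a := l' - l) (b := (n : ℝ) + 1) (by linarith)
        (by linarith [n.cast_nonneg (α := ℝ)])
      linarith
    gcongr
  · have h1 : Tendsto (fun n : ℕ => l + (l' - l) / ((n : ℝ) + 1)) atTop (𝓝 l) := by
      have := (tendsto_const_div_atTop_nhds_zero_nat (l' - l)).comp (tendsto_add_atTop_nat 1)
      have := this.const_add l
      simpa using this
    exact ENNReal.tendsto_ofReal ((Real.continuous_exp.tendsto _).comp (h1.mul_const x))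

/-- As f is infinite at R_c, a point where f is finite lies strictly below R_c. -/
theorem IsSupercritical.lt_radius {p : PMF ℕ} (hp : IsSupercritical p) {y : ℝ≥0∞} (hy : 1 ≤ y)
    (h : genFun p y < ∞) : ∃ r, y < r ∧ genFun p r < ∞ := by
  have h1 : y < radius p := by
    refine lt_of_le_of_ne (le_sSup ⟨hy, h⟩) fun h2 => ?_
    rw [h2, hp.genFun_radius] at h
    exact lt_irrefl _ h
  obtain ⟨r, hr, hyr⟩ := lt_sSup_iff.1 h1
  exact ⟨r, hyr, hr.2⟩

theorem IsSenetaHeyde.limLaw_Ioi_zero_ne_zero {p : PMF ℕ} (hp : IsSupercritical p) {c : ℕ → ℝ}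
    (hc : IsSenetaHeyde p c) : limLaw p c (Set.Ioi 0) ≠ 0 := by
  intro h
  refine hc.not_ae_eq_const hp 0 ?_
  filter_upwards [ae_limLaw_nonneg p c, measure_eq_zero_iff_ae_notMem.1 h] with x hx hx'
  exact le_antisymm (not_lt.1 hx') hx

theorem IsSenetaHeyde.expMoment_top {p : PMF ℕ} (hp : IsSupercritical p) {c : ℕ → ℝ}
    (hc : IsSenetaHeyde p c) (h : ℕ) : expMoment p c ⊤ h = ∞ := by
  rw [expMoment]
  have h1 : (tauLaw p : Measure PlaneTree) (limW c ⁻¹' Set.Ioi 0) ≠ 0 := by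
    rw [← Measure.map_apply (measurable_limW c) measurableSet_Ioi]
    exact hc.limLaw_Ioi_zero_ne_zero hp
  refine top_unique ((?_ : ∞ ≤ ∫⁻ t, (limW c ⁻¹' Set.Ioi 0).indicator (fun _ => ∞) t
    ∂(tauLaw p : Measure PlaneTree)).trans (lintegral_mono fun t => ?_))
  · rw [lintegral_indicator_const (measurable_limW c measurableSet_Ioi), ENNReal.top_mul h1]
  · refine Set.indicator_apply_le' (fun ht => ?_) fun _ => bot_le
    have h2 : 0 < ((mean p).toReal ^ h)⁻¹ * limW c t :=
      mul_pos (_root_.inv_pos.2 (pow_pos hp.meanR_pos h)) ht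
    rw [EReal.top_mul_coe_of_pos h2, EReal.exp_top]

/-- Suppose that φ(l) = E[exp(lW)] is finite at L = λ_c < ∞. Then f is finite at φ(L/μ), hence
slightly beyond. By right continuity of φ at L/μ < L, f(φ(l)) = φ(μl) is finite for some l > L/μ,
contradicting the definition of λ_c. -/
theorem IsSenetaHeyde.expMoment_lambdaC {p : PMF ℕ} (hp : IsSupercritical p) {c : ℕ → ℝ}
    (hc : IsSenetaHeyde p c) : expMoment p c (lambdaC p c) 0 = ∞ := by
  obtain ⟨l, hl, hl0, hfin, hlt, hlim⟩ := hc.exists_seq_lambdaC hp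
  induction hL : lambdaC p c using EReal.rec with
  | bot => exact absurd (hL ▸ hlt 0) not_lt_bot
  | top =>
    exact hc.expMoment_top hp 0
  | coe L =>
    rw [expMoment_coe, pow_zero, div_one]
    by_contra hne
    have hμ := hp.one_lt_meanR
    have hL0 : 0 < L := (hl0 0).trans (by
      have := hlt 0
      rwa [hL, EReal.coe_lt_coe_iff] at this)
    have h1 : L / meanR p < L := div_lt_self hL0 hμ
    have h2 : genFun p (lap (limLaw p c) (L / meanR p)) < ∞ := by
      rw [hc.genFun_lap hp, mul_div_cancel₀ _ hp.meanR_pos.ne']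
      exact lt_top_iff_ne_top.2 hne
    obtain ⟨r, hyr, hr⟩ := hp.lt_radius (one_le_lap p c (div_nonneg hL0.le hp.meanR_pos.le)) h2
    obtain ⟨n, hn⟩ := ((tendsto_lap_right h1 hne).eventually_lt_const hyr).exists
    have h3 : L < meanR p * (L / meanR p + (L - L / meanR p) / (n + 1)) := by
      have : 0 < (L - L / meanR p) / ((n : ℝ) + 1) := div_pos (by linarith) (by positivity)
      rw [mul_add, mul_div_cancel₀ _ hp.meanR_pos.ne']
      have := mul_pos hp.meanR_pos this
      linarith
    have h4 : expMoment p c (meanR p * (L / meanR p + (L - L / meanR p) / (n + 1)) : ℝ) 0 < ∞ := by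
      rw [expMoment_coe, pow_zero, div_one, ← hc.genFun_lap hp]
      exact (genFun_mono p hn.le).trans_lt hr
    have h5 : ((meanR p * (L / meanR p + (L - L / meanR p) / (n + 1)) : ℝ) : EReal)
        ≤ lambdaC p c := le_sSup ⟨_, h4, rfl⟩
    rw [hL, EReal.coe_le_coe_iff] at h5
    linarith

/-- Take k > μ with p(k) > 0. From f(x) ≥ p(k) x^k and the functional equation, E[exp(μ^j l W)]
grows at least like 2^(k^j). If W < M it would be at most exp(μ^j l M), which is smaller for large
j. -/
theorem IsSenetaHeyde.limLaw_Ici_ne_zero {p : PMF ℕ} (hp : IsSupercritical p) {c : ℕ → ℝ}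
    (hc : IsSenetaHeyde p c) (M : ℝ) : limLaw p c (Set.Ici M) ≠ 0 := by
  intro hM
  obtain ⟨l, hl, hl0, hfin, hlt, hlim⟩ := hc.exists_seq_lambdaC hp
  have hμ := hp.one_lt_meanR
  have h1 := tendsto_expMoment p c hl hlim hlt 0
  rw [hc.expMoment_lambdaC hp] at h1
  simp only [expMoment_coe, pow_zero, div_one] at h1
  obtain ⟨k, hk, hpk⟩ := hp.exists_mean_lt
  have hk2 : 2 ≤ k := by
    have : (1 : ℝ) < k := hμ.trans hk
    exact_mod_cast this
  have h2 : Tendsto (fun n => p k * lap (limLaw p c) (l n)) atTop (𝓝 ∞) := by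
    have := ENNReal.Tendsto.const_mul h1 (Or.inr (p.apply_ne_top k))
    rwa [ENNReal.mul_top hpk] at this
  -- The transform is unbounded along l_n, so the induction can start from p(k) E[exp(l_n W)] ≥ 2.
  obtain ⟨n, hn⟩ := (h2.eventually_const_le (u := 2) ENNReal.ofNat_lt_top).exists
  have hlow : ∀ j : ℕ, 2 ^ k ^ j ≤ p k * lap (limLaw p c) (meanR p ^ j * l n) := by
    intro j
    induction j with
    | zero => simpa using hn
    | succ j ih =>
      rw [pow_succ' (meanR p), mul_assoc, ← hc.genFun_lap hp, pow_succ k, pow_mul]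
      calc (2 ^ k ^ j) ^ k ≤ (p k * lap (limLaw p c) (meanR p ^ j * l n)) ^ k := by gcongr
        _ = p k ^ k * lap (limLaw p c) (meanR p ^ j * l n) ^ k := mul_pow _ _ _
        _ ≤ p k ^ 2 * lap (limLaw p c) (meanR p ^ j * l n) ^ k :=
          mul_le_mul' (pow_le_pow_right_of_le_one' (p.coe_le_one k) hk2) le_rfl
        _ = p k * (p k * lap (limLaw p c) (meanR p ^ j * l n) ^ k) := by ring
        _ ≤ p k * genFun p (lap (limLaw p c) (meanR p ^ j * l n)) :=
          mul_le_mul' le_rfl (ENNReal.le_tsum k)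
  have hup : ∀ j : ℕ, p k * lap (limLaw p c) (meanR p ^ j * l n)
      ≤ ENNReal.ofReal (Real.exp (meanR p ^ j * l n * M)) := by
    intro j
    refine (mul_le_of_le_one_left' (p.coe_le_one k)).trans ?_
    have h3 : ∫⁻ _, ENNReal.ofReal (Real.exp (meanR p ^ j * l n * M)) ∂limLaw p c
        = ENNReal.ofReal (Real.exp (meanR p ^ j * l n * M)) := by simp
    rw [← h3]
    refine lintegral_mono_ae ?_
    filter_upwards [measure_eq_zero_iff_ae_notMem.1 hM] with x hx
    have h4 : x ≤ M := (not_le.1 hx).le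
    have h5 : 0 ≤ meanR p ^ j * l n := mul_nonneg (pow_nonneg hp.meanR_pos.le j) (hl0 n).le
    gcongr
  have hreal : ∀ j : ℕ, (k / meanR p) ^ j * Real.log 2 ≤ l n * M := by
    intro j
    have h3 := (hlow j).trans (hup j)
    have h4 : ((2 : ℝ≥0∞) ^ k ^ j) = ENNReal.ofReal (2 ^ k ^ j) := by
      rw [ENNReal.ofReal_pow (by norm_num)]; simp
    rw [h4, ENNReal.ofReal_le_ofReal_iff (Real.exp_pos _).le] at h3
    have h5 := Real.log_le_log (by positivity) h3
    rw [Real.log_exp, Real.log_pow] at h5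
    push_cast at h5
    rw [div_pow, div_mul_eq_mul_div, div_le_iff₀ (pow_pos hp.meanR_pos j)]
    linarith
  have hlog : 0 < Real.log 2 := Real.log_pos (by norm_num)
  obtain ⟨j, hj⟩ := pow_unbounded_of_one_lt (l n * M / Real.log 2)
    ((one_lt_div hp.meanR_pos).2 hk)
  rw [div_lt_iff₀ hlog] at hj
  linarith [hreal j]

/-- If λ_c is finite, the numerator is bounded and the denominator tends to ∞. If λ_c = ∞, the
denominator is at least P(W ≥ K + 1) exp(l(K + 1)), and this probability is positive. -/
theorem IsSenetaHeyde.tendsto_exp_div_lap {p : PMF ℕ} (hp : IsSupercritical p) {c : ℕ → ℝ}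
    (hc : IsSenetaHeyde p c) {l : ℕ → ℝ} (hl : StrictMono l)
    (hlim : Tendsto (fun n => (l n : EReal)) atTop (𝓝 (lambdaC p c))) (hl0 : ∀ n, 0 < l n)
    (hlt : ∀ n, (l n : EReal) < lambdaC p c) (K : ℝ) :
    Tendsto (fun n => ENNReal.ofReal (Real.exp (l n * K)) / lap (limLaw p c) (l n)) atTop (𝓝 0) := by
  have h1 := tendsto_expMoment p c hl hlim hlt 0
  rw [hc.expMoment_lambdaC hp] at h1
  simp only [expMoment_coe, pow_zero, div_one] at h1
  induction hL : lambdaC p c using EReal.rec with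
  | bot => exact absurd (hL ▸ hlt 0) not_lt_bot
  | coe L =>
    have h2 : Tendsto (fun n => ENNReal.ofReal (Real.exp (L * |K|)) / lap (limLaw p c) (l n)) atTop
        (𝓝 0) := by
      have := ENNReal.Tendsto.const_div h1 (Or.inr ENNReal.ofReal_ne_top)
        (a := ENNReal.ofReal (Real.exp (L * |K|)))
      rwa [ENNReal.div_top] at this
    refine tendsto_of_tendsto_of_tendsto_of_le_of_le tendsto_const_nhds h2 (fun n => bot_le)
      fun n => ENNReal.div_le_div_right (ENNReal.ofReal_le_ofReal (Real.exp_le_exp.2 ?_)) _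
    have h3 := hlt n
    rw [hL, EReal.coe_lt_coe_iff] at h3
    exact (mul_le_mul_of_nonneg_left (le_abs_self K) (hl0 n).le).trans
      (mul_le_mul_of_nonneg_right h3.le (abs_nonneg K))
  | top =>
    have hm := hc.limLaw_Ici_ne_zero hp (K + 1)
    have hlR : Tendsto l atTop atTop := by
      rw [hL] at hlim
      exact EReal.tendsto_coe_nhds_top_iff.1 hlim
    have h2 : Tendsto (fun n => ENNReal.ofReal (Real.exp (-(l n))) * (limLaw p c (Set.Ici (K + 1)))⁻¹)
        atTop (𝓝 0) := by
      have h3 := ENNReal.tendsto_ofReal (Real.tendsto_exp_neg_atTop_nhds_zero.comp hlR)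
      have := ENNReal.Tendsto.mul_const h3 (b := (limLaw p c (Set.Ici (K + 1)))⁻¹)
        (Or.inr (ENNReal.inv_ne_top.2 hm))
      simpa using this
    refine tendsto_of_tendsto_of_tendsto_of_le_of_le tendsto_const_nhds h2 (fun n => bot_le)
      fun n => ?_
    have h4 : ENNReal.ofReal (Real.exp (l n * (K + 1))) * limLaw p c (Set.Ici (K + 1))
        ≤ lap (limLaw p c) (l n) := by
      rw [← setLIntegral_const, ← lintegral_indicator measurableSet_Ici]
      refine lintegral_mono fun x => Set.indicator_apply_le' (fun hx => ?_) fun _ => bot_le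
      have h5 : K + 1 ≤ x := hx
      have := (hl0 n).le
      gcongr
    have h6 : limLaw p c (Set.Ici (K + 1)) ≠ ∞ := measure_ne_top _ _
    refine ENNReal.div_le_of_le_mul ?_
    calc ENNReal.ofReal (Real.exp (l n * K))
        = ENNReal.ofReal (Real.exp (-(l n))) * ENNReal.ofReal (Real.exp (l n * (K + 1)))
            * ((limLaw p c (Set.Ici (K + 1)))⁻¹ * limLaw p c (Set.Ici (K + 1))) := by
          rw [ENNReal.inv_mul_cancel hm h6, mul_one, ← ENNReal.ofReal_mul (Real.exp_pos _).le,
            ← Real.exp_add]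
          congr 2
          ring
      _ = ENNReal.ofReal (Real.exp (-(l n))) * (limLaw p c (Set.Ici (K + 1)))⁻¹
            * (ENNReal.ofReal (Real.exp (l n * (K + 1))) * limLaw p c (Set.Ici (K + 1))) := by ring
      _ ≤ _ := mul_le_mul' le_rfl h4

/-! ### Convergence of the offspring distributions -/

theorem map_natCast_apply (q : PMF ℕ) (k : ℕ) : (q.map fun n : ℕ => (n : ℕ∞)) (k : ℕ∞) = q k := by
  rw [PMF.map_apply, tsum_eq_single k]
  · simp
  · intro j hj
    rw [if_neg]
    simpa using hj.symm

/-- A clopen set that avoids ∞ is a finite set of integers. One that contains ∞ is handled through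
its complement, which accounts for the mass escaping to infinity. -/
theorem tendsto_toMeasure_of_isClopen {P : ℕ → PMF ℕ∞} {Q : PMF ℕ∞}
    (h : ∀ k : ℕ, Tendsto (fun n => P n (k : ℕ∞)) atTop (𝓝 (Q (k : ℕ∞)))) {C : Set ℕ∞}
    (hC : IsClopen C) : Tendsto (fun n => (P n).toMeasure C) atTop (𝓝 (Q.toMeasure C)) := by
  have key : ∀ C : Set ℕ∞, IsClopen C → ⊤ ∉ C →
      Tendsto (fun n => (P n).toMeasure C) atTop (𝓝 (Q.toMeasure C)) := by
    classical
    intro C hC htop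
    obtain ⟨N, hN⟩ := eventually_atTop.1 (ENat.tendsto_natCast_nhds_top.eventually
      (hC.compl.isOpen.mem_nhds htop))
    obtain ⟨S, hS⟩ : ∃ S : Finset ℕ, C = (S.image fun n : ℕ => (n : ℕ∞) : Finset ℕ∞) := by
      refine ⟨(Finset.range N).filter fun n => (n : ℕ∞) ∈ C, ?_⟩
      ext x
      simp only [Finset.coe_image, Finset.coe_filter, Finset.mem_range, Set.mem_image]
      constructor
      · intro hx
        induction x using ENat.recTopCoe with
        | top => exact absurd hx htop
        | coe n =>
          refine ⟨n, ⟨?_, hx⟩, rfl⟩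
          by_contra! hn
          exact hN n hn hx
      · rintro ⟨n, hn, rfl⟩
        exact hn.2
    simp only [hS, PMF.toMeasure_apply_finset]
    refine tendsto_finsetSum _ fun x hx => ?_
    obtain ⟨n, -, rfl⟩ := Finset.mem_image.1 hx
    exact h n
  by_cases htop : ⊤ ∈ C
  · have h1 : ∀ R : PMF ℕ∞, R.toMeasure C = 1 - R.toMeasure Cᶜ := fun R => by
      rw [prob_compl_eq_one_sub hC.isOpen.measurableSet,
        ENNReal.sub_sub_cancel ENNReal.one_ne_top prob_le_one]
    simp only [h1]
    exact ENNReal.Tendsto.sub tendsto_const_nhds (key Cᶜ hC.compl (by simpa using htop))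
      (Or.inl ENNReal.one_ne_top)
  · exact key C hC htop

theorem tendsto_zero_of_pow_tendsto_zero {s : ℕ → ℝ≥0∞} {m : ℕ} (hm : m ≠ 0)
    (h : Tendsto (fun n => s n ^ m) atTop (𝓝 0)) : Tendsto s atTop (𝓝 0) := by
  rw [ENNReal.tendsto_nhds_zero] at h ⊢
  intro ε hε
  filter_upwards [h (ε ^ m) (by positivity)] with n hn
  by_contra! hlt
  exact absurd (ENNReal.pow_lt_pow_left hm hlt) (not_lt.2 hn)

/-- Since f(x) ≥ p(j) x^j with j > k, the numerator is of smaller order as soon as f(x_n) → ∞,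
whether x_n tends to ∞ or to a finite R_c. Raising to the power k + 1 avoids fractional exponents.
-/
theorem tendsto_pow_div_genFun {p : PMF ℕ} {k j : ℕ} (hkj : k < j) (hj : p j ≠ 0) {x : ℕ → ℝ≥0∞}
    (hx : ∀ n, 1 ≤ x n) (hfin : ∀ n, genFun p (x n) ≠ ∞)
    (h : Tendsto (fun n => genFun p (x n)) atTop (𝓝 ∞)) :
    Tendsto (fun n => x n ^ k / genFun p (x n)) atTop (𝓝 0) := by
  refine tendsto_zero_of_pow_tendsto_zero k.succ_ne_zero ?_
  have h1 : Tendsto (fun n => ((p j)⁻¹) ^ k * (genFun p (x n))⁻¹) atTop (𝓝 0) := by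
    have := ENNReal.Tendsto.const_mul (tendsto_inv_iff.2 h) (a := ((p j)⁻¹) ^ k)
      (Or.inr (ENNReal.pow_ne_top (ENNReal.inv_ne_top.2 hj)))
    simpa using this
  refine tendsto_of_tendsto_of_tendsto_of_le_of_le tendsto_const_nhds h1 (fun n => bot_le)
    fun n => ?_
  have hy0 : genFun p (x n) ≠ 0 := by
    have : p j * x n ^ j ≤ genFun p (x n) := ENNReal.le_tsum j
    intro h0
    rw [h0] at this
    have := mul_eq_zero.1 (le_antisymm this bot_le)
    rcases this with h2 | h2
    · exact hj h2
    · exact (zero_lt_one.trans_le (hx n)).ne' (pow_eq_zero_iff (by omega) |>.1 h2)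
  have h2 : x n ^ (k + 1) ≤ (p j)⁻¹ * genFun p (x n) := by
    calc x n ^ (k + 1) = (p j)⁻¹ * (p j * x n ^ (k + 1)) := by
          rw [← mul_assoc, ENNReal.inv_mul_cancel hj (p.apply_ne_top j), one_mul]
      _ ≤ (p j)⁻¹ * (p j * x n ^ j) := by
          gcongr
          · exact hx n
          · exact hkj
      _ ≤ (p j)⁻¹ * genFun p (x n) := mul_le_mul' le_rfl (ENNReal.le_tsum j)
  have hyt := hfin n
  generalize genFun p (x n) = y at *
  calc (x n ^ k / y) ^ (k + 1) = (x n ^ (k + 1)) ^ k * (y⁻¹) ^ (k + 1) := by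
        rw [div_eq_mul_inv, mul_pow, ← pow_mul, ← pow_mul, mul_comm k]
    _ ≤ ((p j)⁻¹ * y) ^ k * (y⁻¹) ^ (k + 1) := by gcongr
    _ = ((p j)⁻¹) ^ k * ((y * y⁻¹) ^ k * y⁻¹) := by rw [mul_pow, mul_pow, pow_succ]; ring
    _ = ((p j)⁻¹) ^ k * y⁻¹ := by rw [ENNReal.mul_inv_cancel hy0 hyt, one_pow, one_mul]

theorem exists_lt_of_lt_upperBd {p : PMF ℕ} {k : ℕ} (h : (k : ℕ∞) < upperBd p) :
    ∃ j, k < j ∧ p j ≠ 0 := by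
  rw [upperBd] at h
  obtain ⟨j, hj⟩ := lt_iSup_iff.1 h
  obtain ⟨hpj, hj⟩ := lt_iSup_iff.1 hj
  exact ⟨j, by exact_mod_cast hj, hpj⟩

theorem apply_eq_zero_of_upperBd_lt {p : PMF ℕ} {k : ℕ} (h : upperBd p < k) : p k = 0 := by
  by_contra hk
  exact absurd (le_iSup₂ (f := fun (n : ℕ) (_ : n ∈ {n | p n ≠ 0}) => (n : ℕ∞)) k hk)
    (not_le.2 h)

/-- If ζ_h is finite at λ_c, this is continuity of the weights. If it is infinite, then f(ζ_{h+1}) =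
ζ_h tends to ∞ along the sequence and every k < 𝔟 loses its mass, so that the limit is the Dirac
mass at 𝔟, possibly at ∞. -/
theorem IsSenetaHeyde.tendsto_tiltedOffspring {p : PMF ℕ} (hp : IsSupercritical p) {c : ℕ → ℝ}
    (hc : IsSenetaHeyde p c) {l : ℕ → ℝ} (hl : StrictMono l)
    (hlim : Tendsto (fun n => (l n : EReal)) atTop (𝓝 (lambdaC p c))) (hl0 : ∀ n, 0 < l n)
    (hlt : ∀ n, (l n : EReal) < lambdaC p c) (hfin : ∀ n, lap (limLaw p c) (l n) ≠ ∞) (h k : ℕ) :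
    Tendsto (fun n => tiltedOffspring p c (l n) h (k : ℕ∞)) atTop
      (𝓝 (tiltedOffspring p c (lambdaC p c) h (k : ℕ∞))) := by
  have hfin' : ∀ n h, lap (limLaw p c) (l n / meanR p ^ h) ≠ ∞ := fun n h =>
    ne_top_of_le_ne_top (hfin n) (lap_limLaw_mono p c
      (div_le_self (hl0 n).le (one_le_pow₀ hp.one_lt_meanR.le)))
  have hone : ∀ n h, 1 ≤ lap (limLaw p c) (l n / meanR p ^ h) := fun n h =>
    one_le_lap p c (div_nonneg (hl0 n).le (pow_pos hp.meanR_pos h).le)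
  have hx := tendsto_expMoment p c hl hlim hlt (h + 1)
  have hy := tendsto_expMoment p c hl hlim hlt h
  simp only [expMoment_coe] at hx hy
  choose q hq hqk using fun n => hc.tiltedOffspring_eq_map hp (hl0 n).le (hfin' n h)
  simp only [hq, map_natCast_apply]
  by_cases htop : expMoment p c (lambdaC p c) h = ∞
  · rw [tiltedOffspring, if_pos htop, PMF.pure_apply]
    rw [htop] at hy
    have hgen : ∀ n, lap (limLaw p c) (l n / meanR p ^ h)
        = genFun p (lap (limLaw p c) (l n / meanR p ^ (h + 1))) := fun n => by
      rw [hc.genFun_lap hp, hp.div_meanR_pow_succ]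
    have hzero : ∀ k : ℕ, (k : ℕ∞) < upperBd p → Tendsto (fun n => q n k) atTop (𝓝 0) := by
      intro k hk
      obtain ⟨j, hkj, hj⟩ := exists_lt_of_lt_upperBd hk
      have h1 := tendsto_pow_div_genFun hkj hj (fun n => hone n (h + 1))
        (fun n => hgen n ▸ hfin' n h) (by simpa only [← hgen] using hy)
      have h2 := ENNReal.Tendsto.mul_const h1 (b := p k) (Or.inr (p.apply_ne_top k))
      simpa only [hqk, hgen, zero_mul] using h2
    rcases lt_trichotomy (k : ℕ∞) (upperBd p) with hk | hk | hk
    · rw [if_neg hk.ne]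
      exact hzero k hk
    · rw [if_pos hk]
      -- When 𝔟 = k is finite it carries all the mass not carried by smaller integers.
      have h1 : ∀ n, q n k = 1 - ∑ j ∈ Finset.range k, q n j := by
        intro n
        have h2 := (q n).tsum_coe
        rw [tsum_eq_sum (s := Finset.range (k + 1)), Finset.sum_range_succ] at h2
        · refine ENNReal.eq_sub_of_add_eq ?_ (by rw [add_comm]; exact h2)
          exact ENNReal.sum_ne_top.2 fun j _ => (q n).apply_ne_top j
        · intro j hj
          have h3 : upperBd p < (j : ℕ∞) := by
            rw [← hk]
            simp only [Finset.mem_range] at hj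
            exact_mod_cast (by omega : k < j)
          rw [hqk, apply_eq_zero_of_upperBd_lt h3, mul_zero]
      simp only [h1]
      have h4 : Tendsto (fun n => ∑ j ∈ Finset.range k, q n j) atTop
          (𝓝 (∑ j ∈ Finset.range k, 0)) := by
        refine tendsto_finsetSum _ fun j hj => hzero j ?_
        rw [← hk]
        exact_mod_cast Finset.mem_range.1 hj
      have h5 := ENNReal.Tendsto.sub (tendsto_const_nhds (x := (1 : ℝ≥0∞))) h4
        (Or.inl ENNReal.one_ne_top)
      simpa using h5
    · rw [if_neg hk.ne']
      simp only [hqk, apply_eq_zero_of_upperBd_lt hk, mul_zero]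
      exact tendsto_const_nhds
  · induction hL : lambdaC p c using EReal.rec with
    | bot => exact absurd (hL ▸ hlt 0) not_lt_bot
    | top =>
      rw [hL] at htop
      exact absurd (hc.expMoment_top hp h) htop
    | coe L =>
      have hL0 : 0 < L := (hl0 0).trans (by
        have := hlt 0
        rwa [hL, EReal.coe_lt_coe_iff] at this)
      rw [hL, expMoment_coe] at hx hy htop
      obtain ⟨q', hq', hqk'⟩ := hc.tiltedOffspring_eq_map hp hL0.le htop
      rw [hq', map_natCast_apply]
      simp only [hqk, hqk']
      have hx' : lap (limLaw p c) (L / meanR p ^ (h + 1)) ≠ ∞ :=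
        ne_top_of_le_ne_top htop (lap_limLaw_mono p c (hp.div_meanR_pow_le hL0.le h))
      have hy' : lap (limLaw p c) (L / meanR p ^ h) ≠ 0 := (zero_lt_one.trans_le
        (one_le_lap p c (div_nonneg hL0.le (pow_pos hp.meanR_pos h).le))).ne'
      exact ENNReal.Tendsto.mul_const (ENNReal.Tendsto.div (ENNReal.Tendsto.pow hx) (Or.inr hy') hy
        (Or.inr (ENNReal.pow_ne_top hx'))) (Or.inr (p.apply_ne_top k))

/-! ### Passage to the limit. -/

theorem tendsto_measure_of_isClopen {P : ℝ → ProbabilityMeasure PlaneTree}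
    {Q : ProbabilityMeasure PlaneTree} (h : Tendsto P atTop (𝓝 Q)) {E : Set PlaneTree}
    (hE : IsClopen E) : Tendsto (fun θ => (P θ : Measure PlaneTree) E) atTop
      (𝓝 ((Q : Measure PlaneTree) E)) := by
  have h1 := ProbabilityMeasure.tendsto_iff_forall_integral_tendsto.1 h
    (BoundedContinuousFunction.indicator E hE)
  have h2 : ∀ R : ProbabilityMeasure PlaneTree,
      (R : Measure PlaneTree) E = ENNReal.ofReal (∫ t, BoundedContinuousFunction.indicator E hE t
        ∂(R : Measure PlaneTree)) := by
    intro R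
    have : IsProbabilityMeasure R.1 := R.2
    have h3 : ∫ t, E.indicator (1 : PlaneTree → ℝ) t ∂(R : Measure PlaneTree) = R.1.real E :=
      integral_indicator_one hE.isOpen.measurableSet
    exact ((congrArg ENNReal.ofReal h3).trans ofReal_measureReal).symm
  simp only [h2]
  exact ENNReal.tendsto_ofReal h1

/-- The mixture formula is split at θ = K. Above K, P(τ^θ ∈ E) is within ε of x. Below K, the weight
exp(lθ) is at most exp(lK) and w has total mass at most 1. The constant 1 bounds the extinct part.
Both inequalities are kept additive, to avoid subtraction in [0, ∞]. -/
theorem IsSenetaHeyde.tiltedLaw_bounds {p : PMF ℕ} (hp : IsSupercritical p) {c : ℕ → ℝ}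
    (hc : IsSenetaHeyde p c) {l : ℝ} (hl : 0 ≤ l) (hfin : lap (limLaw p c) l ≠ ∞)
    {F : Finset (List ℕ)} {C : List ℕ → Set ℕ∞} (hF : IsFramed F C) {x ε : ℝ≥0∞} (hx : x ≤ 1)
    {K : ℝ}
    (hup : ∀ θ, K ≤ θ → (extremalLaw p c θ : Measure PlaneTree) (boxEvent F C) ≤ x + ε)
    (hlow : ∀ θ, K ≤ θ → x ≤ (extremalLaw p c θ : Measure PlaneTree) (boxEvent F C) + ε) :
    lap (limLaw p c) l * (tiltedLaw p c l : Measure PlaneTree) (boxEvent F C)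
        ≤ lap (limLaw p c) l * (x + ε) + (1 + ENNReal.ofReal (Real.exp (l * K))) ∧
      lap (limLaw p c) l * x ≤ lap (limLaw p c) l *
        ((tiltedLaw p c l : Measure PlaneTree) (boxEvent F C) + ε)
          + (1 + ENNReal.ofReal (Real.exp (l * K))) := by
  obtain ⟨a, ha, h⟩ := hc.lintegral_exp_mul_extremalLaw hp hl hfin hF
  have ha1 : a ≤ 1 := ha.trans (extProb_le_one p)
  have hle1 : ∀ θ, (extremalLaw p c θ : Measure PlaneTree) (boxEvent F C) ≤ 1 := fun θ => by
    have : IsProbabilityMeasure (extremalLaw p c θ).1 := (extremalLaw p c θ).2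
    exact prob_le_one
  let e : ℝ → ℝ≥0∞ := fun θ => ENNReal.ofReal (Real.exp (l * θ)) * dens p c θ
  have he : Measurable e := (measurable_exp_mul l).mul (measurable_dens p c)
  have heI : ∫⁻ θ in Set.Ioi 0, e θ = densLap p c l := rfl
  have hsmall : ∫⁻ θ in Set.Ioi 0, ENNReal.ofReal (Real.exp (l * K)) * dens p c θ
      ≤ ENNReal.ofReal (Real.exp (l * K)) := by
    rw [lintegral_const_mul _ (measurable_dens p c)]
    refine mul_le_of_le_one_right' ?_
    simpa [densLap] using hc.densLap_le_one hp (le_refl 0)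
  have hexp : ∀ θ, θ ≤ K → e θ ≤ ENNReal.ofReal (Real.exp (l * K)) * dens p c θ := fun θ hθ => by
    simp only [e]
    gcongr
  have hdle : densLap p c l ≤ lap (limLaw p c) l := by
    rw [hc.lap_limLaw_eq_add hp]
    exact le_add_self
  have hmeas : Measurable fun θ => ENNReal.ofReal (Real.exp (l * K)) * dens p c θ :=
    (measurable_dens p c).const_mul _
  constructor
  · rw [← h]
    calc a + ∫⁻ θ in Set.Ioi 0, ENNReal.ofReal (Real.exp (l * θ)) *
          (dens p c θ * (extremalLaw p c θ : Measure PlaneTree) (boxEvent F C))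
        ≤ 1 + ∫⁻ θ in Set.Ioi 0, (e θ * (x + ε)
          + ENNReal.ofReal (Real.exp (l * K)) * dens p c θ) := by
          refine add_le_add ha1 (lintegral_mono fun θ => ?_)
          rw [← mul_assoc]
          change e θ * _ ≤ _
          rcases le_total θ K with hθ | hθ
          · exact ((mul_le_of_le_one_right' (hle1 θ)).trans (hexp θ hθ)).trans le_add_self
          · exact (mul_le_mul' le_rfl (hup θ hθ)).trans le_self_add
      _ = 1 + (densLap p c l * (x + ε)
          + ∫⁻ θ in Set.Ioi 0, ENNReal.ofReal (Real.exp (l * K)) * dens p c θ) := by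
          rw [lintegral_add_right _ hmeas, lintegral_mul_const _ he, heI]
      _ ≤ 1 + (lap (limLaw p c) l * (x + ε) + ENNReal.ofReal (Real.exp (l * K))) := by gcongr
      _ = _ := by ring
  · calc lap (limLaw p c) l * x = extProb p * x + ∫⁻ θ in Set.Ioi 0, e θ * x := by
          rw [lintegral_mul_const _ he, heI, hc.lap_limLaw_eq_add hp, add_mul]
      _ ≤ 1 + ∫⁻ θ in Set.Ioi 0, (ENNReal.ofReal (Real.exp (l * θ)) *
          (dens p c θ * (extremalLaw p c θ : Measure PlaneTree) (boxEvent F C)) + (e θ * ε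
          + ENNReal.ofReal (Real.exp (l * K)) * dens p c θ)) := by
          refine add_le_add (mul_le_one' (extProb_le_one p) hx) (lintegral_mono fun θ => ?_)
          rw [← mul_assoc (ENNReal.ofReal (Real.exp (l * θ)))]
          change e θ * x ≤ e θ * _ + _
          rcases le_total θ K with hθ | hθ
          · exact ((mul_le_of_le_one_right' hx).trans (hexp θ hθ)).trans
              (le_add_self.trans le_add_self)
          · refine (mul_le_mul' le_rfl (hlow θ hθ)).trans ?_
            rw [mul_add]
            gcongr
            exact le_self_add
      _ = 1 + ((∫⁻ θ in Set.Ioi 0, ENNReal.ofReal (Real.exp (l * θ)) *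
          (dens p c θ * (extremalLaw p c θ : Measure PlaneTree) (boxEvent F C)))
          + (densLap p c l * ε
            + ∫⁻ θ in Set.Ioi 0, ENNReal.ofReal (Real.exp (l * K)) * dens p c θ)) := by
          have hmeas' : Measurable fun θ => e θ * ε
              + ENNReal.ofReal (Real.exp (l * K)) * dens p c θ := (he.mul_const ε).add hmeas
          rw [lintegral_add_right _ hmeas', lintegral_add_right _ hmeas,
            lintegral_mul_const _ he, heI]
      _ ≤ 1 + (lap (limLaw p c) l * (tiltedLaw p c l : Measure PlaneTree) (boxEvent F C)
          + (lap (limLaw p c) l * ε + ENNReal.ofReal (Real.exp (l * K)))) := by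
          rw [← h]
          gcongr
          exact le_add_self
      _ = _ := by ring

/-- After division by E[exp(l_n W)] the error terms of `IsSenetaHeyde.tiltedLaw_bounds` tend to 0,
with K fixed first according to the convergence of τ^θ. -/
theorem IsSenetaHeyde.tendsto_tiltedLaw {p : PMF ℕ} (hp : IsSupercritical p) {c : ℕ → ℝ}
    (hc : IsSenetaHeyde p c) {l : ℕ → ℝ} (hl : StrictMono l)
    (hlim : Tendsto (fun n => (l n : EReal)) atTop (𝓝 (lambdaC p c))) (hl0 : ∀ n, 0 < l n)
    (hlt : ∀ n, (l n : EReal) < lambdaC p c) (hfin : ∀ n, lap (limLaw p c) (l n) ≠ ∞)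
    {ν : ProbabilityMeasure PlaneTree} (hν : Tendsto (extremalLaw p c) atTop (𝓝 ν))
    {F : Finset (List ℕ)} {C : List ℕ → Set ℕ∞} (hF : IsFramed F C) :
    Tendsto (fun n => (tiltedLaw p c (l n) : Measure PlaneTree) (boxEvent F C)) atTop
      (𝓝 ((ν : Measure PlaneTree) (boxEvent F C))) := by
  have : IsProbabilityMeasure ν.1 := ν.2
  have hlimE := tendsto_measure_of_isClopen hν (isClopen_boxEvent (F := F) hF.isClopen)
  have hx : (ν : Measure PlaneTree) (boxEvent F C) ≤ 1 := prob_le_one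
  generalize (ν : Measure PlaneTree) (boxEvent F C) = x at *
  have hxt : x ≠ ∞ := (hx.trans_lt ENNReal.one_lt_top).ne
  rw [ENNReal.tendsto_nhds hxt] at hlimE ⊢
  intro ε hε
  have hε2 : 0 < ε / 2 := ENNReal.half_pos hε.ne'
  obtain ⟨K, hK⟩ := eventually_atTop.1 (hlimE (ε / 2) hε2)
  have h0 : Tendsto (fun n => (1 + ENNReal.ofReal (Real.exp (l n * K))) / lap (limLaw p c) (l n))
      atTop (𝓝 0) := by
    have h1 := (hc.tendsto_exp_div_lap hp hl hlim hl0 hlt 0).add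
      (hc.tendsto_exp_div_lap hp hl hlim hl0 hlt K)
    simpa [ENNReal.add_div] using h1
  filter_upwards [ENNReal.tendsto_nhds_zero.1 h0 (ε / 2) hε2] with n hn
  have hb := hc.tiltedLaw_bounds hp (hl0 n).le (hfin n) hF hx (fun θ hθ => (hK θ hθ).2)
    (fun θ hθ => tsub_le_iff_right.1 (hK θ hθ).1)
  have hφ0 : lap (limLaw p c) (l n) ≠ 0 :=
    (zero_lt_one.trans_le (one_le_lap p c (hl0 n).le)).ne'
  have hφ := hfin n
  rw [ENNReal.div_le_iff hφ0 hφ] at hn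
  generalize lap (limLaw p c) (l n) = φ at *
  generalize (tiltedLaw p c (l n) : Measure PlaneTree) (boxEvent F C) = y at *
  constructor
  · rw [tsub_le_iff_right, ← ENNReal.mul_le_mul_iff_right hφ0 hφ]
    refine (hb.2.trans (add_le_add_right hn _)).trans_eq ?_
    rw [mul_comm (ε / 2), ← mul_add, add_assoc, ENNReal.add_halves]
  · rw [← ENNReal.mul_le_mul_iff_right hφ0 hφ]
    refine (hb.1.trans (add_le_add_right hn _)).trans_eq ?_
    rw [mul_comm (ε / 2), ← mul_add, add_assoc, ENNReal.add_halves]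

end GWTree

end

theorem corollary8p6 (p : PMF ℕ)
    (hnondeg : (GWTree.lowerBd p : ℕ∞) < GWTree.upperBd p)
    (hsuper : 1 < GWTree.mean p) (hmean : GWTree.mean p < ∞)
    (hblow : GWTree.genFun p (GWTree.radius p) = ∞)
    (c : ℕ → ℝ) (hc : GWTree.IsSenetaHeyde p c)
    (ν : ProbabilityMeasure GWTree.PlaneTree)
    (hν : Tendsto (fun θ : ℝ => GWTree.extremalLaw p c θ) atTop (𝓝 ν)) :
    ν = GWTree.tauInftyLaw p c := by
  have hp : GWTree.IsSupercritical p := ⟨hnondeg, hsuper, hmean, hblow⟩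
  obtain ⟨l, hl, hl0, hfin, hlt, hlim⟩ := hc.exists_seq_lambdaC hp
  refine GWTree.probabilityMeasure_ext_of_framed fun F C hF => ?_
  -- Along l_n ↑ λ_c the probability of the event under T^(l_n) tends to its value under ν. It also
  -- tends to its value under τ^∞, as a finite product of convergent factors.
  refine tendsto_nhds_unique (hc.tendsto_tiltedLaw hp hl hlim hl0 hlt hfin hν hF) ?_
  simp only [GWTree.tauInftyLaw, GWTree.tiltedLaw, GWTree.gwLaw_boxEvent _ hF]
  refine ENNReal.tendsto_finsetProd_of_ne_top _ (fun u _ => ?_) fun u _ => measure_ne_top _ _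
  exact GWTree.tendsto_toMeasure_of_isClopen
    (hc.tendsto_tiltedOffspring hp hl hlim hl0 hlt hfin u.length) (hF.isClopen u)
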